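/- For a graph $H$, a vertex set $S$ of a finite simple graph $G$ is an *$H$-free modulator* of $G$ if deleting $S$ from $G$ leaves a graph with no induced subgraph isomorphic to $H$. Let $K_3$ be the triangle and $\overline{K_3}$ the graph consisting of three pairwise non-adjacent vertices. (i) Given a graph $G$ on $n$ vertices, a $\overline{K_3}$-free modulator $S$ of $G$ of size $p$, and any positive integer $k$, the $k$-Coloring problem (does $G$ have a proper coloring with at most $k$ colors?) can be solved in randomized $O^*(2^p)$ time. (ii) Equivalently, by passing to the complement graph, given a graph $G$ on $n$ vertices, a $K_3$-free modulator $S$ of $G$ of size $p$, and any positive integer $k$, the $k$-Clique Cover problem (is there a collection of at most $k$ pairwise vertex-disjoint cliques of $G$ that together contain all vertices?) can be solved in randomized $O^*(2^p)$ time. Here "solved in randomized $O^*(2^p)$ time" means: for every $c\in\mathbb{N}$ there are a single program for a random access machine with fair coin flips (logarithmic cost criterion; graphs given by adjacency matrices), a polynomial $q$ and a constant $C$ such that on every such instance the program halts within time $2^p\cdot q(n) + C\cdot(\text{bit length of } k)$ for every outcome of the coin flips, and its yes/no answer is correct with probability at least $1-(n+2)^{-c}$. -/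

import Mathlib

open scoped ENNReal

/-! ## Graph notions -/

/-- `G` is `H`-free: it has no induced subgraph isomorphic to `H`. -/
def InducedFree {α β : Type*} (H : SimpleGraph α) (G : SimpleGraph β) : Prop :=
  ¬ H.IsIndContained G

/-- `S` is an `H`-free modulator of `G`: deleting the vertices of `S` from `G` leaves an
`H`-free graph. -/
def IsFreeModulator {α β : Type*} (H : SimpleGraph α) (G : SimpleGraph β) (S : Finset β) : Prop :=
  InducedFree H (G.induce {v : β | v ∉ S})

/-- `G` has a clique cover of size at most `k`: a collection of at most `k` pairwise disjoint
cliques which together contain every vertex. -/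
def HasCliqueCover {V : Type*} (G : SimpleGraph V) (k : ℕ) : Prop :=
  ∃ C : Finset (Finset V),
    (∀ A ∈ C, G.IsClique (A : Set V)) ∧
    (C : Set (Finset V)).PairwiseDisjoint id ∧
    (∀ v : V, ∃ A ∈ C, v ∈ A) ∧
    C.card ≤ k

/-! ## Random access machines with coin flips and logarithmic cost

A machine has registers `0, 1, 2, …`, of which a program mentions only finitely many, and a
random access memory. Registers and memory cells hold natural numbers. Every elementary operation
is charged one unit plus the bit lengths of all numbers (operands and addresses) it handles. -/

namespace RAM

/-- Arithmetic operations. -/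
inductive Op
  | add | sub | mul | div

/-- Subtraction is truncated at `0`, division rounds down (and division by `0` gives `0`). -/
def Op.app : Op → ℕ → ℕ → ℕ
  | .add, a, b => a + b
  | .sub, a, b => a - b
  | .mul, a, b => a * b
  | .div, a, b => a / b

/-- Expressions: constants, registers, the memory cell at a computed address, arithmetic. -/
inductive Exp
  | lit (c : ℕ)
  | reg (i : ℕ)
  | mem (a : Exp)
  | bin (o : Op) (a b : Exp)

/-- Programs. A test succeeds when its value is nonzero. -/
inductive Prog
  | skip
  | assign (i : ℕ) (e : Exp)
  | store (a e : Exp)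
  | flip (i : ℕ)
  | seq (P Q : Prog)
  | cond (e : Exp) (P Q : Prog)
  | loop (e : Exp) (P : Prog)

/-- Machine states: the registers, the memory, and the number of coins flipped so far. -/
structure State where
  reg : ℕ → ℕ
  mem : ℕ → ℕ
  coins : ℕ

/-- The value of an expression in a state. -/
def Exp.val (s : State) : Exp → ℕ
  | .lit c => c
  | .reg i => s.reg i
  | .mem a => s.mem (a.val s)
  | .bin o a b => o.app (a.val s) (b.val s)

/-- The logarithmic cost of evaluating an expression; `Nat.size` is the bit length. -/
def Exp.cost (s : State) : Exp → ℕ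
  | .lit c => 1 + c.size
  | .reg i => 1 + (s.reg i).size
  | .mem a => a.cost s + (1 + (a.val s).size + (s.mem (a.val s)).size)
  | .bin _ a b => a.cost s + b.cost s + (1 + (a.val s).size + (b.val s).size)

/-- Assign the value `x` to register `i`. -/
def State.setReg (s : State) (i x : ℕ) : State :=
  { s with reg := Function.update s.reg i x }

/-- Write the value `x` to memory cell `a`. -/
def State.setMem (s : State) (a x : ℕ) : State :=
  { s with mem := Function.update s.mem a x }

/-- Put the outcome of the next coin of the coin sequence `ω` into register `i`. -/
def State.flipReg (ω : ℕ → Bool) (s : State) (i : ℕ) : State :=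
  { s with reg := Function.update s.reg i (ω s.coins).toNat, coins := s.coins + 1 }

/-- `Exec ω P s s' t`: with coin sequence `ω`, the program `P` started in state `s` halts in
state `s'` after a running time of `t`. -/
inductive Exec (ω : ℕ → Bool) : Prog → State → State → ℕ → Prop
  | skip (s : State) : Exec ω .skip s s 1
  | assign (i : ℕ) (e : Exp) (s : State) :
      Exec ω (.assign i e) s (s.setReg i (e.val s)) (1 + e.cost s + (e.val s).size)
  | store (a e : Exp) (s : State) :
      Exec ω (.store a e) s (s.setMem (a.val s) (e.val s))
        (1 + a.cost s + e.cost s + (a.val s).size + (e.val s).size)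
  | flip (i : ℕ) (s : State) : Exec ω (.flip i) s (s.flipReg ω i) 1
  | seq {P Q : Prog} {s s₁ s₂ : State} {t₁ t₂ : ℕ} :
      Exec ω P s s₁ t₁ → Exec ω Q s₁ s₂ t₂ → Exec ω (.seq P Q) s s₂ (t₁ + t₂)
  | condTrue {e : Exp} {P Q : Prog} {s s' : State} {t : ℕ} :
      e.val s ≠ 0 → Exec ω P s s' t → Exec ω (.cond e P Q) s s' (1 + e.cost s + t)
  | condFalse {e : Exp} {P Q : Prog} {s s' : State} {t : ℕ} :
      e.val s = 0 → Exec ω Q s s' t → Exec ω (.cond e P Q) s s' (1 + e.cost s + t)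
  | loopDone {e : Exp} {P : Prog} {s : State} :
      e.val s = 0 → Exec ω (.loop e P) s s (1 + e.cost s)
  | loopStep {e : Exp} {P : Prog} {s s₁ s₂ : State} {t₁ t₂ : ℕ} :
      e.val s ≠ 0 → Exec ω P s s₁ t₁ → Exec ω (.loop e P) s₁ s₂ t₂ →
      Exec ω (.loop e P) s s₂ (1 + e.cost s + t₁ + t₂)

/-- The final state and the running time are determined by the program, the initial state and
the coin sequence. -/
theorem Exec.unique {ω : ℕ → Bool} {P : Prog} {s s₁ s₂ : State} {t₁ t₂ : ℕ}
    (h₁ : Exec ω P s s₁ t₁) (h₂ : Exec ω P s s₂ t₂) : s₁ = s₂ ∧ t₁ = t₂ := by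
  induction h₁ generalizing s₂ t₂ with
  | skip s => cases h₂; exact ⟨rfl, rfl⟩
  | assign i e s => cases h₂; exact ⟨rfl, rfl⟩
  | store a e s => cases h₂; exact ⟨rfl, rfl⟩
  | flip i s => cases h₂; exact ⟨rfl, rfl⟩
  | seq _ _ ih₁ ih₂ =>
    cases h₂ with
    | seq g₁ g₂ =>
      obtain ⟨rfl, rfl⟩ := ih₁ g₁
      obtain ⟨rfl, rfl⟩ := ih₂ g₂
      exact ⟨rfl, rfl⟩
  | condTrue h _ ih =>
    cases h₂ with
    | condTrue _ g => obtain ⟨rfl, rfl⟩ := ih g; exact ⟨rfl, rfl⟩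
    | condFalse h' _ => exact absurd h' h
  | condFalse h _ ih =>
    cases h₂ with
    | condTrue h' _ => exact absurd h h'
    | condFalse _ g => obtain ⟨rfl, rfl⟩ := ih g; exact ⟨rfl, rfl⟩
  | loopDone h =>
    cases h₂ with
    | loopDone _ => exact ⟨rfl, rfl⟩
    | loopStep h' _ _ => exact absurd h h'
  | loopStep h _ _ ih₁ ih₂ =>
    cases h₂ with
    | loopDone h' => exact absurd h' h
    | loopStep _ g₁ g₂ =>
      obtain ⟨rfl, rfl⟩ := ih₁ g₁
      obtain ⟨rfl, rfl⟩ := ih₂ g₂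
      exact ⟨rfl, rfl⟩

/-- The distribution of an infinite sequence of independent fair coin flips. -/
noncomputable def coinMeasure : MeasureTheory.Measure (ℕ → Bool) :=
  MeasureTheory.Measure.infinitePi fun _ : ℕ => (PMF.uniformOfFintype Bool).toMeasure

/-- Started in state `s`, the program `P` halts within time `T` for every outcome of the coin
flips, and except with probability at most `ε` it leaves in register `0` the correct answer
to the question whether `A` holds (`1` for yes, `0` for no). -/
def Decides (P : Prog) (s : State) (A : Prop) (T : ℕ) (ε : ℝ≥0∞) : Prop :=
  (∀ ω : ℕ → Bool, ∃ (s' : State) (t : ℕ), Exec ω P s s' t ∧ t ≤ T) ∧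
  coinMeasure {ω : ℕ → Bool | ¬ ∃ (s' : State) (t : ℕ), Exec ω P s s' t ∧
    ((A ∧ s'.reg 0 = 1) ∨ (¬ A ∧ s'.reg 0 = 0))} ≤ ε

open Classical in
/-- The input state for a graph `G` on `{0, …, n - 1}`, a vertex set `S` and a number `k`:
register `0` holds `n` and register `1` holds `k`; memory cells `0, …, n - 1` hold the indicator
vector of `S`, the next `n * n` cells hold the adjacency matrix of `G`, row by row; all else
is `0`. -/
noncomputable def input {n : ℕ} (G : SimpleGraph (Fin n)) (S : Finset (Fin n)) (k : ℕ) : State where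
  reg i := if i = 0 then n else if i = 1 then k else 0
  mem a :=
    if (∃ v : Fin n, a = v ∧ v ∈ S) ∨ (∃ u v : Fin n, a = n + u * n + v ∧ G.Adj u v) then 1 else 0
  coins := 0

/-- The problem of deciding `A G k`, given a graph `G` on `n` vertices, a vertex set `S` of size `p`
with the promise `R G S`, and a positive integer `k`, can be solved in randomized time
`2 ^ p * poly(n)`, up to a constant times the bit length of the input number `k`: for each `c`
there is one program which does this on all instances with error probability at most
`1 / (n + 2) ^ c`. -/
def SolvableInRandomizedTwoPow
    (R : ∀ {n : ℕ}, SimpleGraph (Fin n) → Finset (Fin n) → Prop)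
    (A : ∀ {n : ℕ}, SimpleGraph (Fin n) → ℕ → Prop) : Prop :=
  ∀ c : ℕ, ∃ (P : Prog) (q : Polynomial ℕ) (C : ℕ),
    ∀ (n p k : ℕ) (G : SimpleGraph (Fin n)) (S : Finset (Fin n)),
      0 < k → S.card = p → R G S →
        Decides P (input G S k) (A G k) (2 ^ p * q.eval n + C * k.size)
          (1 / ((n : ℝ≥0∞) + 2) ^ c)

end RAM

/-! Let `K` be the graph to be covered by `k` cliques: `G` itself for clique cover, `Gᶜ` for
colouring. Outside of `S` it has no triangle, so every clique of a cover has at most two vertices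
there. Add dummy vertices adjacent to everything until exactly `2 * k` slots lie outside of `S`. A
cover then amounts to a perfect matching of these slots, together with a clique inside `S` for each
matching edge that is joined to both of its ends, such that these cliques cover `S`.

Such configurations are detected algebraically in characteristic two. For `X ⊆ S` let the symmetric
matrix `slotMatrix` have at a pair of slots an edge weight times the weighted sum of all cliques
inside `X` adjacent to both, and let the slots in `S` be fixed with diagonal entry `1`. Its hafnian
enumerates the configurations using cliques inside `X`. In the sum over all `X ⊆ S` a configuration
missing some `s ∈ S` occurs equally often with and without `s` in `X` and cancels, so a nonzero sum
yields a cover (`colorable_of_hafnianSum_ne_zero`). Conversely a cover gives weights at which the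
sum is `1` (`exists_hafnianSum_eq_one`), so the sum is a nonzero polynomial in the weights. Random
weights from `(ZMod 2)[X]` rarely annihilate it, by Schwartz–Zippel
(`coinMeasure_hafnianSum_eq_zero_le`). The error is one-sided.

Hafnians become computable because in characteristic two the determinant of such a matrix is the
square of its hafnian (`Matrix.det_eq_sq_sum_involutions`), and squaring commutes with the sum over
`X`. The determinant itself is the coefficient of `z ^ N` in an expression in walk counts that uses
only additions and multiplications (`coeff_detSeries`). Hence it can be evaluated over `ℕ`: with the
variable of the weights replaced by a power of two `B` and `z` by a power of `B`, all coefficients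
appear as digits of one natural number, and their parities decide the answer
(`exists_odd_digit_iff`).

The `2 ^ p` subsets of `S` are bit masks. Tables of clique sums, walks and partial sums of
determinant series are filled in increasing order of index; each has `2 ^ p` times polynomially many
entries of polynomial bit length. The machine part is a small term language with a compiler
(`Term.runs_compile`), whose value, bit length and running time are computed structurally. -/

namespace RAM

/-! ## Running programs within a time bound -/

/-- With coin sequence `ω`, the program `P` started in state `s` halts within time `T` in a state
satisfying `Q`. -/
def Runs (ω : ℕ → Bool) (P : Prog) (s : State) (T : ℕ) (Q : State → Prop) : Prop :=
  ∃ (s' : State) (t : ℕ), Exec ω P s s' t ∧ t ≤ T ∧ Q s'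

theorem Runs.mono {ω : ℕ → Bool} {P : Prog} {s : State} {T T' : ℕ} {Q Q' : State → Prop}
    (h : Runs ω P s T Q) (hT : T ≤ T') (hQ : ∀ s', Q s' → Q' s') : Runs ω P s T' Q' := by
  obtain ⟨s', t, he, ht, hq⟩ := h
  exact ⟨s', t, he, ht.trans hT, hQ _ hq⟩

theorem Runs.seq {ω : ℕ → Bool} {P₁ P₂ : Prog} {s : State} {T₁ T₂ : ℕ} {Q Q' : State → Prop}
    (h : Runs ω P₁ s T₁ Q) (h' : ∀ s', Q s' → Runs ω P₂ s' T₂ Q') :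
    Runs ω (.seq P₁ P₂) s (T₁ + T₂) Q' := by
  obtain ⟨s₁, t₁, he₁, ht₁, hq₁⟩ := h
  obtain ⟨s₂, t₂, he₂, ht₂, hq₂⟩ := h' _ hq₁
  exact ⟨s₂, t₁ + t₂, .seq he₁ he₂, by omega, hq₂⟩

theorem Runs.assign {ω : ℕ → Bool} {i : ℕ} {e : Exp} {s : State} {T : ℕ} {Q : State → Prop}
    (hT : 1 + e.cost s + (e.val s).size ≤ T) (hQ : Q (s.setReg i (e.val s))) :
    Runs ω (.assign i e) s T Q :=
  ⟨_, _, .assign i e s, hT, hQ⟩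

theorem Runs.cond_true {ω : ℕ → Bool} {e : Exp} {P₁ P₂ : Prog} {s : State} {T : ℕ}
    {Q : State → Prop} (he : e.val s ≠ 0) (h : Runs ω P₁ s T Q) :
    Runs ω (.cond e P₁ P₂) s (1 + e.cost s + T) Q := by
  obtain ⟨s₁, t₁, he₁, ht₁, hq₁⟩ := h
  exact ⟨s₁, _, .condTrue he he₁, by omega, hq₁⟩

theorem Runs.cond_false {ω : ℕ → Bool} {e : Exp} {P₁ P₂ : Prog} {s : State} {T : ℕ}
    {Q : State → Prop} (he : e.val s = 0) (h : Runs ω P₂ s T Q) :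
    Runs ω (.cond e P₁ P₂) s (1 + e.cost s + T) Q := by
  obtain ⟨s₁, t₁, he₁, ht₁, hq₁⟩ := h
  exact ⟨s₁, _, .condFalse he he₁, by omega, hq₁⟩

/-- A loop which runs through its body exactly `c` times, with invariant `I`. -/
theorem Runs.loop {ω : ℕ → Bool} {e : Exp} {P : Prog} {I : ℕ → State → Prop} {c g T : ℕ}
    (hstep : ∀ j s, j < c → I j s → e.val s ≠ 0 ∧ e.cost s ≤ g ∧ Runs ω P s T (I (j + 1)))
    (hdone : ∀ s, I c s → e.val s = 0 ∧ e.cost s ≤ g) {s : State} (hs : I 0 s) :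
    Runs ω (.loop e P) s ((c + 1) * (1 + g) + c * T) (I c) := by
  have key : ∀ m j s, j + m = c → I j s →
      Runs ω (.loop e P) s ((m + 1) * (1 + g) + m * T) (I c) := by
    intro m
    induction m with
    | zero =>
      intro j s hj hs
      obtain rfl : j = c := by omega
      obtain ⟨h1, h2⟩ := hdone s hs
      exact ⟨s, _, .loopDone h1, by omega, hs⟩
    | succ m ih =>
      intro j s hj hs
      obtain ⟨h1, h2, s₁, t₁, he₁, ht₁, hq₁⟩ := hstep j s (by omega) hs
      obtain ⟨s₂, t₂, he₂, ht₂, hq₂⟩ := ih (j + 1) s₁ (by omega) hq₁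
      refine ⟨s₂, _, .loopStep h1 he₁ he₂, ?_, hq₂⟩
      have : (m + 1 + 1) * (1 + g) + (m + 1) * T
        = (1 + g) + T + ((m + 1) * (1 + g) + m * T) := by ring
      omega
  exact key c 0 s (by omega) hs

theorem size_le_self (a : ℕ) : a.size ≤ a := Nat.size_le.2 Nat.lt_two_pow_self

theorem Op.size_app_le (o : Op) (a b : ℕ) : (o.app a b).size ≤ a.size + b.size + 1 := by
  have ha := Nat.lt_size_self a
  have hb := Nat.lt_size_self b
  have h1 : 2 ^ a.size ≤ 2 ^ (a.size + b.size) := Nat.pow_le_pow_right (by norm_num) (by omega)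
  have h2 : 2 ^ b.size ≤ 2 ^ (a.size + b.size) := Nat.pow_le_pow_right (by norm_num) (by omega)
  rw [Nat.size_le, pow_succ]
  cases o with
  | add => simp only [Op.app]; omega
  | sub => simp only [Op.app]; omega
  | mul =>
    have : a * b < 2 ^ (a.size + b.size) := by
      rw [pow_add]; exact Nat.mul_lt_mul'' ha hb
    simp only [Op.app]; omega
  | div =>
    have := Nat.div_le_self a b
    simp only [Op.app]; omega

/-! ## Terms: expressions with conditionals, local definitions and bounded aggregation -/

/-- Terms. In `agg o u r c b`, the operation `o` is used to accumulate, starting from `u`, the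
values of `b` while register `r` runs from `0` up to the value of register `c`. -/
inductive Term
  | lit (c : ℕ)
  | var (r : ℕ)
  | mem (a : Term)
  | bin (o : Op) (a b : Term)
  | ite (c a b : Term)
  | letIn (r : ℕ) (e b : Term)
  | agg (o : Op) (u r c : ℕ) (b : Term)

namespace Term

/-- The value of a term, for given contents of the memory and of the registers. -/
def val (μ : ℕ → ℕ) : Term → (ℕ → ℕ) → ℕ
  | lit c, _ => c
  | var r, ρ => ρ r
  | mem a, ρ => μ (a.val μ ρ)
  | bin o a b, ρ => o.app (a.val μ ρ) (b.val μ ρ)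
  | ite c a b, ρ => if c.val μ ρ = 0 then b.val μ ρ else a.val μ ρ
  | letIn r e b, ρ => b.val μ (Function.update ρ r (e.val μ ρ))
  | agg o u r c b, ρ =>
      Nat.rec u (fun j x => o.app x (b.val μ (Function.update ρ r j))) (ρ c)

/-- Well-formed terms use registers below `40` only, aggregate over registers below `7`, and
bind registers from `7` on. -/
def WF : Term → Bool
  | lit _ => true
  | var r => decide (r < 40)
  | mem a => a.WF
  | bin _ a b => a.WF && b.WF
  | ite c a b => c.WF && a.WF && b.WF
  | letIn r e b => decide (7 ≤ r) && decide (r < 40) && e.WF && b.WF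
  | agg _ _ r c b => decide (7 ≤ r) && decide (r < 40) && decide (c < 7) && b.WF

/-- A program which leaves the value of the term in register `d`, with scratch registers from `d`
on. -/
def compile : Term → ℕ → Prog
  | lit c, d => .assign d (.lit c)
  | var r, d => .assign d (.reg r)
  | mem a, d => .seq (a.compile d) (.assign d (.mem (.reg d)))
  | bin o a b, d =>
      .seq (a.compile d) (.seq (b.compile (d + 1)) (.assign d (.bin o (.reg d) (.reg (d + 1)))))
  | ite c a b, d => .seq (c.compile d) (.cond (.reg d) (a.compile d) (b.compile d))
  | letIn r e b, d =>
      .seq (e.compile d) (.seq (.assign (d + 1) (.reg r)) (.seq (.assign r (.reg d))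
        (.seq (b.compile (d + 2)) (.seq (.assign r (.reg (d + 1))) (.assign d (.reg (d + 2)))))))
  | agg o u r c b, d =>
      .seq (.assign (d + 1) (.reg r)) (.seq (.assign r (.lit 0)) (.seq (.assign d (.lit u))
        (.seq (.loop (.bin .sub (.reg c) (.reg r))
          (.seq (b.compile (d + 2)) (.seq (.assign d (.bin o (.reg d) (.reg (d + 2))))
            (.assign r (.bin .add (.reg r) (.lit 1))))))
        (.assign r (.reg (d + 1))))))

/-- A bound for the bit length of the value of a term. -/
def sz : Term → ℕ → ℕ
  | lit c, _ => c.size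
  | var _, M => M
  | mem _, M => M
  | bin _ a b, M => a.sz M + b.sz M + 1
  | ite _ a b, M => a.sz M + b.sz M
  | letIn _ e b, M => b.sz (M + e.sz M)
  | agg _ u _ _ b, M => u.size + M * (b.sz M + 1)

/-- A bound for the running time of the compiled term. -/
def ct : Term → ℕ → ℕ
  | lit c, _ => 2 + 2 * c.size
  | var _, M => 2 + 2 * M
  | mem a, M => a.ct M + (3 + 2 * a.sz M + 2 * M)
  | bin _ a b, M => a.ct M + (b.ct M + (5 + 3 * a.sz M + 3 * b.sz M))
  | ite c a b, M => c.ct M + (2 + c.sz M + (a.ct M + b.ct M))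
  | letIn _ e b, M => e.ct M + ((2 + 2 * M) + ((2 + 2 * e.sz M) + (b.ct (M + e.sz M) +
      ((2 + 2 * M) + (2 + 2 * b.sz (M + e.sz M))))))
  | agg _ u _ _ b, M => (2 + 2 * M) + (2 + ((2 + 2 * u.size) +
      (((M + 1) * (1 + (3 + 4 * M)) + M * (b.ct M + ((4 + 3 * (u.size + M * (b.sz M + 1)) +
        2 * b.sz M) + (6 + 3 * M)))) + (2 + 2 * M))))

/-- All registers and memory cells which a term may read have at most `M` bits, and the registers
which it may use as upper limits of aggregations are at most `M`. -/
structure Bounded (ρ μ : ℕ → ℕ) (M : ℕ) : Prop where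
  count : ∀ r < 7, ρ r ≤ M
  reg : ∀ r < 40, (ρ r).size ≤ M
  mem : ∀ a, (μ a).size ≤ M

/-- Only registers below `7` serve as limits of aggregations, and binders use registers from `7` on.
Hence a bound variable has to satisfy only the bit length bound. -/
theorem Bounded.update {ρ μ : ℕ → ℕ} {M x r : ℕ} (h : Bounded ρ μ M) (hr : 7 ≤ r)
    (hx : x.size ≤ M) : Bounded (Function.update ρ r x) μ M := by
  refine ⟨fun i hi => ?_, fun i hi => ?_, h.mem⟩
  · rw [Function.update_of_ne (by omega)]; exact h.count i hi
  · rw [Function.update_apply]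
    split
    · exact hx
    · exact h.reg i hi

theorem Bounded.mono {ρ μ : ℕ → ℕ} {M M' : ℕ} (h : Bounded ρ μ M) (hM : M ≤ M') :
    Bounded ρ μ M' :=
  ⟨fun r hr => (h.count r hr).trans hM, fun r hr => (h.reg r hr).trans hM,
    fun a => (h.mem a).trans hM⟩

/-- Every accumulation step adds at most `K + 1` bits, so the bit length grows linearly in the
number of steps. This is why limits of aggregations must be bounded in value and not only in length.
-/
theorem size_rec_le {o : Op} {u K : ℕ} {f : ℕ → ℕ} {m : ℕ} (hf : ∀ j < m, (f j).size ≤ K) :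
    (Nat.rec u (fun j x => o.app x (f j)) m : ℕ).size ≤ u.size + m * (K + 1) := by
  induction m with
  | zero => simp
  | succ m ih =>
    have h1 := ih (fun j hj => hf j (by omega))
    have h2 := hf m (by omega)
    have h3 := o.size_app_le (Nat.rec u (fun j x => o.app x (f j)) m) (f m)
    have h4 : (m + 1) * (K + 1) = m * (K + 1) + K + 1 := by ring
    dsimp only at h1 h3 ⊢
    omega

theorem size_val_le (μ : ℕ → ℕ) (e : Term) : ∀ (ρ : ℕ → ℕ) (M : ℕ), e.WF = true →
    Bounded ρ μ M → (e.val μ ρ).size ≤ e.sz M := by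
  induction e with
  | lit c => intro ρ M _ _; exact le_rfl
  | var r => intro ρ M hw hb; exact hb.reg r (by simpa [WF] using hw)
  | mem a _ => intro ρ M hw hb; exact hb.mem _
  | bin o a b iha ihb =>
    intro ρ M hw hb
    simp only [WF, Bool.and_eq_true] at hw
    have h1 := iha ρ M hw.1 hb
    have h2 := ihb ρ M hw.2 hb
    have := o.size_app_le (a.val μ ρ) (b.val μ ρ)
    simp only [val, sz]
    omega
  | ite c a b ihc iha ihb =>
    intro ρ M hw hb
    simp only [WF, Bool.and_eq_true] at hw
    have h1 := iha ρ M hw.1.2 hb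
    have h2 := ihb ρ M hw.2 hb
    simp only [val, sz]
    split <;> omega
  | letIn r e b ihe ihb =>
    intro ρ M hw hb
    simp only [WF, Bool.and_eq_true, decide_eq_true_eq] at hw
    have h1 := ihe ρ M hw.1.2 hb
    exact ihb _ _ hw.2 ((hb.mono (Nat.le_add_right _ _)).update hw.1.1.1 (by omega))
  | agg o u r c b ihb =>
    intro ρ M hw hb
    simp only [WF, Bool.and_eq_true, decide_eq_true_eq] at hw
    have hc := hb.count c hw.1.2
    simp only [val, sz]
    refine (size_rec_le (K := b.sz M) fun j hj => ?_).trans ?_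
    · exact ihb _ _ hw.2 (hb.update hw.1.1.1 ((size_le_self j).trans (by omega)))
    · gcongr

/-! ### Correctness and running time of compiled terms. -/

@[simp] theorem setReg_reg (s : State) (i x j : ℕ) :
    (s.setReg i x).reg j = if j = i then x else s.reg j := by
  simp [State.setReg, Function.update_apply]

@[simp] theorem setReg_mem (s : State) (i x : ℕ) : (s.setReg i x).mem = s.mem := rfl

@[simp] theorem setReg_coins (s : State) (i x : ℕ) : (s.setReg i x).coins = s.coins := rfl

/-- The state after evaluating a term into register `d`. -/
structure Computed (d x : ℕ) (s s' : State) : Prop where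
  result : s'.reg d = x
  reg : ∀ r < d, s'.reg r = s.reg r
  mem : s'.mem = s.mem
  coins : s'.coins = s.coins

/-- Scratch registers start at `d ≥ 40`, beyond everything a term reads, and subterms are compiled
at larger `d`, so intermediate values parked at `d` and `d + 1` survive. A bound register below `40`
is saved in `d + 1` and restored, which is why all registers below `d` are unchanged afterwards. -/
theorem runs_compile (ω : ℕ → Bool) (μ : ℕ → ℕ) (e : Term) : ∀ (ρ : ℕ → ℕ) (M d : ℕ) (s : State),
    e.WF = true → Bounded ρ μ M → 40 ≤ d → (∀ r < 40, s.reg r = ρ r) → s.mem = μ →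
    Runs ω (e.compile d) s (e.ct M) (Computed d (e.val μ ρ) s) := by
  induction e with
  | lit c =>
    intro ρ M d s _ _ _ _ _
    refine Runs.assign ?_ ⟨?_, fun r hr => ?_, rfl, rfl⟩
    · simp [Exp.cost, Exp.val, ct]; omega
    · simp [Exp.val, val]
    · simp [hr.ne]
  | var r =>
    intro ρ M d s hw hb hd hs hm
    have hr : r < 40 := by simpa [WF] using hw
    have := hb.reg r hr
    refine Runs.assign ?_ ⟨?_, fun i hi => ?_, rfl, rfl⟩
    · simp only [Exp.cost, Exp.val, ct, hs r hr]; omega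
    · simp [Exp.val, val, hs r hr]
    · simp [hi.ne]
  | mem a iha =>
    intro ρ M d s hw hb hd hs hm
    simp only [WF] at hw
    refine (iha ρ M d s hw hb hd hs hm).seq fun s₁ h₁ => ?_
    have h2 := size_val_le μ a ρ M hw hb
    have h3 := hb.mem (a.val μ ρ)
    refine Runs.assign ?_ ⟨?_, fun i hi => ?_, h₁.mem, h₁.coins⟩
    · simp only [Exp.cost, Exp.val, h₁.result, h₁.mem, hm]; omega
    · simp [Exp.val, val, h₁.result, h₁.mem, hm]
    · simp [hi.ne, h₁.reg i hi]
  | bin o a b iha ihb =>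
    intro ρ M d s hw hb hd hs hm
    simp only [WF, Bool.and_eq_true] at hw
    refine (iha ρ M d s hw.1 hb hd hs hm).seq fun s₁ h₁ => ?_
    refine (ihb ρ M (d + 1) s₁ hw.2 hb (by omega)
      (fun r hr => (h₁.reg r (by omega)).trans (hs r hr)) (h₁.mem.trans hm)).seq fun s₂ h₂ => ?_
    have h3 := size_val_le μ a ρ M hw.1 hb
    have h4 := size_val_le μ b ρ M hw.2 hb
    have h5 := o.size_app_le (a.val μ ρ) (b.val μ ρ)
    have h6 : s₂.reg d = a.val μ ρ := (h₂.reg d (by omega)).trans h₁.result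
    refine Runs.assign ?_ ⟨?_, fun i hi => ?_, h₂.mem.trans h₁.mem, h₂.coins.trans h₁.coins⟩
    · simp only [Exp.cost, Exp.val, h₂.result, h6]; omega
    · simp [Exp.val, val, h₂.result, h6]
    · simp [hi.ne, h₂.reg i (by omega), h₁.reg i hi]
  | ite c a b ihc iha ihb =>
    intro ρ M d s hw hb hd hs hm
    simp only [WF, Bool.and_eq_true] at hw
    refine (ihc ρ M d s hw.1.1 hb hd hs hm).seq fun s₁ h₁ => ?_
    have h3 := size_val_le μ c ρ M hw.1.1 hb
    have hs₁ : ∀ r < 40, s₁.reg r = ρ r := fun r hr => (h₁.reg r (by omega)).trans (hs r hr)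
    by_cases h0 : c.val μ ρ = 0
    · refine (Runs.cond_false (by simpa [Exp.val, h₁.result] using h0)
        (ihb ρ M d s₁ hw.2 hb hd hs₁ (h₁.mem.trans hm))).mono ?_ fun s₂ h₂ => ?_
      · simp only [Exp.cost, h₁.result]; omega
      · refine ⟨?_, fun i hi => ?_, h₂.mem.trans h₁.mem, h₂.coins.trans h₁.coins⟩
        · simp [val, h0, h₂.result]
        · rw [h₂.reg i hi, h₁.reg i hi]
    · refine (Runs.cond_true (by simpa [Exp.val, h₁.result] using h0)
        (iha ρ M d s₁ hw.1.2 hb hd hs₁ (h₁.mem.trans hm))).mono ?_ fun s₂ h₂ => ?_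
      · simp only [Exp.cost, h₁.result]; omega
      · refine ⟨?_, fun i hi => ?_, h₂.mem.trans h₁.mem, h₂.coins.trans h₁.coins⟩
        · simp [val, h0, h₂.result]
        · rw [h₂.reg i hi, h₁.reg i hi]
  | letIn r e b ihe ihb =>
    intro ρ M d s hw hb hd hs hm
    simp only [WF, Bool.and_eq_true, decide_eq_true_eq] at hw
    obtain ⟨⟨⟨hr7, hr40⟩, hwe⟩, hwb⟩ := hw
    have h1 := size_val_le μ e ρ M hwe hb
    have hb' : Bounded (Function.update ρ r (e.val μ ρ)) μ (M + e.sz M) :=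
      (hb.mono (Nat.le_add_right _ _)).update hr7 (by omega)
    have h2 := size_val_le μ b _ _ hwb hb'
    have h3 := hb.reg r hr40
    refine (ihe ρ M d s hwe hb hd hs hm).seq fun s₁ h₁ => ?_
    have hs₁ : ∀ i < 40, s₁.reg i = ρ i := fun i hi => (h₁.reg i (by omega)).trans (hs i hi)
    refine Runs.seq (Q := fun s' => s' = s₁.setReg (d + 1) (ρ r)) (Runs.assign ?_ ?_) ?_
    · simp only [Exp.cost, Exp.val, hs₁ r hr40]; omega
    · simp [Exp.val, hs₁ r hr40]
    rintro s₂ rfl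
    refine Runs.seq (Q := fun s' => s' = (s₁.setReg (d + 1) (ρ r)).setReg r (e.val μ ρ))
      (Runs.assign ?_ ?_) ?_
    · simp [Exp.cost, Exp.val, h₁.result]; omega
    · simp [Exp.val, h₁.result]
    rintro s₂ rfl
    refine (ihb _ _ (d + 2) ((s₁.setReg (d + 1) (ρ r)).setReg r (e.val μ ρ)) hwb hb' (by omega)
      ?_ (h₁.mem.trans hm)).seq fun s₃ h₃ => ?_
    · intro i hi
      simp only [setReg_reg, Function.update_apply]
      split
      · rfl
      · rw [if_neg (by omega), hs₁ i hi]
    have h4 : s₃.reg (d + 1) = ρ r := by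
      rw [h₃.reg _ (by omega)]; simp; omega
    refine Runs.seq (Q := fun s' => s' = s₃.setReg r (ρ r)) (Runs.assign ?_ ?_) ?_
    · simp only [Exp.cost, Exp.val, h4]; omega
    · simp [Exp.val, h4]
    rintro s₂ rfl
    have h5 : (s₃.setReg r (ρ r)).reg (d + 2) = b.val μ (Function.update ρ r (e.val μ ρ)) := by
      rw [setReg_reg, if_neg (by omega), h₃.result]
    refine Runs.assign ?_ ⟨?_, fun i hi => ?_, h₃.mem.trans h₁.mem, h₃.coins.trans h₁.coins⟩
    · simp only [Exp.cost, Exp.val, h5]; omega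
    · simp only [Exp.val, h5]; simp [val]
    · rw [setReg_reg, if_neg hi.ne, setReg_reg]
      split
      · next h => rw [h, hs r hr40]
      · next h => rw [h₃.reg i (by omega)]; simp [h, show i ≠ d + 1 by omega, h₁.reg i hi]
  | agg o u r c b ihb =>
    intro ρ M d s hw hb hd hs hm
    have hsz := size_val_le μ (agg o u r c b) ρ M hw hb
    simp only [WF, Bool.and_eq_true, decide_eq_true_eq] at hw
    obtain ⟨⟨⟨hr7, hr40⟩, hc⟩, hwb⟩ := hw
    have hcM := hb.count c hc
    have h3 := hb.reg r hr40
    have hcs := hb.reg c (by omega)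
    have hub : ∀ j ≤ ρ c, Bounded (Function.update ρ r j) μ M := fun j hj =>
      hb.update hr7 ((size_le_self j).trans (by omega))
    set f : ℕ → ℕ := fun m =>
      Nat.rec u (fun j x => o.app x (b.val μ (Function.update ρ r j))) m with hf
    have hfsz : ∀ m ≤ ρ c, (f m).size ≤ u.size + M * (b.sz M + 1) := by
      intro m hm
      refine (size_rec_le (K := b.sz M) fun j hj => ?_).trans ?_
      · exact size_val_le μ b _ _ hwb (hub j (by omega))
      · gcongr; omega
    refine Runs.seq (Q := fun s' => s' = s.setReg (d + 1) (ρ r)) (Runs.assign ?_ ?_) ?_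
    · simp only [Exp.cost, Exp.val, hs r hr40]; omega
    · simp [Exp.val, hs r hr40]
    rintro s₂ rfl
    refine Runs.seq (Q := fun s' => s' = (s.setReg (d + 1) (ρ r)).setReg r 0)
      (Runs.assign ?_ ?_) ?_
    · simp [Exp.cost, Exp.val]
    · simp [Exp.val]
    rintro s₂ rfl
    refine Runs.seq (Q := fun s' => s' = ((s.setReg (d + 1) (ρ r)).setReg r 0).setReg d u)
      (Runs.assign ?_ ?_) ?_
    · simp [Exp.cost, Exp.val]; omega
    · simp [Exp.val]
    rintro s₂ rfl
    -- Register `r` is the loop counter and thus exempt from the frame condition; its old content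
    -- waits in `d + 1`.
    let I : ℕ → State → Prop := fun j s' => s'.reg d = f j ∧ s'.reg r = j ∧
      s'.reg (d + 1) = ρ r ∧ (∀ i < d, i ≠ r → s'.reg i = s.reg i) ∧ s'.mem = s.mem ∧
      s'.coins = s.coins
    have hguard : ∀ j s', j ≤ ρ c → I j s' →
        (Exp.bin .sub (.reg c) (.reg r)).val s' = ρ c - j ∧
        (Exp.bin .sub (.reg c) (.reg r)).cost s' ≤ 3 + 4 * M := by
      rintro j s' hj ⟨_, h2, _, h4, _, _⟩
      have h5 : s'.reg c = ρ c := by rw [h4 c (by omega) (by omega), hs c (by omega)]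
      have := (size_le_self j)
      simp only [Exp.val, Op.app, Exp.cost, h2, h5]
      exact ⟨trivial, by omega⟩
    refine Runs.seq (Q := I (ρ c)) ((Runs.loop (I := I) (c := ρ c) (g := 3 + 4 * M)
      (T := b.ct M + ((4 + 3 * (u.size + M * (b.sz M + 1)) + 2 * b.sz M) + (6 + 3 * M)))
      ?_ ?_ ?_).mono ?_ fun _ h => h) ?_
    · intro j s₁ hj hI
      obtain ⟨hg1, hg2⟩ := hguard j s₁ hj.le hI
      refine ⟨by rw [hg1]; omega, hg2, ?_⟩
      obtain ⟨i1, i2, i3, i4, i5, i6⟩ := hI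
      refine (ihb (Function.update ρ r j) M (d + 2) s₁ hwb (hub j hj.le) (by omega) ?_
        (i5.trans hm)).seq fun s₂ h₂ => ?_
      · intro i hi
        rw [Function.update_apply]
        split
        · next h => rw [h, i2]
        · next h => rw [i4 i (by omega) h, hs i hi]
      have hbs := size_val_le μ b _ _ hwb (hub j hj.le)
      have hd2 : s₂.reg d = f j := (h₂.reg d (by omega)).trans i1
      have hr2 : s₂.reg r = j := (h₂.reg r (by omega)).trans i2
      have hfj := hfsz j hj.le
      have hfj1 := hfsz (j + 1) hj
      have hfs : o.app (f j) (b.val μ (Function.update ρ r j)) = f (j + 1) := rfl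
      refine Runs.seq (Q := fun s' => s' = s₂.setReg d (f (j + 1))) (Runs.assign ?_ ?_) ?_
      · simp only [Exp.cost, Exp.val, hd2, h₂.result, hfs]; omega
      · simp only [Exp.val, hd2, h₂.result, hfs]
      rintro s₃ rfl
      have hr3 : (s₂.setReg d (f (j + 1))).reg r = j := by
        rw [setReg_reg, if_neg (by omega), hr2]
      have hj1 := size_le_self j
      have hj2 := size_le_self (j + 1)
      refine Runs.assign ?_ ⟨?_, ?_, ?_, ?_, ?_, ?_⟩
      · simp only [Exp.cost, Exp.val, hr3, Op.app, Nat.size_one]; omega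
      · rw [setReg_reg, if_neg (by omega)]; simp
      · simp [Exp.val, Op.app]; rw [if_neg (by omega), hr2]
      · rw [setReg_reg, if_neg (by omega), setReg_reg, if_neg (by omega), h₂.reg _ (by omega), i3]
      · intro i hi hir
        rw [setReg_reg, if_neg hir, setReg_reg, if_neg hi.ne, h₂.reg i (by omega), i4 i hi hir]
      · simp [h₂.mem, i5]
      · simp [h₂.coins, i6]
    · intro s' hI
      obtain ⟨hg1, hg2⟩ := hguard _ s' le_rfl hI
      exact ⟨by omega, hg2⟩
    · refine ⟨?_, ?_, ?_, ?_, ?_, ?_⟩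
      · simp [hf]
      · simp; omega
      · simp; omega
      · intro i hi hir
        simp [hir, hi.ne, show i ≠ d + 1 by omega]
      · simp
      · simp
    · gcongr
    · rintro s' ⟨i1, i2, i3, i4, i5, i6⟩
      refine Runs.assign ?_ ⟨?_, ?_, ?_, ?_⟩
      · simp only [Exp.cost, Exp.val, i3]; omega
      · rw [setReg_reg, if_neg (by omega), i1]; rfl
      · intro i hi
        rw [setReg_reg]
        split
        · next h => simp [Exp.val, i3, h, hs r hr40]
        · next h => exact i4 i hi h
      · simp [i5]
      · simp [i6]

end Term
end RAM

namespace RAM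

open Term

/-! ## Assignments of terms, table filling and coin flipping -/

/-- The registers below `40`, the memory and the number of flipped coins have the given values. -/
structure At (ρ μ : ℕ → ℕ) (n : ℕ) (s : State) : Prop where
  reg : ∀ r < 40, s.reg r = ρ r
  mem : s.mem = μ
  coins : s.coins = n

/-- Assign the value of a term to a register. -/
def setTerm (r : ℕ) (e : Term) : Prog := .seq (e.compile 40) (.assign r (.reg 40))

theorem runs_setTerm {ω : ℕ → Bool} {ρ μ : ℕ → ℕ} {n M r : ℕ} {e : Term} {s : State}
    (hs : At ρ μ n s) (hb : Bounded ρ μ M) (hw : e.WF = true) :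
    Runs ω (setTerm r e) s (e.ct M + (2 + 2 * e.sz M))
      (At (Function.update ρ r (e.val μ ρ)) μ n) := by
  refine (runs_compile ω μ e ρ M 40 s hw hb le_rfl hs.reg hs.mem).seq fun s₁ h₁ => ?_
  have h2 := size_val_le μ e ρ M hw hb
  refine Runs.assign ?_ ⟨fun i hi => ?_, h₁.mem.trans hs.mem, h₁.coins.trans hs.coins⟩
  · simp only [Exp.cost, Exp.val, h₁.result]; omega
  · rw [setReg_reg, Function.update_apply]
    split
    · exact h₁.result
    · rw [h₁.reg i hi, hs.reg i hi]

/-- The memory after filling the `j` cells from `b` on with the values of `g`. -/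
def filled (μ : ℕ → ℕ) (b : ℕ) (g : ℕ → ℕ) (j a : ℕ) : ℕ :=
  if b ≤ a ∧ a < b + j then g (a - b) else μ a

theorem filled_zero (μ : ℕ → ℕ) (b : ℕ) (g : ℕ → ℕ) : filled μ b g 0 = μ := by
  funext a; simp only [filled]; rw [if_neg (by omega)]

theorem filled_succ (μ : ℕ → ℕ) (b : ℕ) (g : ℕ → ℕ) (j : ℕ) :
    Function.update (filled μ b g j) (b + j) (g j) = filled μ b g (j + 1) := by
  funext a
  simp only [filled, Function.update_apply]
  split
  · next h => rw [if_pos (by omega), h, Nat.add_sub_cancel_left]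
  · next h =>
    by_cases h1 : b ≤ a ∧ a < b + j
    · rw [if_pos h1, if_pos (by omega)]
    · rw [if_neg h1, if_neg (by omega)]

theorem filled_of_lt {μ : ℕ → ℕ} {b : ℕ} {g : ℕ → ℕ} {j a : ℕ} (h : a < b) :
    filled μ b g j a = μ a := by
  simp only [filled]; rw [if_neg (by omega)]

theorem filled_of_ge {μ : ℕ → ℕ} {b : ℕ} {g : ℕ → ℕ} {j a : ℕ} (h : b + j ≤ a) :
    filled μ b g j a = μ a := by
  simp only [filled]; rw [if_neg (by omega)]

theorem filled_add {μ : ℕ → ℕ} {b : ℕ} {g : ℕ → ℕ} {j i : ℕ} (h : i < j) :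
    filled μ b g j (b + i) = g i := by
  simp only [filled]; rw [if_pos (by omega), Nat.add_sub_cancel_left]

theorem size_filled_le {μ : ℕ → ℕ} {b : ℕ} {g : ℕ → ℕ} {j M : ℕ} (hμ : ∀ a, (μ a).size ≤ M)
    (hg : ∀ i < j, (g i).size ≤ M) (a : ℕ) : (filled μ b g j a).size ≤ M := by
  simp only [filled]
  split
  · exact hg _ (by omega)
  · exact hμ a

/-- Fill a table whose first address is in register `b` and whose length is in register `c`; the
term `e` computes the entry number `t` from the content `t` of register `19`. -/
def fillTable (b c : ℕ) (e : Term) : Prog :=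
  .seq (.assign 19 (.lit 0)) (.seq
    (.loop (.bin .sub (.reg c) (.reg 19)) (.seq (e.compile 40)
      (.seq (.store (.bin .add (.reg b) (.reg 19)) (.reg 40))
        (.assign 19 (.bin .add (.reg 19) (.lit 1))))))
    (.assign 19 (.lit 0)))

/-- This is dynamic programming: by `he`, entry `j` is computed in the memory in which exactly the
entries before `j` have been written, so the term may look these up. -/
theorem runs_fillTable {ω : ℕ → Bool} {ρ μ : ℕ → ℕ} {n M b c : ℕ} {e : Term} {s : State}
    {g : ℕ → ℕ} (hs : At ρ μ n s) (hb : Bounded ρ μ M) (hw : e.WF = true) (h19 : ρ 19 = 0)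
    (hb19 : b < 19) (hc19 : c < 19) (hg : ∀ j < ρ c, (g j).size ≤ M)
    (he : ∀ j < ρ c, e.val (filled μ (ρ b) g j) (Function.update ρ 19 j) = g j) :
    Runs ω (fillTable b c e) s
      (2 + (((ρ c + 1) * (1 + (3 + 4 * M)) + ρ c * (e.ct M + ((6 + 8 * M) + (6 + 3 * M)))) + 2))
      (At ρ (filled μ (ρ b) g (ρ c)) n) := by
  have hcs := hb.reg c (by omega)
  have hbs := hb.reg b (by omega)
  let I : ℕ → State → Prop := fun j => At (Function.update ρ 19 j) (filled μ (ρ b) g j) n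
  have hsize : ∀ j ≤ ρ c, j.size ≤ M := fun j hj => (Nat.size_le_size hj).trans hcs
  have hguard : ∀ j s', j ≤ ρ c → I j s' →
      (Exp.bin .sub (.reg c) (.reg 19)).val s' = ρ c - j ∧
      (Exp.bin .sub (.reg c) (.reg 19)).cost s' ≤ 3 + 4 * M := by
    intro j s' hj hI
    have h2 : s'.reg 19 = j := by rw [hI.reg 19 (by omega)]; simp
    have h5 : s'.reg c = ρ c := by
      rw [hI.reg c (by omega), Function.update_of_ne (by omega)]
    have := hsize j hj
    simp only [Exp.val, Op.app, Exp.cost, h2, h5]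
    exact ⟨trivial, by omega⟩
  refine Runs.seq (Q := I 0) (Runs.assign ?_ ?_) fun s₁ h₁ => ?_
  · simp [Exp.cost, Exp.val]
  · refine ⟨fun i hi => ?_, ?_, hs.coins⟩
    · rw [setReg_reg, Function.update_apply, hs.reg i hi]; rfl
    · rw [filled_zero]; exact hs.mem
  refine Runs.seq (Q := I (ρ c)) (Runs.loop (I := I) (c := ρ c) ?_ ?_ h₁) ?_
  · intro j s₂ hj hI
    obtain ⟨hg1, hg2⟩ := hguard j s₂ hj.le hI
    refine ⟨by rw [hg1]; omega, hg2, ?_⟩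
    have hbd : Bounded (Function.update ρ 19 j) (filled μ (ρ b) g j) M :=
      Bounded.update ⟨hb.count, hb.reg, fun a => size_filled_le hb.mem
        (fun i hi => hg i (by omega)) a⟩ (by omega) (hsize j hj.le)
    refine (runs_compile ω _ e _ M 40 s₂ hw hbd le_rfl hI.reg hI.mem).seq fun s₃ h₃ => ?_
    have e1 : s₃.reg 19 = j := by
      rw [h₃.reg 19 (by omega), hI.reg 19 (by omega)]; simp
    have e2 : s₃.reg b = ρ b := by
      rw [h₃.reg b (by omega), hI.reg b (by omega), Function.update_of_ne (by omega)]
    have e3 : s₃.reg 40 = g j := h₃.result.trans (he j hj)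
    have a1 := hsize j hj.le
    have a2 := hg j hj
    have a3 := Op.add.size_app_le (ρ b) j
    have a4 := hsize (j + 1) hj
    refine Runs.seq (Q := fun s' => s' = s₃.setMem (ρ b + j) (g j))
      ⟨_, _, .store _ _ _, ?_, ?_⟩ ?_
    · simp only [Exp.cost, Exp.val, e1, e2, e3]
      omega
    · simp only [Exp.val, e1, e2, e3]; rfl
    rintro s₄ rfl
    have e4 : (s₃.setMem (ρ b + j) (g j)).reg 19 = j := e1
    refine Runs.assign ?_ ⟨fun i hi => ?_, ?_, ?_⟩
    · simp only [Exp.cost, Exp.val, e4, Op.app, Nat.size_one]; omega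
    · simp only [setReg_reg, Exp.val, e4, Op.app, Function.update_apply]
      split
      · rfl
      · next h =>
        change s₃.reg i = _
        rw [h₃.reg i hi, hI.reg i hi, Function.update_of_ne h]
    · change Function.update s₃.mem (ρ b + j) (g j) = _
      rw [h₃.mem, hI.mem, filled_succ]
    · exact h₃.coins.trans hI.coins
  · intro s' hI
    obtain ⟨hg1, hg2⟩ := hguard _ s' le_rfl hI
    exact ⟨by omega, hg2⟩
  · intro s' hI
    refine Runs.assign ?_ ⟨fun i hi => ?_, hI.mem, hI.coins⟩
    · simp [Exp.cost, Exp.val]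
    · rw [setReg_reg]
      split
      · next h => rw [h, h19]; rfl
      · next h => rw [hI.reg i hi, Function.update_of_ne h]

/-- Fill a table whose first address is in register `b` and whose length is in register `c` with
the outcomes of coin flips. -/
def fillCoins (b c : ℕ) : Prog :=
  .seq (.assign 19 (.lit 0)) (.seq
    (.loop (.bin .sub (.reg c) (.reg 19)) (.seq (.flip 20)
      (.seq (.store (.bin .add (.reg b) (.reg 19)) (.reg 20))
        (.assign 19 (.bin .add (.reg 19) (.lit 1))))))
    (.seq (.assign 19 (.lit 0)) (.assign 20 (.lit 0))))

/-- The coin counter starts at `0` and advances together with the table position, so cell `j` of the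
table receives coin `j`. -/
theorem runs_fillCoins {ω : ℕ → Bool} {ρ μ : ℕ → ℕ} {M b c : ℕ} {s : State}
    (hs : At ρ μ 0 s) (hb : Bounded ρ μ M) (h19 : ρ 19 = 0) (h20 : ρ 20 = 0)
    (hb19 : b < 19) (hc19 : c < 19) :
    Runs ω (fillCoins b c) s
      (2 + (((ρ c + 1) * (1 + (3 + 4 * M)) + ρ c * (1 + ((9 + 6 * M) + (6 + 3 * M)))) + (2 + 2)))
      (At ρ (filled μ (ρ b) (fun j => (ω j).toNat) (ρ c)) (ρ c)) := by
  have hcs := hb.reg c (by omega)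
  have hbs := hb.reg b (by omega)
  set g : ℕ → ℕ := fun j => (ω j).toNat with hg
  -- Register `20` holds the last coin and is exempt until it is reset after the loop.
  let I : ℕ → State → Prop := fun j s' => (∀ r < 40, r ≠ 20 → s'.reg r = Function.update ρ 19 j r) ∧
    s'.mem = filled μ (ρ b) g j ∧ s'.coins = j
  have hsize : ∀ j ≤ ρ c, j.size ≤ M := fun j hj => (Nat.size_le_size hj).trans hcs
  have hguard : ∀ j s', j ≤ ρ c → I j s' →
      (Exp.bin .sub (.reg c) (.reg 19)).val s' = ρ c - j ∧
      (Exp.bin .sub (.reg c) (.reg 19)).cost s' ≤ 3 + 4 * M := by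
    intro j s' hj hI
    have h2 : s'.reg 19 = j := by rw [hI.1 19 (by omega) (by omega)]; simp
    have h5 : s'.reg c = ρ c := by
      rw [hI.1 c (by omega) (by omega), Function.update_of_ne (by omega)]
    have := hsize j hj
    simp only [Exp.val, Op.app, Exp.cost, h2, h5]
    exact ⟨trivial, by omega⟩
  refine Runs.seq (Q := I 0) (Runs.assign ?_ ?_) fun s₁ h₁ => ?_
  · simp [Exp.cost, Exp.val]
  · refine ⟨fun i hi _ => ?_, ?_, hs.coins⟩
    · rw [setReg_reg, Function.update_apply, hs.reg i hi]; rfl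
    · rw [filled_zero]; exact hs.mem
  refine Runs.seq (Q := I (ρ c)) (Runs.loop (I := I) (c := ρ c) ?_ ?_ h₁) ?_
  · intro j s₂ hj hI
    obtain ⟨hg1, hg2⟩ := hguard j s₂ hj.le hI
    refine ⟨by rw [hg1]; omega, hg2, ?_⟩
    obtain ⟨i1, i2, i3⟩ := hI
    refine Runs.seq (Q := fun s' => s' = s₂.flipReg ω 20) ⟨_, _, .flip _ _, le_rfl, rfl⟩ ?_
    rintro s₃ rfl
    have e1 : (s₂.flipReg ω 20).reg 19 = j := by
      simp [State.flipReg, i1 19]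
    have e2 : (s₂.flipReg ω 20).reg b = ρ b := by
      simp only [State.flipReg]
      rw [Function.update_of_ne (by omega), i1 b (by omega) (by omega),
        Function.update_of_ne (by omega)]
    have e3 : (s₂.flipReg ω 20).reg 20 = g j := by
      simp [State.flipReg, i3, hg]
    have a1 := hsize j hj.le
    have a2 : (g j).size ≤ 1 := by
      rw [Nat.size_le]; simp only [hg]; cases ω j <;> simp
    have a3 := Op.add.size_app_le (ρ b) j
    have a4 := hsize (j + 1) hj
    refine Runs.seq (Q := fun s' => s' = (s₂.flipReg ω 20).setMem (ρ b + j) (g j))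
      ⟨_, _, .store _ _ _, ?_, ?_⟩ ?_
    · simp only [Exp.cost, Exp.val, e1, e2, e3]
      omega
    · simp only [Exp.val, e1, e2, e3]; rfl
    rintro s₄ rfl
    have e4 : ((s₂.flipReg ω 20).setMem (ρ b + j) (g j)).reg 19 = j := e1
    refine Runs.assign ?_ ⟨fun i hi hi20 => ?_, ?_, ?_⟩
    · simp only [Exp.cost, Exp.val, e4, Op.app, Nat.size_one]; omega
    · simp only [setReg_reg, Exp.val, e4, Op.app, Function.update_apply]
      split
      · rfl
      · next h =>
        change Function.update s₂.reg 20 _ i = _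
        rw [Function.update_of_ne hi20, i1 i hi hi20, Function.update_of_ne h]
    · change Function.update s₂.mem (ρ b + j) (g j) = _
      rw [i2, filled_succ]
    · change s₂.coins + 1 = _
      rw [i3]
  · intro s' hI
    obtain ⟨hg1, hg2⟩ := hguard _ s' le_rfl hI
    exact ⟨by omega, hg2⟩
  · rintro s' ⟨i1, i2, i3⟩
    refine Runs.seq (Q := fun t => t = s'.setReg 19 0) (Runs.assign ?_ ?_) ?_
    · simp [Exp.cost, Exp.val]
    · simp [Exp.val]
    rintro s'' rfl
    refine Runs.assign ?_ ⟨fun i hi => ?_, i2, i3⟩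
    · simp [Exp.cost, Exp.val]
    · rw [setReg_reg]
      split
      · next h => rw [h, h20]; rfl
      · next h =>
        rw [setReg_reg]
        split
        · next h' => rw [h', h19]
        · next h' => rw [i1 i hi h, Function.update_of_ne h']

/-- Assign the values of terms to consecutive registers. -/
def setTerms : ℕ → List Term → Prog
  | _, [] => .skip
  | r, e :: l => .seq (setTerm r e) (setTerms (r + 1) l)

/-- The time bound for `setTerms`. -/
def setTermsTime (M : ℕ) : List Term → ℕ
  | [] => 1
  | e :: l => (e.ct M + (2 + 2 * e.sz M)) + setTermsTime M l

/-- Each term is evaluated when only the earlier registers carry their final contents and the later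
ones are `0`, so it may refer to parameters already computed. Truncations of `ρ` obey the bound for
`ρ`, hence one `M` serves for all terms. -/
theorem runs_setTerms {ω : ℕ → Bool} {μ ρ : ℕ → ℕ} {n M : ℕ} (hb : Bounded ρ μ M)
    (l : List Term) : ∀ (r : ℕ) (s : State), (∀ e ∈ l, e.WF = true) →
    At (fun i => if i < r then ρ i else 0) μ n s →
    (∀ (j : ℕ) (hj : j < l.length), (l[j]).val μ (fun i => if i < r + j then ρ i else 0)
      = ρ (r + j)) →
    Runs ω (setTerms r l) s (setTermsTime M l)
      (At (fun i => if i < r + l.length then ρ i else 0) μ n) := by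
  induction l with
  | nil =>
    intro r s _ hs _
    exact ⟨s, 1, .skip s, le_rfl, hs⟩
  | cons e l ih =>
    intro r s hw hs hl
    have hb' : Bounded (fun i => if i < r then ρ i else 0) μ M := by
      refine ⟨fun i hi => ?_, fun i hi => ?_, hb.mem⟩
      · split
        · exact hb.count i hi
        · omega
      · split
        · exact hb.reg i hi
        · simp
    refine (runs_setTerm hs hb' (hw e (by simp))).seq fun s₁ h₁ => ?_
    have h0 := hl 0 (by simp)
    simp only [List.getElem_cons_zero, add_zero] at h0
    have heq : Function.update (fun i => if i < r then ρ i else 0) r (ρ r)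
        = fun i => if i < r + 1 then ρ i else 0 := by
      funext i
      rw [Function.update_apply]
      split
      · next h => subst h; simp
      · next h => by_cases h' : i < r
                  · simp only [if_pos h', if_pos (show i < r + 1 by omega)]
                  · simp only [if_neg h', if_neg (show ¬ i < r + 1 by omega)]
    rw [h0, heq] at h₁
    refine (ih (r + 1) s₁ (fun e' he' => hw e' (by simp [he'])) h₁ fun j hj => ?_).mono le_rfl ?_
    · have := hl (j + 1) (by simpa using hj)
      simpa [add_assoc, add_comm 1 j] using this
    · intro s' h
      simpa [add_assoc, add_comm 1 l.length] using h

/-! ## Polynomial bounds -/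

/-- `f` is bounded by a polynomial. -/
def PolyBdd (f : ℕ → ℕ) : Prop := ∃ q : Polynomial ℕ, ∀ n, f n ≤ q.eval n

theorem PolyBdd.const (c : ℕ) : PolyBdd fun _ => c := ⟨.C c, by simp⟩

theorem PolyBdd.id : PolyBdd fun n => n := ⟨.X, by simp⟩

theorem PolyBdd.add {f g : ℕ → ℕ} (hf : PolyBdd f) (hg : PolyBdd g) :
    PolyBdd fun n => f n + g n := by
  obtain ⟨p, hp⟩ := hf
  obtain ⟨q, hq⟩ := hg
  exact ⟨p + q, fun n => by simpa using add_le_add (hp n) (hq n)⟩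

theorem PolyBdd.mul {f g : ℕ → ℕ} (hf : PolyBdd f) (hg : PolyBdd g) :
    PolyBdd fun n => f n * g n := by
  obtain ⟨p, hp⟩ := hf
  obtain ⟨q, hq⟩ := hg
  exact ⟨p * q, fun n => by simpa using Nat.mul_le_mul (hp n) (hq n)⟩

/-- The induction has to run over all `f`, because the body of a local definition is estimated with
the larger bound `M + e.sz M`. -/
theorem PolyBdd.sz_and_ct (e : Term) : ∀ {f : ℕ → ℕ}, PolyBdd f →
    PolyBdd (fun n => e.sz (f n)) ∧ PolyBdd (fun n => e.ct (f n)) := by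
  have C := PolyBdd.const
  induction e with
  | lit c => intro f hf; exact ⟨C _, C _⟩
  | var r => intro f hf; exact ⟨hf, (C _).add ((C _).mul hf)⟩
  | mem a iha =>
    intro f hf
    obtain ⟨h1, h2⟩ := iha hf
    exact ⟨hf, h2.add (((C _).add ((C _).mul h1)).add ((C _).mul hf))⟩
  | bin o a b iha ihb =>
    intro f hf
    obtain ⟨h1, h2⟩ := iha hf
    obtain ⟨h3, h4⟩ := ihb hf
    exact ⟨(h1.add h3).add (C _),
      h2.add (h4.add (((C _).add ((C _).mul h1)).add ((C _).mul h3)))⟩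
  | ite c a b ihc iha ihb =>
    intro f hf
    obtain ⟨h1, h2⟩ := iha hf
    obtain ⟨h3, h4⟩ := ihb hf
    obtain ⟨h5, h6⟩ := ihc hf
    exact ⟨h1.add h3, h6.add (((C _).add h5).add (h2.add h4))⟩
  | letIn r e b ihe ihb =>
    intro f hf
    obtain ⟨h1, h2⟩ := ihe hf
    obtain ⟨h3, h4⟩ := ihb (hf.add h1)
    exact ⟨h3, h2.add (((C _).add ((C _).mul hf)).add (((C _).add ((C _).mul h1)).add (h4.add
      (((C _).add ((C _).mul hf)).add ((C _).add ((C _).mul h3))))))⟩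
  | agg o u r c b ihb =>
    intro f hf
    obtain ⟨h1, h2⟩ := ihb hf
    have h3 : PolyBdd fun n => u.size + f n * (b.sz (f n) + 1) :=
      (C _).add (hf.mul (h1.add (C _)))
    exact ⟨h3, ((C _).add ((C _).mul hf)).add ((C _).add ((C _).add
      ((((hf.add (C _)).mul ((C _).add ((C _).add ((C _).mul hf)))).add
        (hf.mul (h2.add ((((C _).add ((C _).mul h3)).add ((C _).mul h1)).add
          ((C _).add ((C _).mul hf)))))).add ((C _).add ((C _).mul hf)))))⟩

theorem PolyBdd.sz (e : Term) {f : ℕ → ℕ} (hf : PolyBdd f) : PolyBdd fun n => e.sz (f n) :=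
  (PolyBdd.sz_and_ct e hf).1

theorem PolyBdd.ct (e : Term) {f : ℕ → ℕ} (hf : PolyBdd f) : PolyBdd fun n => e.ct (f n) :=
  (PolyBdd.sz_and_ct e hf).2

theorem PolyBdd.setTermsTime (l : List Term) {f : ℕ → ℕ} (hf : PolyBdd f) :
    PolyBdd fun n => setTermsTime (f n) l := by
  induction l with
  | nil => exact PolyBdd.const 1
  | cons e l ih =>
    exact ((PolyBdd.ct e hf).add ((PolyBdd.const 2).add ((PolyBdd.const 2).mul
      (PolyBdd.sz e hf)))).add ih

end RAM

open Polynomial Finset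

/-! ## Determinants over rings of characteristic two -/

/-- Over a ring of characteristic two, the determinant of a symmetric matrix with idempotent
diagonal is the square of the sum, over all involutions, of the products over their orbits. -/
theorem Matrix.det_eq_sq_sum_involutions {R n : Type*} [CommRing R] [CharP R 2] [Fintype n]
    [LinearOrder n] (B : Matrix n n R) (hs : ∀ i j, B i j = B j i)
    (hd : ∀ i, B i i * B i i = B i i) :
    B.det = (∑ σ : Equiv.Perm n with σ * σ = 1, ∏ i with i ≤ σ i, B i (σ i)) ^ 2 := by
  have hsign : ∀ σ : Equiv.Perm n, Equiv.Perm.sign σ • ∏ i, B (σ i) i = ∏ i, B (σ i) i := by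
    intro σ
    rcases Int.units_eq_one_or (Equiv.Perm.sign σ) with h | h
    · rw [h, one_smul]
    · rw [h, Units.neg_smul, one_smul, CharTwo.neg_eq]
  have hinv : ∀ σ : Equiv.Perm n, ∏ i, B (σ⁻¹ i) i = ∏ i, B (σ i) i := by
    intro σ
    rw [← Equiv.prod_comp σ]
    exact prod_congr rfl fun i _ => by rw [← Equiv.Perm.mul_apply, inv_mul_cancel, Equiv.Perm.one_apply, hs]
  rw [Matrix.det_apply, sum_congr rfl fun σ _ => hsign σ,
    ← sum_filter_add_sum_filter_not univ (fun σ : Equiv.Perm n => σ * σ = 1),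
    CharTwo.sum_sq]
  -- By symmetry of `B`, a permutation and its inverse contribute equally, so the permutations that
  -- are not involutions cancel in pairs.
  have h0 : ∑ σ : Equiv.Perm n with ¬ σ * σ = 1, ∏ i, B (σ i) i = 0 := by
    refine sum_involution (fun σ _ => σ⁻¹) (fun σ _ => ?_) (fun σ hσ _ => ?_) (fun σ hσ => ?_)
      (fun σ _ => inv_inv σ)
    · rw [hinv, CharTwo.add_self_eq_zero]
    · intro h
      apply (mem_filter.1 hσ).2
      rw [mul_eq_one_iff_eq_inv, h]
    · simp only [mem_filter, mem_univ, true_and] at hσ ⊢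
      intro h
      apply hσ
      have := congrArg (fun τ => τ⁻¹) h
      simpa using this
  rw [h0, add_zero]
  refine sum_congr rfl fun σ hσ => ?_
  have hσ2 : ∀ i, σ (σ i) = i := fun i => by
    have := (mem_filter.1 hσ).2
    rw [← Equiv.Perm.mul_apply, this, Equiv.Perm.one_apply]
  rw [← prod_filter_mul_prod_filter_not univ (fun i => i ≤ σ i), ← prod_pow]
  -- The two factors of a 2-cycle agree and form a square; a fixed point contributes an idempotent,
  -- which is its own square.
  have h1 : ∏ i with ¬ i ≤ σ i, B (σ i) i = ∏ i with i < σ i, B i (σ i) := by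
    refine prod_bij' (fun i _ => σ i) (fun i _ => σ i) ?_ ?_ ?_ ?_ ?_
    · intro i hi; simpa [hσ2] using hi
    · intro i hi; simpa [hσ2] using hi
    · intro i _; exact hσ2 i
    · intro i _; exact hσ2 i
    · intro i _; rw [hσ2]
  have h2 : ∏ i with i < σ i, B i (σ i) =
      ∏ i with i ≤ σ i, if i < σ i then B i (σ i) else 1 := by
    rw [← prod_filter, filter_filter]
    refine prod_congr ?_ fun _ _ => rfl
    ext i; simp only [mem_filter, mem_univ, true_and]; exact ⟨fun h => ⟨h.le, h⟩, fun h => h.2⟩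
  rw [h1, h2, ← prod_mul_distrib]
  refine prod_congr rfl fun i hi => ?_
  rw [sq]
  split
  · rw [hs]
  · next h =>
    have : σ i = i := le_antisymm (not_lt.1 h) (mem_filter.1 hi).2
    rw [this, hd, mul_one]

/-! ## A division-free determinant -/

section Chistov

/-- The leading principal `r × r` submatrix. -/
def leadingMatrix {R : Type*} (A : ℕ → ℕ → R) (r : ℕ) : Matrix (Fin r) (Fin r) R :=
  Matrix.of fun i j => A i j

/-- The total weight of the walks of length `k` from `i` to `r` which visit only vertices up to
`r` after the start. -/
def walk {R : Type*} [CommSemiring R] (A : ℕ → ℕ → R) (N r : ℕ) : ℕ → ℕ → R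
  | 0, i => if i = r then 1 else 0
  | k + 1, i => ∑ j ∈ range N, if r < j then 0 else A i j * walk A N r k j

/-- The product of the truncated generating functions of the closed walks at `r` below `r`. -/
def walkSeries {R : Type*} [CommSemiring R] (A : ℕ → ℕ → R) (N : ℕ) (z : R) : R :=
  ∏ r ∈ range N, ∑ k ∈ range (N + 1), z ^ k * walk A N r k r

/-- The truncated geometric series which inverts `walkSeries` in characteristic two. -/
def detSeries {R : Type*} [CommSemiring R] (A : ℕ → ℕ → R) (N : ℕ) (z : R) : R :=
  ∑ j ∈ range (N + 1), (1 + walkSeries A N z) ^ j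

/-- For a start `i ≤ r`, walks that avoid all vertices above `r` are walks in the leading `(r + 1) ×
(r + 1)` block, and powers of that block count them. -/
theorem walk_eq_pow {R : Type*} [CommRing R] (A : ℕ → ℕ → R) {N r : ℕ} (hr : r < N) (k : ℕ) :
    ∀ i : Fin (r + 1), walk A N r k i = (leadingMatrix A (r + 1) ^ k) i (Fin.last r) := by
  induction k with
  | zero =>
    intro i
    simp only [walk, pow_zero, Matrix.one_apply, Fin.ext_iff, Fin.val_last]
  | succ k ih =>
    intro i
    rw [pow_succ', Matrix.mul_apply, walk]
    simp only [← ih]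
    rw [show ∑ j : Fin (r + 1), leadingMatrix A (r + 1) i j * walk A N r k j
      = ∑ j : Fin (r + 1), A i j * walk A N r k j from rfl,
      Fin.sum_univ_eq_sum_range (fun j => A i j * walk A N r k j) (r + 1)]
    rw [← sum_subset (range_subset_range.2 (show r + 1 ≤ N from hr))]
    · refine sum_congr rfl fun j hj => if_neg ?_
      have := mem_range.1 hj; omega
    · intro j _ hj
      rw [mem_range] at hj
      exact if_pos (by omega)

theorem walk_map {R S : Type*} [CommSemiring R] [CommSemiring S] (f : R →+* S) (A : ℕ → ℕ → R)
    (N r k : ℕ) : ∀ i, walk (fun i j => f (A i j)) N r k i = f (walk A N r k i) := by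
  induction k with
  | zero => intro i; simp only [walk]; split <;> simp
  | succ k ih =>
    intro i
    simp only [walk, map_sum, ih]
    exact sum_congr rfl fun j _ => by split <;> simp

/-- The series uses no subtraction or division. It therefore makes sense over `ℕ`, where the machine
computes, and is carried to characteristic two by ring homomorphisms. -/
theorem detSeries_map {R S : Type*} [CommSemiring R] [CommSemiring S] (f : R →+* S)
    (A : ℕ → ℕ → R) (N : ℕ) (z : R) :
    detSeries (fun i j => f (A i j)) N (f z) = f (detSeries A N z) := by
  simp only [detSeries, walkSeries, walk_map, map_sum, map_pow, map_add, map_one, map_prod,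
    map_mul]

variable {R : Type*} [CommRing R] (A : ℕ → ℕ → R)

/-- By Cramer's rule the last diagonal entry of the inverse of `1 - X • L` is the quotient of the
reversed characteristic polynomials of two consecutive leading blocks. The same entry is the
generating function of closed walks at `r`. Truncating the geometric series costs a multiple of `X ^
(N + 1)`. -/
theorem charpolyRev_mul_walks {N r : ℕ} (hr : r < N) :
    ∃ c : R[X], (leadingMatrix A (r + 1)).charpolyRev *
      ∑ k ∈ range (N + 1), X ^ k * C (walk A N r k r) =
      (leadingMatrix A r).charpolyRev + X ^ (N + 1) * c := by
  set L := (leadingMatrix A (r + 1)).map C with hL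
  set M : Matrix (Fin (r + 1)) (Fin (r + 1)) R[X] := 1 - (X : R[X]) • L with hM
  have hdet : M.det = (leadingMatrix A (r + 1)).charpolyRev := rfl
  have hgeom : M * ∑ k ∈ range (N + 1), ((X : R[X]) • L) ^ k = 1 - ((X : R[X]) • L) ^ (N + 1) :=
    mul_neg_geom_sum _ _
  have hadj := congrArg (fun T => M.adjugate * T) hgeom
  simp only [← mul_assoc, Matrix.adjugate_mul, mul_sub, mul_one, smul_mul_assoc, one_mul] at hadj
  have hent := congrFun (congrFun hadj (Fin.last r)) (Fin.last r)
  have hpow : ∀ k, (((X : R[X]) • L) ^ k) (Fin.last r) (Fin.last r)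
      = X ^ k * C (walk A N r k r) := by
    intro k
    rw [_root_.smul_pow, Matrix.smul_apply, smul_eq_mul, hL]
    have : (leadingMatrix A (r + 1)).map C ^ k = ((leadingMatrix A (r + 1)) ^ k).map C :=
      (map_pow (C : R →+* R[X]).mapMatrix _ _).symm
    rw [this, Matrix.map_apply, ← walk_eq_pow A hr k (Fin.last r)]
    rfl
  rw [Matrix.smul_apply, Matrix.sum_apply, smul_eq_mul, sum_congr rfl fun k _ => hpow k,
    Matrix.sub_apply, hdet] at hent
  -- Deleting the last row and column of `1 - X • L` leaves the same matrix for the smaller block.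
  have hadjlast : M.adjugate (Fin.last r) (Fin.last r) = (leadingMatrix A r).charpolyRev := by
    rw [Matrix.adjugate_fin_succ_eq_det_submatrix, Matrix.charpolyRev]
    simp only [Fin.succAbove_last, ← two_mul, pow_mul, Fin.val_last]
    rw [show ((-1 : R[X]) ^ 2) = 1 by ring, one_pow, one_mul]
    congr 1
    ext1 i j
    simp [hM, hL, leadingMatrix, Matrix.one_apply]
  refine ⟨-((M.adjugate * L ^ (N + 1)) (Fin.last r) (Fin.last r)), ?_⟩
  rw [hent, hadjlast, _root_.smul_pow, Matrix.mul_smul, Matrix.smul_apply, smul_eq_mul]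
  ring

/-- The quotients for consecutive blocks telescope down to the empty matrix, whose reversed
characteristic polynomial is `1`. -/
theorem charpolyRev_mul_walkSeries (N : ℕ) :
    ∃ c : R[X], (leadingMatrix A N).charpolyRev * walkSeries (fun i j => C (A i j)) N X =
      1 + X ^ (N + 1) * c := by
  have key : ∀ m ≤ N, ∃ c : R[X], (leadingMatrix A m).charpolyRev *
      ∏ r ∈ range m, ∑ k ∈ range (N + 1), X ^ k * C (walk A N r k r) = 1 + X ^ (N + 1) * c := by
    intro m
    induction m with
    | zero =>
      intro _
      exact ⟨0, by simp [Matrix.charpolyRev]⟩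
    | succ m ih =>
      intro hm
      obtain ⟨c, hc⟩ := ih (by omega)
      obtain ⟨d, hd⟩ := charpolyRev_mul_walks A (show m < N from hm)
      rw [prod_range_succ, mul_comm (∏ r ∈ range m, _), ← mul_assoc, hd, add_mul, hc]
      exact ⟨c + d * ∏ r ∈ range m, ∑ k ∈ range (N + 1), X ^ k * C (walk A N r k r), by ring⟩
  obtain ⟨c, hc⟩ := key N le_rfl
  refine ⟨c, ?_⟩
  rw [← hc, walkSeries]
  simp only [walk_map (C : R →+* R[X])]

theorem coeff_charpolyRev_card (N : ℕ) [CharP R 2] :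
    (leadingMatrix A N).charpolyRev.coeff N = (leadingMatrix A N).det := by
  have := CharP.nontrivial_of_char_ne_one (R := R) (show (2 : ℕ) ≠ 1 by norm_num)
  rw [← Matrix.reverse_charpoly, coeff_reverse, Matrix.charpoly_natDegree_eq_dim, Fintype.card_fin,
    revAt_le le_rfl, Nat.sub_self, Matrix.det_eq_sign_charpoly_coeff, CharTwo.neg_eq, one_pow,
    one_mul]

/-- Over a ring of characteristic two, the determinant of an `N × N` matrix is the coefficient of
`X ^ N` in `detSeries`. -/
theorem coeff_detSeries [CharP R 2] (N : ℕ) :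
    (detSeries (fun i j => C (A i j)) N (X : R[X])).coeff N = (leadingMatrix A N).det := by
  obtain ⟨c, hc⟩ := charpolyRev_mul_walkSeries A N
  set Q := walkSeries (fun i j => C (A i j)) N (X : R[X]) with hQ
  set D := (leadingMatrix A N).charpolyRev with hD
  set F := detSeries (fun i j => C (A i j)) N (X : R[X]) with hF
  have htwo : ∀ x : R[X], x + x = 0 := CharTwo.add_self_eq_zero
  have hD1 : D.coeff 0 = 1 := by
    rw [hD, coeff_zero_eq_eval_zero]; exact Matrix.eval_charpolyRev
  have hQ1 : Q.coeff 0 = 1 := by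
    have := congrArg (fun p => p.coeff 0) hc
    simpa [mul_coeff_zero, hD1] using this
  -- In characteristic two `1 + Q` is `1 - Q`. As `X` divides it, the geometric sum of its powers
  -- inverts `Q` modulo `X ^ (N + 1)`.
  obtain ⟨u, hu⟩ : X ∣ 1 + Q := by
    rw [X_dvd_iff, coeff_add, hQ1, coeff_one_zero, CharTwo.add_self_eq_zero]
  have hFQ : F * Q = 1 + X ^ (N + 1) * u ^ (N + 1) := by
    have h1 : (1 + Q - 1) * ∑ j ∈ range (N + 1), (1 + Q) ^ j = (1 + Q) ^ (N + 1) - 1 :=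
      mul_geom_sum _ _
    rw [add_sub_cancel_left, CharTwo.sub_eq_add, hu, mul_pow] at h1
    rw [show F = ∑ j ∈ range (N + 1), (1 + Q) ^ j from rfl, mul_comm, hu, h1, add_comm]
  -- Both `F` and `D` invert `Q` modulo `X ^ (N + 1)`, so they agree up to degree `N`.
  have hfin : F = D + X ^ (N + 1) * (D * u ^ (N + 1) - F * c) := by
    have : F * (D * Q) = D * (F * Q) := by ring
    rw [hc, hFQ] at this
    linear_combination this
  rw [hfin, coeff_add, coeff_X_pow_mul', if_neg (by omega), add_zero, hD, coeff_charpolyRev_card]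

end Chistov

/-! ## Digits of values of polynomials -/

theorem Polynomial.coeff_le_eval_one (P : ℕ[X]) (j : ℕ) : P.coeff j ≤ P.eval 1 := by
  rw [eval_eq_sum_range]
  simp only [one_pow, mul_one]
  by_cases h : j ≤ P.natDegree
  · exact single_le_sum (f := fun i => P.coeff i) (fun _ _ => Nat.zero_le _)
      (mem_range.2 (Nat.lt_succ_of_le h))
  · rw [coeff_eq_zero_of_natDegree_lt (by omega)]; exact Nat.zero_le _

/-- Coefficients below `b` are the base `b` digits of the value at `b`; removing the lowest digit
corresponds to `divX`. -/
theorem Polynomial.digit_eval {b : ℕ} (j : ℕ) : ∀ P : ℕ[X], (∀ i, P.coeff i < b) →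
    P.eval b / b ^ j % b = P.coeff j := by
  induction j with
  | zero =>
    intro P h
    conv_lhs => rw [← P.divX_mul_X_add]
    simp [Nat.mod_eq_of_lt (h 0)]
  | succ j ih =>
    intro P h
    have hb : 0 < b := (Nat.zero_le _).trans_lt (h 0)
    conv_lhs => rw [← P.divX_mul_X_add]
    rw [pow_succ', ← Nat.div_div_eq_div_mul, eval_add, eval_mul, eval_X, eval_C, mul_comm,
      Nat.mul_add_div hb, Nat.div_eq_of_lt (h 0), add_zero, ih _ fun i => ?_, coeff_divX]
    rw [coeff_divX]; exact h _

/-! ## Clique covers and sums of matchings -/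

section Matchings

open Classical in
/-- The sum of the weights of all cliques inside `Y`. -/
noncomputable def cliqueSum {R : Type*} [CommSemiring R] (H : SimpleGraph ℕ) (w : ℕ → R)
    (Y : Finset ℕ) : R :=
  ∑ A ∈ Y.powerset.filter (fun A : Finset ℕ => H.IsClique (A : Set ℕ)), ∏ v ∈ A, w v

open Classical in
/-- The weighted adjacency matrix of the slots outside of `S`, where an edge is weighted by the
cliques inside `X` which it extends; slots in `S` are matched to themselves. -/
noncomputable def slotMatrix {R : Type*} [CommSemiring R] (H : SimpleGraph ℕ) (S : Finset ℕ)
    (x w : ℕ → ℕ → R) (X : Finset ℕ) (i j : ℕ) : R :=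
  if i = j then (if i ∈ S then 1 else 0)
  else if i ∈ S ∨ j ∈ S ∨ ¬ H.Adj i j then 0
  else x (min i j) (max i j) *
    cliqueSum H (w (min i j)) (X.filter fun v => H.Adj v i ∧ H.Adj v j)

/-- The sum of the hafnians of all slot matrices. -/
noncomputable def hafnianSum {R : Type*} [CommSemiring R] (H : SimpleGraph ℕ) (S : Finset ℕ)
    (N : ℕ) (x w : ℕ → ℕ → R) : R :=
  ∑ X ∈ S.powerset, ∑ σ : Equiv.Perm (Fin N) with σ * σ = 1,
    ∏ i : Fin N with i ≤ σ i, slotMatrix H S x w X i (σ i)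

theorem slotMatrix_comm {R : Type*} [CommSemiring R] (H : SimpleGraph ℕ) (S : Finset ℕ)
    (x w : ℕ → ℕ → R) (X : Finset ℕ) (i j : ℕ) :
    slotMatrix H S x w X i j = slotMatrix H S x w X j i := by
  classical
  by_cases h : i = j
  · rw [h]
  · simp only [slotMatrix, if_neg h, if_neg (Ne.symm h), min_comm j i, max_comm j i]
    simp only [H.adj_comm j i, or_left_comm (a := j ∈ S), and_comm]

theorem slotMatrix_self {R : Type*} [CommSemiring R] (H : SimpleGraph ℕ) (S : Finset ℕ)
    (x w : ℕ → ℕ → R) (X : Finset ℕ) (i : ℕ) :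
    slotMatrix H S x w X i i = if i ∈ S then 1 else 0 := by
  simp [slotMatrix]

open Classical in
theorem slotMatrix_of_lt {R : Type*} [CommSemiring R] (H : SimpleGraph ℕ) (S : Finset ℕ)
    (x w : ℕ → ℕ → R) (X : Finset ℕ) {i j : ℕ} (hij : i < j) (hi : i ∉ S) (hj : j ∉ S)
    (h : H.Adj i j) :
    slotMatrix H S x w X i j =
      x i j * cliqueSum H (w i) (X.filter fun v => H.Adj v i ∧ H.Adj v j) := by
  rw [slotMatrix, if_neg hij.ne, if_neg (by tauto), min_eq_left hij.le, max_eq_right hij.le]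

theorem slotMatrix_eq_zero {R : Type*} [CommSemiring R] (H : SimpleGraph ℕ) (S : Finset ℕ)
    (x w : ℕ → ℕ → R) (X : Finset ℕ) {i j : ℕ} (hij : i ≠ j)
    (h : ¬ (i ∉ S ∧ j ∉ S ∧ H.Adj i j)) : slotMatrix H S x w X i j = 0 := by
  rw [slotMatrix, if_neg hij, if_pos (by tauto)]

/-- Each determinant is the square of a hafnian, since diagonal entries are `0` or `1`. In
characteristic two the sum of the squares is the square of the sum. -/
theorem sum_det_slotMatrix {R : Type*} [CommRing R] [CharP R 2] (H : SimpleGraph ℕ)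
    (S : Finset ℕ) (N : ℕ) (x w : ℕ → ℕ → R) :
    ∑ X ∈ S.powerset, (leadingMatrix (slotMatrix H S x w X) N).det = hafnianSum H S N x w ^ 2 := by
  rw [hafnianSum, CharTwo.sum_sq]
  refine sum_congr rfl fun X _ => ?_
  refine Matrix.det_eq_sq_sum_involutions _ (fun i j => slotMatrix_comm H S x w X i j) fun i => ?_
  simp only [leadingMatrix, Matrix.of_apply, slotMatrix_self]
  split <;> simp

/-- The graph `K` on the slots `0, …, n - 1`; all further slots are adjacent to everything. -/
def slotGraph {n : ℕ} (K : SimpleGraph (Fin n)) : SimpleGraph ℕ where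
  Adj i j := i ≠ j ∧ ∀ (hi : i < n) (hj : j < n), K.Adj ⟨i, hi⟩ ⟨j, hj⟩
  symm := ⟨fun _ _ h => ⟨h.1.symm, fun hi hj => (h.2 hj hi).symm⟩⟩
  loopless := ⟨fun _ h => h.1 rfl⟩

/-- The numbers of the vertices in `S`. -/
def slotSet {n : ℕ} (S : Finset (Fin n)) : Finset ℕ := S.map Fin.valEmbedding

theorem mem_slotSet {n : ℕ} {S : Finset (Fin n)} {i : ℕ} :
    i ∈ slotSet S ↔ ∃ h : i < n, (⟨i, h⟩ : Fin n) ∈ S := by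
  simp only [slotSet, mem_map, Fin.valEmbedding_apply]
  constructor
  · rintro ⟨a, ha, rfl⟩; exact ⟨a.2, ha⟩
  · rintro ⟨h, hi⟩; exact ⟨_, hi, rfl⟩

open Classical in
/-- A nonvanishing sum of hafnians yields a matching of the slots outside of `S`, with cliques
attached to its edges which cover `S`. -/
theorem exists_matching_of_hafnianSum_ne_zero {R : Type*} [CommRing R] [CharP R 2]
    {H : SimpleGraph ℕ} {S : Finset ℕ} {N : ℕ} {x w : ℕ → ℕ → R}
    (h : hafnianSum H S N x w ≠ 0) :
    ∃ (σ : Equiv.Perm (Fin N)) (q : Fin N → Finset ℕ), (∀ i, σ (σ i) = i) ∧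
      (∀ i, σ i = i → (i : ℕ) ∈ S) ∧
      (∀ i, i < σ i → (i : ℕ) ∉ S ∧ (σ i : ℕ) ∉ S ∧ H.Adj i (σ i) ∧
        H.IsClique (q i : Set ℕ) ∧ ∀ v ∈ q i, H.Adj v i ∧ H.Adj v (σ i)) ∧
      ∀ s ∈ S, ∃ i, i < σ i ∧ s ∈ q i := by
  -- Fix one matching whose contributions over all `X` do not cancel.
  rw [hafnianSum, sum_comm] at h
  obtain ⟨σ, hσ, hne⟩ := exists_ne_zero_of_sum_ne_zero h
  have hσ2 : ∀ i, σ (σ i) = i := fun i => by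
    rw [← Equiv.Perm.mul_apply, (mem_filter.1 hσ).2, Equiv.Perm.one_apply]
  have hfix : ∀ i, σ i = i → (i : ℕ) ∈ S := by
    intro i hi
    by_contra hS
    refine hne (sum_eq_zero fun X _ => prod_eq_zero (i := i) (by simp [hi]) ?_)
    rw [hi, slotMatrix_self, if_neg hS]
  have hedge : ∀ i, i < σ i → (i : ℕ) ∉ S ∧ (σ i : ℕ) ∉ S ∧ H.Adj i (σ i) := by
    intro i hi
    by_contra hS
    refine hne (sum_eq_zero fun X _ => prod_eq_zero (i := i) (by simp [hi.le]) ?_)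
    exact slotMatrix_eq_zero H S x w X (Fin.val_injective.ne hi.ne) hS
  let t : Fin N → Finset (Finset ℕ) := fun i =>
    if i < σ i then S.powerset.filter fun A : Finset ℕ => H.IsClique (A : Set ℕ) ∧
      ∀ v ∈ A, H.Adj v i ∧ H.Adj v (σ i) else {∅}
  let f : Finset ℕ → Fin N → Finset ℕ → R := fun X i A =>
    if i < σ i then (if A ⊆ X then x i (σ i) * ∏ v ∈ A, w i v else 0) else 1
  have hprod : ∀ X ∈ S.powerset, ∏ i : Fin N with i ≤ σ i, slotMatrix H S x w X i (σ i) =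
      ∏ i, ∑ A ∈ t i, f X i A := by
    intro X hX
    rw [prod_filter]
    refine prod_congr rfl fun i _ => ?_
    rcases lt_trichotomy i (σ i) with hi | hi | hi
    · obtain ⟨h1, h2, h3⟩ := hedge i hi
      rw [if_pos hi.le, slotMatrix_of_lt H S x w X hi h1 h2 h3, cliqueSum, mul_sum]
      simp only [t, f, if_pos hi]
      rw [← sum_filter]
      refine sum_congr ?_ fun _ _ => rfl
      ext A
      simp only [mem_filter, mem_powerset, subset_iff] at hX ⊢
      constructor
      · rintro ⟨h4, h5⟩
        exact ⟨⟨fun v hv => hX (h4 hv).1, h5, fun v hv => (h4 hv).2⟩, fun v hv => (h4 hv).1⟩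
      · rintro ⟨⟨_, h5, h6⟩, h7⟩
        exact ⟨fun v hv => ⟨h7 hv, h6 v hv⟩, h5⟩
    · rw [← hi, if_pos le_rfl, slotMatrix_self, if_pos (hfix i hi.symm)]
      simp [t, f, ← hi]
    · rw [if_neg (not_le.2 hi)]
      simp [t, f, not_lt.2 hi.le]
  rw [sum_congr rfl hprod] at hne
  simp_rw [prod_univ_sum] at hne
  rw [sum_comm] at hne
  obtain ⟨q, hq, hqne⟩ := exists_ne_zero_of_sum_ne_zero hne
  refine ⟨σ, q, hσ2, hfix, fun i hi => ?_, fun s hs => ?_⟩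
  · have := (Fintype.mem_piFinset.1 hq) i
    simp only [t, if_pos hi, mem_filter] at this
    obtain ⟨h1, h2, h3⟩ := hedge i hi
    exact ⟨h1, h2, h3, this.2⟩
  · by_contra hcon
    push Not at hcon
    -- If no chosen clique contains `s`, toggling `s` in `X` does not change the weight, and the sum
    -- over `X` cancels in pairs.
    have hsub : ∀ (X : Finset ℕ) i, i < σ i → (q i ⊆ symmDiff X {s} ↔ q i ⊆ X) := by
      intro X i hi
      have := hcon i hi
      refine forall_congr' fun v => imp_congr_right fun hv => ?_
      have hvs : v ≠ s := fun h => this (h ▸ hv)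
      simp [mem_symmDiff, hvs]
    refine hqne (sum_involution (fun X _ => symmDiff X {s}) (fun X _ => ?_) (fun X _ _ => ?_)
      (fun X hX => ?_) (fun X _ => by simp))
    · have : ∏ i, f (symmDiff X {s}) i (q i) = ∏ i, f X i (q i) := by
        refine prod_congr rfl fun i _ => ?_
        simp only [f]
        split
        · next hi => rw [if_congr (hsub X i hi) rfl rfl]
        · rfl
      rw [this, CharTwo.add_self_eq_zero]
    · intro h
      have := symmDiff_eq_left.1 h
      simp at this
    · rw [mem_powerset] at hX ⊢
      intro v hv
      rw [mem_symmDiff, mem_singleton] at hv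
      rcases hv with hv | hv
      · exact hX hv.1
      · exact hv.1 ▸ hs

theorem card_slotSet {n : ℕ} (S : Finset (Fin n)) : (slotSet S).card = S.card := card_map _

/-- The colours are the matching edges: an edge and its attached clique form one clique. The fixed
points are exactly the `S.card` slots in `S`, and the padding makes the other slots `2 * k` in
number, so there are `k` edges. A vertex in several of these cliques picks any of them. -/
theorem colorable_of_hafnianSum_ne_zero {R : Type*} [CommRing R] [CharP R 2] {n k : ℕ}
    {K : SimpleGraph (Fin n)} {S : Finset (Fin n)} {x w : ℕ → ℕ → R}
    (hk : n - S.card ≤ 2 * k)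
    (h : hafnianSum (slotGraph K) (slotSet S) (n + (2 * k - (n - S.card))) x w ≠ 0) :
    Kᶜ.Colorable k := by
  classical
  have hSn : S.card ≤ n := by simpa using S.card_le_univ
  set N := n + (2 * k - (n - S.card)) with hN
  obtain ⟨σ, q, hσ2, hfix, hedge, hcov⟩ := exists_matching_of_hafnianSum_ne_zero h
  have hblock : ∀ u : Fin n, ∃ r : {i : Fin N // i < σ i},
      (u : ℕ) ∈ q r ∨ (u : ℕ) = r ∨ (u : ℕ) = σ r := by
    intro u
    have huN : (u : ℕ) < N := by omega
    rcases lt_trichotomy (⟨u, huN⟩ : Fin N) (σ ⟨u, huN⟩) with hu | hu | hu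
    · exact ⟨⟨_, hu⟩, by simp⟩
    · obtain ⟨i, hi, hui⟩ := hcov u (hfix _ hu.symm)
      exact ⟨⟨i, hi⟩, by simp [hui]⟩
    · exact ⟨⟨σ ⟨u, huN⟩, by rw [hσ2]; exact hu⟩, by simp [hσ2]⟩
  choose col hcol using hblock
  have hclique : ∀ (r : {i : Fin N // i < σ i}) (u v : ℕ), u ≠ v →
      (u ∈ q r ∨ u = (r : Fin N) ∨ u = σ r) → (v ∈ q r ∨ v = (r : Fin N) ∨ v = σ r) →
      (slotGraph K).Adj u v := by
    rintro ⟨r, hr⟩ u v huv hu hv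
    obtain ⟨_, _, h3, h4, h5⟩ := hedge r hr
    rcases hu with hu | rfl | rfl <;> rcases hv with hv | rfl | rfl
    · exact h4 hu hv huv
    · exact (h5 u hu).1
    · exact (h5 u hu).2
    · exact (h5 v hv).1.symm
    · exact absurd rfl huv
    · exact h3
    · exact (h5 v hv).2.symm
    · exact h3.symm
    · exact absurd rfl huv
  let C : Kᶜ.Coloring {i : Fin N // i < σ i} := SimpleGraph.Coloring.mk col (by
    intro u v huv heq
    rw [SimpleGraph.compl_adj] at huv
    apply huv.2
    have := hclique (col u) u v (Fin.val_injective.ne huv.1) (hcol u) (heq ▸ hcol v)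
    exact this.2 u.2 v.2)
  refine C.colorable.mono ?_
  have hcard1 : (univ.filter fun i : Fin N => σ i = i).card = S.card := by
    rw [← card_slotSet S]
    refine card_bij (fun (i : Fin N) _ => (i : ℕ)) (fun i hi => hfix i (mem_filter.1 hi).2)
      (fun i _ j _ h => Fin.val_injective h) fun s hs => ?_
    obtain ⟨hsn, _⟩ := mem_slotSet.1 hs
    have hsN : s < N := by omega
    refine ⟨⟨s, hsN⟩, ?_, rfl⟩
    rw [mem_filter]
    refine ⟨mem_univ _, ?_⟩
    by_contra hne
    rcases lt_or_gt_of_ne hne with hlt | hlt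
    · have := (hedge (σ ⟨s, hsN⟩) (by rwa [hσ2])).2.1
      rw [hσ2] at this
      exact this hs
    · exact (hedge _ hlt).1 hs
  have hcard2 : (univ.filter fun i : Fin N => σ i < i).card =
      (univ.filter fun i : Fin N => i < σ i).card := by
    refine card_bij' (fun i _ => σ i) (fun i _ => σ i) ?_ ?_ ?_ ?_
    · intro i hi; simpa [hσ2] using hi
    · intro i hi; simpa [hσ2] using hi
    · intro i _; exact hσ2 i
    · intro i _; exact hσ2 i
  have hcard3 : N = (univ.filter fun i : Fin N => σ i = i).card +
      ((univ.filter fun i : Fin N => i < σ i).card +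
        (univ.filter fun i : Fin N => σ i < i).card) := by
    rw [← card_union_of_disjoint, ← card_union_of_disjoint]
    · conv_lhs => rw [← Fintype.card_fin N, ← card_univ]
      congr 1
      ext i
      simp only [mem_univ, mem_union, mem_filter, true_and, true_iff]
      rcases lt_trichotomy i (σ i) with h | h | h
      · exact Or.inr (Or.inl h)
      · exact Or.inl h.symm
      · exact Or.inr (Or.inr h)
    · rw [disjoint_left]
      intro i hi hi'
      simp only [mem_union, mem_filter, mem_univ, true_and] at hi hi'
      rw [hi] at hi'
      simp at hi'
    · rw [disjoint_left]
      intro i hi hi'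
      simp only [mem_filter, mem_univ, true_and] at hi hi'
      exact absurd hi (not_lt.2 hi'.le)
  rw [Fintype.card_subtype]
  omega

/-! ### From a colouring to weights with nonvanishing sum of hafnians. -/

/-- The cliques with nonzero weight are all subsets of `Y.filter P`. Their number is a power of two,
which is odd only if that set is empty. -/
theorem cliqueSum_indicator {R : Type*} [CommRing R] [CharP R 2] {H : SimpleGraph ℕ}
    {P : ℕ → Prop} [DecidablePred P] (hP : ∀ i j, i ≠ j → P i → P j → H.Adj i j) (Y : Finset ℕ) :
    cliqueSum H (fun v => if P v then (1 : R) else 0) Y = if ∃ v ∈ Y, P v then 0 else 1 := by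
  classical
  have h1 : cliqueSum H (fun v => if P v then (1 : R) else 0) Y =
      ∑ A ∈ (Y.filter P).powerset, 1 := by
    rw [cliqueSum]
    have hsub : (Y.filter P).powerset ⊆ Y.powerset.filter fun A : Finset ℕ => H.IsClique (A : Set ℕ) := by
      intro A hA
      rw [mem_powerset] at hA
      rw [mem_filter, mem_powerset]
      refine ⟨fun v hv => (mem_filter.1 (hA hv)).1, fun u hu v hv huv => ?_⟩
      exact hP u v huv (mem_filter.1 (hA hu)).2 (mem_filter.1 (hA hv)).2
    rw [← sum_subset hsub]
    · refine sum_congr rfl fun A hA => prod_eq_one fun v hv => ?_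
      rw [if_pos (mem_filter.1 (mem_powerset.1 hA hv)).2]
    · intro A hA hA'
      have : ∃ v ∈ A, ¬ P v := by
        by_contra hcon
        push Not at hcon
        apply hA'
        rw [mem_powerset]
        intro v hv
        exact mem_filter.2 ⟨mem_powerset.1 (mem_filter.1 hA).1 hv, hcon v hv⟩
      obtain ⟨v, hv, hPv⟩ := this
      exact prod_eq_zero hv (if_neg hPv)
  rw [h1, sum_const, card_powerset, nsmul_eq_mul, mul_one, Nat.cast_pow, Nat.cast_ofNat,
    CharTwo.two_eq_zero]
  split
  · next h =>
    obtain ⟨v, hv, hPv⟩ := h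
    rw [zero_pow]
    exact card_ne_zero_of_mem (mem_filter.2 ⟨hv, hPv⟩)
  · next h =>
    rw [filter_eq_empty_iff.2 fun v hv hPv => h ⟨v, hv, hPv⟩, card_empty, pow_zero]

/-- No three vertices outside of `S` are pairwise adjacent. -/
def TriangleFreeOff {n : ℕ} (K : SimpleGraph (Fin n)) (S : Finset (Fin n)) : Prop :=
  ∀ u v w, u ∉ S → v ∉ S → w ∉ S → K.Adj u v → K.Adj u w → K.Adj v w → False

/-- Colour a slot assignment: an injection of the vertices outside of `S` into pairs of a colour
and a bit. -/
theorem exists_injOn_color_bit {n k : ℕ} {K : SimpleGraph (Fin n)} {S : Finset (Fin n)}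
    (hK : TriangleFreeOff K S) (c : Kᶜ.Coloring (Fin k)) :
    ∃ g : Fin n → Fin k × Bool, (∀ u, (g u).1 = c u) ∧ Set.InjOn g {u | u ∉ S} := by
  classical
  have hadj : ∀ u v, u ≠ v → c u = c v → K.Adj u v := by
    intro u v huv hc
    by_contra h
    exact c.valid ((SimpleGraph.compl_adj _ _ _).2 ⟨huv, h⟩) hc
  -- The bit tells whether a smaller vertex outside of `S` has the same colour. Equal bits on two
  -- vertices of one colour would yield a third one, hence a triangle.
  refine ⟨fun u => (c u, decide (∃ v, v ∉ S ∧ v < u ∧ c v = c u)), fun _ => rfl, ?_⟩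
  have key : ∀ u v, u ∉ S → v ∉ S → u < v → c u = c v →
      ¬ ((∃ t, t ∉ S ∧ t < u ∧ c t = c u) ↔ ∃ t, t ∉ S ∧ t < v ∧ c t = c v) := by
    intro u v hu hv huv hc hiff
    obtain ⟨t, ht, htu, hct⟩ := hiff.2 ⟨u, hu, huv, hc⟩
    exact hK t u v ht hu hv (hadj _ _ htu.ne hct) (hadj _ _ (htu.trans huv).ne (hct.trans hc))
      (hadj _ _ huv.ne hc)
  intro u hu v hv huv
  simp only [Prod.mk.injEq, decide_eq_decide] at huv
  rcases lt_trichotomy u v with h | h | h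
  · exact absurd huv.2 (key u v hu hv h huv.1)
  · exact h
  · exact absurd huv.2.symm (key v u hv hu h huv.1.symm)

theorem card_compl_le_of_colorable {n k : ℕ} {K : SimpleGraph (Fin n)} {S : Finset (Fin n)}
    (hK : TriangleFreeOff K S) (hc : Kᶜ.Colorable k) : n - S.card ≤ 2 * k := by
  classical
  obtain ⟨c⟩ := hc
  obtain ⟨g, _, hg⟩ := exists_injOn_color_bit hK c
  have h1 : (univ \ S).card = n - S.card := by
    rw [card_sdiff_of_subset (subset_univ S), card_univ, Fintype.card_fin]
  rw [← h1]
  have := card_le_card_of_injOn (s := univ \ S) (t := (univ : Finset (Fin k × Bool))) g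
    (fun _ _ => mem_univ _) (fun u hu v hv => hg (by simpa using hu) (by simpa using hv))
  simpa [mul_comm] using this

/-- A colouring of the complement yields weights for which the sum of hafnians is `1`. -/
theorem exists_hafnianSum_eq_one {R : Type*} [CommRing R] [CharP R 2] {n k : ℕ}
    {K : SimpleGraph (Fin n)} {S : Finset (Fin n)} (hk : 0 < k) (hK : TriangleFreeOff K S)
    (hc : Kᶜ.Colorable k) :
    ∃ x w : ℕ → ℕ → R,
      hafnianSum (slotGraph K) (slotSet S) (n + (2 * k - (n - S.card))) x w = 1 := by
  classical
  have hle := card_compl_le_of_colorable hK hc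
  have hSn : S.card ≤ n := by simpa using S.card_le_univ
  obtain ⟨c⟩ := hc
  have hadj : ∀ u v, u ≠ v → c u = c v → K.Adj u v := by
    intro u v huv hc
    by_contra h
    exact c.valid ((SimpleGraph.compl_adj _ _ _).2 ⟨huv, h⟩) hc
  obtain ⟨g, hg1, hg⟩ := exists_injOn_color_bit hK c
  set N := n + (2 * k - (n - S.card)) with hN
  set H := slotGraph K with hH
  set S' := slotSet S with hS'
  have hS'n : ∀ i ∈ S', i < n := fun i hi => (mem_slotSet.1 hi).1
  -- There are exactly `2 * k` slots outside of `S`, so the injection on real vertices extends to a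
  -- bijection; dummies fill up each colour to two slots.
  have hcardT : Fintype.card {i : Fin N // (i : ℕ) ∉ S'} = (univ : Finset (Fin k × Bool)).card := by
    have h1 : (univ.filter fun i : Fin N => (i : ℕ) ∈ S').card = S.card := by
      rw [← card_slotSet S]
      refine card_bij (fun (i : Fin N) _ => (i : ℕ)) (fun i hi => (mem_filter.1 hi).2)
        (fun i _ j _ h => Fin.val_injective h) fun s hs => ?_
      have := hS'n s hs
      exact ⟨⟨s, by omega⟩, by simpa using hs, rfl⟩
    rw [Fintype.card_subtype_compl, Fintype.card_fin, Fintype.card_subtype, h1]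
    simp
    omega
  let f : {i : Fin N // (i : ℕ) ∉ S'} → Fin k × Bool := fun i =>
    if hi : ((i : Fin N) : ℕ) < n then g ⟨i, hi⟩ else (⟨0, hk⟩, false)
  obtain ⟨e', he'⟩ := exists_equiv_extend_of_card_eq hcardT
    (s := univ.filter fun i : {i : Fin N // (i : ℕ) ∉ S'} => ((i : Fin N) : ℕ) < n) (f := f)
    (subset_univ _) (by
      intro i hi j hj hij
      have hi' : ((i : Fin N) : ℕ) < n := by simpa using hi
      have hj' : ((j : Fin N) : ℕ) < n := by simpa using hj
      simp only [f, dif_pos hi', dif_pos hj'] at hij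
      have := @hg ⟨i, hi'⟩
        (fun h => i.2 (mem_slotSet.2 ⟨hi', h⟩)) ⟨j, hj'⟩
        (fun h => j.2 (mem_slotSet.2 ⟨hj', h⟩)) hij
      exact Subtype.ext (Fin.ext (by simpa using this)))
  let e : {i : Fin N // (i : ℕ) ∉ S'} ≃ Fin k × Bool :=
    e'.trans (Equiv.subtypeUnivEquiv fun _ => mem_univ _)
  have he : ∀ i : {i : Fin N // (i : ℕ) ∉ S'}, ∀ hi : ((i : Fin N) : ℕ) < n,
      (e i).1 = c ⟨i, hi⟩ := by
    intro i hi
    have := he' i (by simpa using hi)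
    change ((e' i : Fin k × Bool)).1 = _
    rw [this]
    simp only [f, dif_pos hi, hg1]
  -- The final default is harmless: numbers from `n` on are adjacent to everything, so colour
  -- classes remain cliques.
  let cl : ℕ → Fin k := fun v =>
    if hv : v < n then c ⟨v, hv⟩
    else if hv' : v < N ∧ v ∉ S' then (e ⟨⟨v, hv'.1⟩, hv'.2⟩).1 else ⟨0, hk⟩
  have hcl : ∀ i : {i : Fin N // (i : ℕ) ∉ S'}, cl (i : Fin N) = (e i).1 := by
    intro i
    by_cases hi : ((i : Fin N) : ℕ) < n
    · simp only [cl, dif_pos hi, he i hi]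
    · simp only [cl, dif_neg hi, dif_pos (show ((i : Fin N) : ℕ) < N ∧ ((i : Fin N) : ℕ) ∉ S' from
        ⟨i.1.2, i.2⟩)]
  have hclH : ∀ i j, i ≠ j → cl i = cl j → H.Adj i j := by
    intro i j hij hc
    refine ⟨hij, fun hi hj => hadj _ _ (by simpa using hij) ?_⟩
    simpa [cl, hi, hj] using hc
  -- The matching joins the two slots of each colour.
  let τ : Fin N → Fin N := fun i =>
    if h : (i : ℕ) ∈ S' then i else (e.symm ((e ⟨i, h⟩).1, !(e ⟨i, h⟩).2) : Fin N)
  have hτS : ∀ i : Fin N, (i : ℕ) ∈ S' → τ i = i := fun i h => dif_pos h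
  have hτ : ∀ (i : Fin N) (h : (i : ℕ) ∉ S'),
      τ i = (e.symm ((e ⟨i, h⟩).1, !(e ⟨i, h⟩).2) : Fin N) := fun i h => dif_neg h
  have hτmem : ∀ i : Fin N, (i : ℕ) ∉ S' → (τ i : ℕ) ∉ S' := by
    intro i h
    rw [hτ i h]; exact (e.symm _).2
  have hinv : Function.Involutive τ := by
    intro i
    by_cases h : (i : ℕ) ∈ S'
    · rw [hτS i h, hτS i h]
    · have h2 := hτmem i h
      rw [hτ _ h2]
      have : (⟨τ i, h2⟩ : {i : Fin N // (i : ℕ) ∉ S'}) =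
          e.symm ((e ⟨i, h⟩).1, !(e ⟨i, h⟩).2) := Subtype.ext (hτ i h)
      rw [this]
      simp
  have hτne : ∀ i : Fin N, (i : ℕ) ∉ S' → τ i ≠ i := by
    intro i h heq
    have h1 : e.symm ((e ⟨i, h⟩).1, !(e ⟨i, h⟩).2) = ⟨i, h⟩ :=
      Subtype.ext ((hτ i h).symm.trans heq)
    have h2 := congrArg (fun t => (e t).2) h1
    simp at h2
  have hτcl : ∀ i : Fin N, (i : ℕ) ∉ S' → cl (τ i) = cl i := by
    intro i h
    rw [hτ i h, hcl, hcl ⟨i, h⟩]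
    simp
  have hrep : ∀ a : Fin k, ∃ i : Fin N, (i : ℕ) ∉ S' ∧ i < τ i ∧ cl i = a := by
    intro a
    have h0 : cl (e.symm (a, false) : Fin N) = a := by rw [hcl]; simp
    have hm := (e.symm (a, false)).2
    set i : Fin N := (e.symm (a, false) : Fin N) with hi
    rcases lt_or_gt_of_ne (hτne i hm) with hlt | hlt
    · exact ⟨τ i, hτmem i hm, by rwa [hinv i], by rw [hτcl i hm, h0]⟩
    · exact ⟨i, hm, hlt, h0⟩
  let σ : Equiv.Perm (Fin N) := hinv.toPerm
  have hσ : ∀ i, σ i = τ i := fun i => rfl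
  -- With these edge weights only the matching `τ` survives. With the vertex weights below, each
  -- edge sees only the vertices of its own colour.
  let x : ℕ → ℕ → R := fun i j => if ∃ hi : i < N, j = τ ⟨i, hi⟩ then 1 else 0
  let w : ℕ → ℕ → R := fun i v => if cl v = cl i then 1 else 0
  have hx : ∀ i j : Fin N, x i j = if j = τ i then 1 else 0 := by
    intro i j
    simp only [x]
    refine if_congr ⟨?_, ?_⟩ rfl rfl
    · rintro ⟨_, h⟩; exact Fin.ext h
    · rintro rfl; exact ⟨i.2, rfl⟩
  refine ⟨x, w, ?_⟩
  rw [hafnianSum, sum_comm, sum_eq_single σ]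
  · rw [sum_eq_single ∅]
    · refine prod_eq_one fun i hi => ?_
      have hile : i ≤ τ i := (mem_filter.1 hi).2
      rw [hσ]
      by_cases hiS : (i : ℕ) ∈ S'
      · rw [hτS i hiS, slotMatrix_self, if_pos hiS]
      · have hlt : i < τ i := lt_of_le_of_ne hile (hτne i hiS).symm
        rw [slotMatrix_of_lt H S' x w ∅ hlt hiS (hτmem i hiS)
          (hclH _ _ (Fin.val_injective.ne hlt.ne) (hτcl i hiS).symm), hx, if_pos rfl, one_mul,
          filter_empty]
        have := cliqueSum_indicator (R := R) (H := H) (P := fun v => cl v = cl i)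
          (fun a b hab ha hb => hclH a b hab (ha.trans hb.symm)) ∅
        simpa using this
    -- An element of a nonempty `X` makes the clique sum at the edge of its colour even, so only `X
    -- = ∅` contributes.
    · intro X hX hne
      obtain ⟨s, hs⟩ := nonempty_iff_ne_empty.2 hne
      have hsS := mem_powerset.1 hX hs
      obtain ⟨i, hiS, hlt, hic⟩ := hrep (cl s)
      refine prod_eq_zero (i := i) (mem_filter.2 ⟨mem_univ _, hlt.le⟩) ?_
      have hsi : s ≠ i := fun h => hiS (h ▸ hsS)
      have hsi' : s ≠ τ i := fun h => hτmem i hiS (h ▸ hsS)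
      rw [hσ, slotMatrix_of_lt H S' x w X hlt hiS (hτmem i hiS)
          (hclH _ _ (Fin.val_injective.ne hlt.ne) (hτcl i hiS).symm)]
      have := cliqueSum_indicator (R := R) (H := H) (P := fun v => cl v = cl i)
          (fun a b hab ha hb => hclH a b hab (ha.trans hb.symm))
          (X.filter fun v => H.Adj v i ∧ H.Adj v (τ i))
      rw [if_pos] at this
      · exact (congrArg _ this).trans (mul_zero _)
      · exact ⟨s, mem_filter.2 ⟨hs, hclH _ _ hsi hic.symm,
          hclH _ _ hsi' (hic.symm.trans (hτcl i hiS).symm)⟩, hic.symm⟩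
    · intro h
      exact absurd (empty_mem_powerset _) h
  · intro ρ hρ hne
    have hρ2 : ∀ i, ρ (ρ i) = i := fun i => by
      rw [← Equiv.Perm.mul_apply, (mem_filter.1 hρ).2, Equiv.Perm.one_apply]
    -- Only indices with `i ≤ ρ i` give factors. If the involutions differ at `i`, they also differ
    -- at `ρ i`, and one of the two indices qualifies.
    have hex : ∃ i, i ≤ ρ i ∧ ρ i ≠ τ i := by
      obtain ⟨i, hi⟩ : ∃ i, ρ i ≠ σ i := by
        by_contra hcon
        push Not at hcon
        exact hne (Equiv.ext hcon)
      rcases le_total i (ρ i) with h | h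
      · exact ⟨i, h, hi⟩
      · refine ⟨ρ i, by rwa [hρ2], fun heq => hi ?_⟩
        rw [hρ2] at heq
        rw [hσ]
        conv_rhs => rw [heq]
        exact (hinv _).symm
    obtain ⟨i, hi, hne'⟩ := hex
    refine sum_eq_zero fun X _ => prod_eq_zero (i := i) (mem_filter.2 ⟨mem_univ _, hi⟩) ?_
    rcases hi.eq_or_lt with heq | hlt
    · rw [← heq, slotMatrix_self, if_neg]
      intro hiS
      exact hne' (by rw [← heq, hτS i hiS])
    · by_cases hS3 : (i : ℕ) ∉ S' ∧ (ρ i : ℕ) ∉ S' ∧ H.Adj i (ρ i)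
      · rw [slotMatrix_of_lt H S' x w X hlt hS3.1 hS3.2.1 hS3.2.2, hx, if_neg hne', zero_mul]
      · exact slotMatrix_eq_zero H S' x w X (Fin.val_injective.ne hlt.ne) hS3
  · intro h
    have hσσ : σ * σ = 1 := by
      ext1 i
      rw [Equiv.Perm.mul_apply, Equiv.Perm.one_apply]
      exact hinv i
    exact absurd (mem_filter.2 ⟨mem_univ σ, hσσ⟩) h

end Matchings

/-! ## The two promises and the two problems -/

/-- Colour classes of the complement are cliques and disjoint for free; conversely, covering alone
suffices to choose a colour for each vertex. -/
theorem hasCliqueCover_iff_colorable_compl {n : ℕ} (G : SimpleGraph (Fin n)) (k : ℕ) :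
    HasCliqueCover G k ↔ Gᶜ.Colorable k := by
  classical
  constructor
  · rintro ⟨C, hC, _, hcov, hcard⟩
    choose f hf using hcov
    let c : Gᶜ.Coloring {A // A ∈ C} := SimpleGraph.Coloring.mk (fun v => ⟨f v, (hf v).1⟩) (by
      intro u v huv heq
      rw [SimpleGraph.compl_adj] at huv
      have h1 : f u = f v := congrArg Subtype.val heq
      exact huv.2 (hC _ (hf u).1 (hf u).2 (h1 ▸ (hf v).2) huv.1))
    refine c.colorable.mono ?_
    simpa using hcard
  · rintro ⟨c⟩
    refine ⟨univ.image fun v => univ.filter fun u => c u = c v, ?_, ?_, ?_, ?_⟩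
    · intro A hA
      obtain ⟨w, _, rfl⟩ := mem_image.1 hA
      intro u hu v hv huv
      rw [mem_coe, mem_filter] at hu hv
      by_contra h
      exact c.valid ((SimpleGraph.compl_adj _ _ _).2 ⟨huv, h⟩) (hu.2.trans hv.2.symm)
    · intro A hA B hB hAB
      obtain ⟨a, _, rfl⟩ := mem_image.1 (mem_coe.1 hA)
      obtain ⟨b, _, rfl⟩ := mem_image.1 (mem_coe.1 hB)
      simp only [Function.onFun, id]
      rw [disjoint_left]
      intro u hu hu'
      simp only [mem_filter, mem_univ, true_and] at hu hu'
      exact hAB (by simp only [← hu, ← hu'])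
    · intro v
      exact ⟨_, mem_image_of_mem _ (mem_univ v), by simp⟩
    · have : (univ.image fun v => univ.filter fun u => c u = c v) ⊆
          univ.image fun j : Fin k => univ.filter fun u => c u = j := by
        intro A hA
        obtain ⟨a, _, rfl⟩ := mem_image.1 hA
        exact mem_image_of_mem _ (mem_univ _)
      refine (card_le_card this).trans (card_image_le.trans ?_)
      simp

theorem IsFreeModulator.triangleFreeOff {n : ℕ} {G : SimpleGraph (Fin n)} {S : Finset (Fin n)}
    (h : IsFreeModulator (⊤ : SimpleGraph (Fin 3)) G S) : TriangleFreeOff G S := by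
  intro u v w hu hv hw huv huw hvw
  let f : Fin 3 → {v : Fin n | v ∉ S} := ![⟨u, hu⟩, ⟨v, hv⟩, ⟨w, hw⟩]
  have hf : ∀ i j, G.Adj (f i) (f j) ↔ i ≠ j := by
    intro i j
    fin_cases i <;> fin_cases j <;> simp [f, huv, huw, hvw, huv.symm, huw.symm, hvw.symm]
  have hinj : Function.Injective f := by
    intro i j hij
    by_contra hne
    exact ((hf i j).2 hne).ne (congrArg Subtype.val hij)
  exact h ⟨⟨⟨f, hinj⟩, fun {i j} => hf i j⟩⟩

theorem IsFreeModulator.triangleFreeOff_compl {n : ℕ} {G : SimpleGraph (Fin n)}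
    {S : Finset (Fin n)} (h : IsFreeModulator ((⊤ : SimpleGraph (Fin 3))ᶜ) G S) :
    TriangleFreeOff Gᶜ S := by
  intro u v w hu hv hw huv huw hvw
  let f : Fin 3 → {v : Fin n | v ∉ S} := ![⟨u, hu⟩, ⟨v, hv⟩, ⟨w, hw⟩]
  have hf : ∀ i j, Gᶜ.Adj (f i) (f j) ↔ i ≠ j := by
    intro i j
    fin_cases i <;> fin_cases j <;>
      simp [f, huv, huw, hvw, huv.symm, huw.symm, hvw.symm, -SimpleGraph.compl_adj]
  have hinj : Function.Injective f := by
    intro i j hij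
    by_contra hne
    exact ((hf i j).2 hne).ne (congrArg Subtype.val hij)
  refine h ⟨⟨⟨f, hinj⟩, fun {i j} => ?_⟩⟩
  have h1 : ¬ G.Adj (f i) (f j) := by
    by_cases hij : i = j
    · rw [hij]; exact G.loopless.irrefl _
    · exact ((SimpleGraph.compl_adj _ _ _).1 ((hf i j).2 hij)).2
  rw [compl_top]
  exact iff_of_false h1 (by simp)

/-! ## The sum of determinant series: naturality and size -/

/-- The sum of the determinant series of all slot matrices. -/
noncomputable def coverSum {R : Type*} [CommSemiring R] (H : SimpleGraph ℕ) (S : Finset ℕ) (N : ℕ)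
    (x w : ℕ → ℕ → R) (z : R) : R :=
  ∑ X ∈ S.powerset, detSeries (slotMatrix H S x w X) N z

section Naturality

variable {R T : Type*} [CommSemiring R] [CommSemiring T] (f : R →+* T)

theorem cliqueSum_map (H : SimpleGraph ℕ) (w : ℕ → R) (Y : Finset ℕ) :
    cliqueSum H (fun v => f (w v)) Y = f (cliqueSum H w Y) := by
  simp only [cliqueSum, map_sum, map_prod]

theorem slotMatrix_map (H : SimpleGraph ℕ) (S : Finset ℕ) (x w : ℕ → ℕ → R) (X : Finset ℕ)
    (i j : ℕ) : slotMatrix H S (fun i j => f (x i j)) (fun i j => f (w i j)) X i j =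
      f (slotMatrix H S x w X i j) := by
  simp only [slotMatrix, cliqueSum_map]
  split_ifs <;> simp

theorem coverSum_map (H : SimpleGraph ℕ) (S : Finset ℕ) (N : ℕ) (x w : ℕ → ℕ → R) (z : R) :
    coverSum H S N (fun i j => f (x i j)) (fun i j => f (w i j)) (f z) =
      f (coverSum H S N x w z) := by
  simp only [coverSum, map_sum, ← detSeries_map]
  refine sum_congr rfl fun X _ => ?_
  congr 1
  funext i j
  exact slotMatrix_map f H S x w X i j

theorem hafnianSum_map (H : SimpleGraph ℕ) (S : Finset ℕ) (N : ℕ) (x w : ℕ → ℕ → R) :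
    hafnianSum H S N (fun i j => f (x i j)) (fun i j => f (w i j)) =
      f (hafnianSum H S N x w) := by
  simp only [hafnianSum, map_sum, map_prod, slotMatrix_map]

end Naturality

section Size

theorem add_one_le_two_pow (n : ℕ) : n + 1 ≤ 2 ^ n := Nat.lt_two_pow_self

variable {H : SimpleGraph ℕ} {S : Finset ℕ} {n N δ ζ : ℕ} {x w : ℕ → ℕ → ℕ}

/-- The sum over all subsets, cliques or not, factors as the product of the `w v + 1`. -/
theorem cliqueSum_le {w : ℕ → ℕ} (hw : ∀ v, w v + 1 ≤ 2 ^ δ) {Y : Finset ℕ} (hY : Y.card ≤ n) :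
    cliqueSum H w Y ≤ 2 ^ (δ * n) := by
  classical
  calc cliqueSum H w Y ≤ ∑ A ∈ Y.powerset, ∏ v ∈ A, w v :=
        sum_le_sum_of_subset (filter_subset _ _)
    _ = ∏ v ∈ Y, (w v + 1) := (prod_add_one _).symm
    _ ≤ ∏ v ∈ Y, 2 ^ δ := prod_le_prod' fun v _ => hw v
    _ = 2 ^ (δ * Y.card) := by rw [prod_const, ← pow_mul]
    _ ≤ 2 ^ (δ * n) := Nat.pow_le_pow_right (by norm_num) (Nat.mul_le_mul_left _ hY)

theorem slotMatrix_le (hx : ∀ i j, x i j + 1 ≤ 2 ^ δ) (hw : ∀ i j, w i j + 1 ≤ 2 ^ δ)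
    {X : Finset ℕ} (hX : X.card ≤ n) (i j : ℕ) :
    slotMatrix H S x w X i j ≤ 2 ^ (δ * (n + 1)) := by
  classical
  have h1 : 1 ≤ 2 ^ (δ * (n + 1)) := Nat.one_le_two_pow
  simp only [slotMatrix]
  split_ifs
  · exact h1
  · omega
  · omega
  · rw [mul_add, mul_one, add_comm, pow_add]
    exact Nat.mul_le_mul (by have := hx (min i j) (max i j); omega)
      (cliqueSum_le (hw _) ((card_filter_le _ _).trans hX))

theorem walk_le {A : ℕ → ℕ → ℕ} {α : ℕ} (hA : ∀ i j, A i j ≤ 2 ^ α) (r k : ℕ) :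
    ∀ i, walk A N r k i ≤ 2 ^ ((N + α) * k) := by
  induction k with
  | zero => intro i; simp only [walk]; split <;> simp
  | succ k ih =>
    intro i
    rw [walk]
    calc _ ≤ ∑ j ∈ range N, 2 ^ α * 2 ^ ((N + α) * k) := by
          refine sum_le_sum fun j _ => ?_
          split
          · exact Nat.zero_le _
          · exact Nat.mul_le_mul (hA _ _) (ih _)
      _ = N * (2 ^ α * 2 ^ ((N + α) * k)) := by rw [sum_const, card_range, smul_eq_mul]
      _ ≤ 2 ^ N * (2 ^ α * 2 ^ ((N + α) * k)) :=
          Nat.mul_le_mul_right _ ((Nat.le_succ _).trans (add_one_le_two_pow N))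
      _ = 2 ^ ((N + α) * (k + 1)) := by rw [← pow_add, ← pow_add]; congr 1; ring

theorem walkSeries_le {A : ℕ → ℕ → ℕ} {α z : ℕ} (hA : ∀ i j, A i j ≤ 2 ^ α) (hz : z ≤ 2 ^ ζ) :
    walkSeries A N z ≤ 2 ^ (N * (N + (ζ + (N + α)) * N)) := by
  rw [walkSeries]
  calc _ ≤ ∏ r ∈ range N, 2 ^ (N + (ζ + (N + α)) * N) := by
        refine prod_le_prod' fun r _ => ?_
        calc _ ≤ ∑ k ∈ range (N + 1), 2 ^ ((ζ + (N + α)) * N) := by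
              refine sum_le_sum fun k hk => ?_
              have hk' : k ≤ N := Nat.lt_succ_iff.1 (mem_range.1 hk)
              calc z ^ k * walk A N r k r ≤ (2 ^ ζ) ^ k * 2 ^ ((N + α) * k) :=
                    Nat.mul_le_mul (Nat.pow_le_pow_left hz k) (walk_le hA r k r)
                _ = 2 ^ ((ζ + (N + α)) * k) := by rw [← pow_mul, ← pow_add]; congr 1; ring
                _ ≤ 2 ^ ((ζ + (N + α)) * N) :=
                    Nat.pow_le_pow_right (by norm_num) (Nat.mul_le_mul_left _ hk')
          _ = (N + 1) * 2 ^ ((ζ + (N + α)) * N) := by rw [sum_const, card_range, smul_eq_mul]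
          _ ≤ 2 ^ N * 2 ^ ((ζ + (N + α)) * N) := Nat.mul_le_mul_right _ (add_one_le_two_pow N)
          _ = _ := by rw [← pow_add]
    _ = _ := by rw [prod_const, card_range, ← pow_mul, mul_comm]

theorem detSeries_le {A : ℕ → ℕ → ℕ} {α z : ℕ} (hA : ∀ i j, A i j ≤ 2 ^ α) (hz : z ≤ 2 ^ ζ) :
    detSeries A N z ≤ 2 ^ (N + (1 + N * (N + (ζ + (N + α)) * N)) * N) := by
  rw [detSeries]
  set β := N * (N + (ζ + (N + α)) * N)
  have hQ : 1 + walkSeries A N z ≤ 2 ^ (1 + β) := by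
    have h1 : walkSeries A N z ≤ 2 ^ β := walkSeries_le hA hz
    have h2 : 1 ≤ 2 ^ β := Nat.one_le_two_pow
    rw [add_comm 1 β, pow_succ]; omega
  calc _ ≤ ∑ j ∈ range (N + 1), 2 ^ ((1 + β) * N) := by
        refine sum_le_sum fun j hj => ?_
        refine (Nat.pow_le_pow_left hQ j).trans ?_
        rw [← pow_mul]
        exact Nat.pow_le_pow_right (by norm_num)
          (Nat.mul_le_mul_left _ (Nat.lt_succ_iff.1 (mem_range.1 hj)))
    _ = (N + 1) * 2 ^ ((1 + β) * N) := by rw [sum_const, card_range, smul_eq_mul]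
    _ ≤ 2 ^ N * 2 ^ ((1 + β) * N) := Nat.mul_le_mul_right _ (add_one_le_two_pow N)
    _ = _ := by rw [← pow_add]

/-- A bound for the bit length of `coverSum`. -/
def coverSumBits (n N δ ζ : ℕ) : ℕ :=
  n + (N + (1 + N * (N + (ζ + (N + δ * (n + 1))) * N)) * N)

theorem coverSumBits_mono {N' : ℕ} (h : N ≤ N') :
    coverSumBits n N δ ζ ≤ coverSumBits n N' δ ζ := by
  simp only [coverSumBits]; gcongr

theorem coverSum_le (hx : ∀ i j, x i j + 1 ≤ 2 ^ δ) (hw : ∀ i j, w i j + 1 ≤ 2 ^ δ) {z : ℕ}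
    (hz : z ≤ 2 ^ ζ) (hS : S.card ≤ n) :
    coverSum H S N x w z ≤ 2 ^ coverSumBits n N δ ζ := by
  rw [coverSum, coverSumBits, pow_add]
  refine (sum_le_card_nsmul _ _ _ fun X hX => detSeries_le (α := δ * (n + 1))
    (fun i j => slotMatrix_le hx hw ((card_le_card (mem_powerset.1 hX)).trans hS) i j) hz).trans ?_
  rw [card_powerset, smul_eq_mul]
  exact Nat.mul_le_mul_right _ (Nat.pow_le_pow_right (by norm_num) hS)

end Size

/-! ## Random polynomials -/

/-- The value at `y` of the polynomial number `t` whose `d` coefficients are given by coins. -/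
def coinPoly {R : Type*} [CommSemiring R] (ω : ℕ → Bool) (d : ℕ) (y : R) (t : ℕ) : R :=
  ∑ e ∈ range d, ((ω (t * d + e)).toNat : R) * y ^ e

theorem coinPoly_map {R T : Type*} [CommSemiring R] [CommSemiring T] (f : R →+* T) (ω : ℕ → Bool)
    (d : ℕ) (y : R) (t : ℕ) : coinPoly ω d (f y) t = f (coinPoly ω d y t) := by
  simp [coinPoly]

theorem coinPoly_one_lt (ω : ℕ → Bool) (d t : ℕ) : coinPoly ω d 1 t + 1 ≤ 2 ^ d := by
  have : coinPoly ω d 1 t ≤ d := by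
    simp only [coinPoly, one_pow, mul_one, Nat.cast_id]
    refine (sum_le_card_nsmul _ _ 1 fun e _ => ?_).trans (by simp)
    exact Bool.toNat_le _
  have := add_one_le_two_pow d
  omega

theorem coinPoly_lt (ω : ℕ → Bool) {L : ℕ} (hL : 0 < L) (d t : ℕ) :
    coinPoly ω d (2 ^ L) t + 1 ≤ 2 ^ (L * d) := by
  have key : ∀ m, ∑ e ∈ range m, (ω (t * d + e)).toNat * (2 ^ L) ^ e + 1 ≤ 2 ^ (L * m) := by
    intro m
    induction m with
    | zero => simp
    | succ m ih =>
      rw [sum_range_succ, mul_add, mul_one, pow_add, pow_mul]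
      have h1 : (ω (t * d + m)).toNat * (2 ^ L) ^ m ≤ 1 * (2 ^ L) ^ m :=
        Nat.mul_le_mul_right _ (Bool.toNat_le _)
      have h2 : 2 ≤ 2 ^ L := by
        calc 2 = 2 ^ 1 := rfl
          _ ≤ 2 ^ L := Nat.pow_le_pow_right (by norm_num) hL
      have h3 := Nat.mul_le_mul_left ((2 ^ L) ^ m) h2
      rw [pow_mul] at ih
      omega
  exact key d

/-! ### Kronecker substitution: many coefficients in one natural number. -/

section Digits

open Polynomial

/-- The edge variables. -/
def edgeVar {R : Type*} (ξ : ℕ → R) (W : ℕ) (i j : ℕ) : R := ξ (i * W + j)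

/-- The clique variables. -/
def vertexVar {R : Type*} (ξ : ℕ → R) (W N : ℕ) (i v : ℕ) : R := ξ (i * W + (N + v))

variable {H : SimpleGraph ℕ} {S : Finset ℕ} {N : ℕ}

/-- `coverSum` with variables replaced by values of the given sequence. -/
noncomputable def coverValue {R : Type*} [CommSemiring R] (H : SimpleGraph ℕ) (S : Finset ℕ)
    (N W : ℕ) (ξ : ℕ → R) (z : R) : R :=
  coverSum H S N (edgeVar ξ W) (vertexVar ξ W N) z

theorem coverValue_map {R T : Type*} [CommSemiring R] [CommSemiring T] (f : R →+* T) (W : ℕ)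
    (ξ : ℕ → R) (z : R) :
    coverValue H S N W (fun t => f (ξ t)) (f z) = f (coverValue H S N W ξ z) :=
  coverSum_map f H S N _ _ z

/-- Reading off digits from the natural number `coverValue`, evaluated at powers of two, decides
whether the sum of hafnians vanishes at random polynomials over `ZMod 2`. -/
theorem exists_odd_digit_iff (ω : ℕ → Bool) (W d L J : ℕ) (hL : 0 < L)
    (hB : coverValue H S N W (coinPoly ω d 1) 1 < 2 ^ L)
    (hZ : coverValue H S N W (coinPoly ω d (2 ^ L)) 1 < (2 ^ L) ^ J) :
    (∃ j < J, (coverValue H S N W (coinPoly ω d (2 ^ L)) ((2 ^ L) ^ J) / ((2 ^ L) ^ J) ^ N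
      % (2 ^ L) ^ J) / (2 ^ L) ^ j % 2 ≠ 0) ↔
    hafnianSum H S N (edgeVar (coinPoly ω d (X : (ZMod 2)[X])) W)
      (vertexVar (coinPoly ω d (X : (ZMod 2)[X])) W N) ≠ 0 := by
  set B := 2 ^ L with hBdef
  set Z := B ^ J with hZdef
  -- One polynomial over `ℕ` lies above everything: evaluation gives the numbers of the machine,
  -- reduction modulo two gives the determinants.
  set F : ℕ[X][X] := coverValue H S N W (fun t => C (coinPoly ω d (X : ℕ[X]) t)) X with hF
  have heval : ∀ b z : ℕ, coverValue H S N W (coinPoly ω d b) z =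
      (F.map (evalRingHom b)).eval z := by
    intro b z
    have := coverValue_map (H := H) (S := S) (N := N)
      ((evalRingHom z).comp (mapRingHom (evalRingHom b))) W
      (fun t => C (coinPoly ω d (X : ℕ[X]) t)) X
    rw [← hF] at this
    simp only [RingHom.coe_comp, Function.comp_apply, coe_mapRingHom, map_C, map_X,
      coe_evalRingHom, eval_X, eval_C] at this
    rw [← this]
    congr 1
    funext t
    have h2 := coinPoly_map (evalRingHom b) ω d (X : ℕ[X]) t
    simpa using h2
  set c := coverValue H S N W (coinPoly ω d B) Z / Z ^ N % Z with hc
  -- The outer digits in base `Z` do not overlap, since coefficients in `ℕ` are at most the value at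
  -- `1`, which `hZ` bounds. The inner digits in base `B` are separated by `hB` in the same way.
  have hcval : c = (F.coeff N).eval B := by
    rw [hc, heval, digit_eval, coeff_map, coe_evalRingHom]
    intro i
    refine (coeff_le_eval_one _ _).trans_lt ?_
    rw [← heval]; exact hZ
  have hcoeff : ∀ i, (F.coeff N).coeff i < B := by
    intro i
    refine (coeff_le_eval_one _ _).trans_lt (lt_of_le_of_lt ?_ hB)
    rw [heval]
    have := coeff_le_eval_one (F.map (evalRingHom 1)) N
    simpa using this
  have hdigit : ∀ j, c / B ^ j % B = (F.coeff N).coeff j := by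
    intro j
    rw [hcval, digit_eval j _ hcoeff]
  have hB2 : 2 ∣ B := dvd_pow_self 2 hL.ne'
  have hZpos : 0 < Z := by positivity
  have hsquare : (F.coeff N).map (Nat.castRingHom (ZMod 2)) =
      hafnianSum H S N (edgeVar (coinPoly ω d (X : (ZMod 2)[X])) W)
        (vertexVar (coinPoly ω d (X : (ZMod 2)[X])) W N) ^ 2 := by
    rw [← sum_det_slotMatrix]
    have := coverValue_map (H := H) (S := S) (N := N)
      (mapRingHom (mapRingHom (Nat.castRingHom (ZMod 2)))) W
      (fun t => C (coinPoly ω d (X : ℕ[X]) t)) X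
    rw [← hF] at this
    simp only [coe_mapRingHom, map_C, map_X] at this
    have h2 : ∀ t, (coinPoly ω d (X : ℕ[X]) t).map (Nat.castRingHom (ZMod 2)) =
        coinPoly ω d (X : (ZMod 2)[X]) t := by
      intro t
      have h2 := coinPoly_map (mapRingHom (Nat.castRingHom (ZMod 2))) ω d (X : ℕ[X]) t
      simpa using h2.symm
    simp only [h2] at this
    have h3 := congrArg (fun p => p.coeff N) this
    simp only [coeff_map, coe_mapRingHom] at h3
    rw [← h3, coverValue, coverSum, finsetSum_coeff]
    refine sum_congr rfl fun Y _ => ?_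
    rw [← coeff_detSeries]
    congr 2
    funext i j
    exact slotMatrix_map (C : (ZMod 2)[X] →+* (ZMod 2)[X][X]) H S _ _ Y i j
  rw [← pow_ne_zero_iff (two_ne_zero), ← hsquare]
  constructor
  · rintro ⟨j, _, hj⟩ h0
    apply hj
    rw [← Nat.mod_mod_of_dvd _ hB2, hdigit]
    have := congrArg (fun p => p.coeff j) h0
    simp only [coeff_map, coeff_zero, eq_natCast] at this
    exact Nat.mod_eq_zero_of_dvd ((ZMod.natCast_eq_zero_iff _ _).1 this)
  · intro h
    obtain ⟨j, hj⟩ : ∃ j, ((F.coeff N).map (Nat.castRingHom (ZMod 2))).coeff j ≠ 0 := by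
      by_contra hcon
      push Not at hcon
      exact h (Polynomial.ext (by simpa using hcon))
    rw [coeff_map, eq_natCast, Ne, ZMod.natCast_eq_zero_iff] at hj
    have hj2 : c / B ^ j % 2 ≠ 0 := by
      rw [← Nat.mod_mod_of_dvd _ hB2, hdigit]
      exact fun h => hj (Nat.dvd_of_mod_eq_zero h)
    refine ⟨j, ?_, hj2⟩
    -- The bound `j < J` is automatic: from position `J` on all base `B` digits of a number below `Z
    -- = B ^ J` are `0`.
    by_contra hJ
    apply hj2
    have hlt : c < B ^ j :=
      (Nat.mod_lt _ hZpos).trans_le (Nat.pow_le_pow_right (by positivity) (not_lt.1 hJ))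
    rw [Nat.div_eq_of_lt hlt]

end Digits

/-! ## Random evaluation -/

section Random

open Polynomial

theorem coinMeasure_pi_singleton (V : ℕ) (a : ℕ → Bool) :
    RAM.coinMeasure (Set.pi (range V : Finset ℕ) fun i => {a i}) = (2⁻¹ : ℝ≥0∞) ^ V := by
  have : ∀ i, (PMF.uniformOfFintype Bool).toMeasure {a i} = (2⁻¹ : ℝ≥0∞) := by
    intro i
    rw [PMF.toMeasure_apply_singleton _ _ (MeasurableSet.singleton _),
      PMF.uniformOfFintype_apply, Fintype.card_bool, Nat.cast_ofNat]
  rw [RAM.coinMeasure, MeasureTheory.Measure.infinitePi_pi _ (fun i _ => MeasurableSet.singleton _),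
    prod_congr rfl fun i _ => this i, prod_const, card_range]

/-- The polynomial over `ZMod 2` with the given coefficients. -/
noncomputable def bitsPoly {d : ℕ} (b : Fin d → Bool) : (ZMod 2)[X] :=
  ∑ e : Fin d, ((b e).toNat : (ZMod 2)[X]) * X ^ (e : ℕ)

/-- Thus `d` coins sample uniformly from `2 ^ d` distinct elements of `(ZMod 2)[X]`, as
Schwartz–Zippel requires. -/
theorem bitsPoly_injective (d : ℕ) : Function.Injective (bitsPoly (d := d)) := by
  have key : ∀ (b : Fin d → Bool) (e : Fin d), (bitsPoly b).coeff e = ((b e).toNat : ZMod 2) := by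
    intro b e
    rw [bitsPoly, finsetSum_coeff, sum_eq_single e]
    · rw [← C_eq_natCast, coeff_C_mul, coeff_X_pow, if_pos rfl, mul_one]
    · intro e' _ hne
      rw [← C_eq_natCast, coeff_C_mul, coeff_X_pow,
        if_neg (fun h => hne (Fin.ext h.symm)), mul_zero]
    · intro h; exact absurd (mem_univ _) h
  intro b b' h
  funext e
  have h1 := key b e
  rw [h, key b' e] at h1
  revert h1
  cases b e <;> cases b' e <;> simp

theorem coinPoly_eq_bitsPoly (ω : ℕ → Bool) (d t : ℕ) :
    coinPoly ω d (X : (ZMod 2)[X]) t = bitsPoly fun e : Fin d => ω (t * d + e) := by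
  rw [coinPoly, bitsPoly,
    ← Fin.sum_univ_eq_sum_range (fun e => ((ω (t * d + e)).toNat : (ZMod 2)[X]) * X ^ e) d]

/-- A nonzero polynomial rarely vanishes at random polynomials over `ZMod 2`. -/
theorem coinMeasure_eval_eq_zero_le {m d : ℕ} (hd : 0 < d) {p : MvPolynomial (Fin m) (ZMod 2)[X]}
    (hp : p ≠ 0) :
    RAM.coinMeasure {ω | MvPolynomial.eval
      (fun t : Fin m => coinPoly ω d (X : (ZMod 2)[X]) t) p = 0} ≤
      p.totalDegree * (2⁻¹ : ℝ≥0∞) ^ d := by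
  classical
  let bad : Finset (Fin m → Fin d → Bool) :=
    univ.filter fun a => MvPolynomial.eval (fun t => bitsPoly (a t)) p = 0
  let T : Finset (ZMod 2)[X] := univ.image (bitsPoly (d := d))
  have hT : T.card = 2 ^ d := by
    rw [card_image_of_injective _ (bitsPoly_injective d), card_univ]; simp
  have hbad : bad.card * 2 ^ d ≤ p.totalDegree * (2 ^ d) ^ m := by
    have h1 := MvPolynomial.schwartz_zippel_totalDegree hp T
    have h2 : bad.card ≤ #{f ∈ Fintype.piFinset fun _ : Fin m => T | MvPolynomial.eval f p = 0} := by
      refine card_le_card_of_injOn (fun a t => bitsPoly (a t)) ?_ ?_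
      · intro a ha
        have ha' := (mem_filter.1 (mem_coe.1 ha)).2
        exact mem_coe.2 (mem_filter.2 ⟨Fintype.mem_piFinset.2 fun t =>
          mem_image_of_mem _ (mem_univ _), ha'⟩)
      · intro a _ b _ hab
        funext t
        exact bitsPoly_injective d (congrFun hab t)
    rw [hT, div_le_div_iff₀ (by positivity) (by positivity)] at h1
    have h3 : #{f ∈ Fintype.piFinset fun _ : Fin m => T | MvPolynomial.eval f p = 0} * 2 ^ d ≤
        p.totalDegree * (2 ^ d) ^ m := by exact_mod_cast h1
    exact (Nat.mul_le_mul_right _ h2).trans h3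
  -- The event depends only on the first `m * d` coins, so it lies in a union of cylinders, one for
  -- each bad coefficient array. The value `false` beyond the prefix is never constrained.
  let ext : (Fin m → Fin d → Bool) → ℕ → Bool := fun a i =>
    if h : i / d < m then a ⟨i / d, h⟩ ⟨i % d, Nat.mod_lt _ hd⟩ else false
  have hcover : {ω | MvPolynomial.eval
      (fun t : Fin m => coinPoly ω d (X : (ZMod 2)[X]) t) p = 0} ⊆
      ⋃ a ∈ bad, Set.pi (range (m * d) : Finset ℕ) fun i => {ext a i} := by
    intro ω hω
    simp only [Set.mem_iUnion]
    refine ⟨fun t e => ω (t * d + e), ?_, ?_⟩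
    · refine mem_filter.2 ⟨mem_univ _, ?_⟩
      simp only [← coinPoly_eq_bitsPoly]
      exact hω
    · intro i hi
      have hi' : i / d < m := by
        rw [Nat.div_lt_iff_lt_mul hd]; simpa using hi
      simp only [ext, dif_pos hi', Set.mem_singleton_iff]
      rw [Nat.div_add_mod']
  calc _ ≤ RAM.coinMeasure (⋃ a ∈ bad, Set.pi (range (m * d) : Finset ℕ) fun i => {ext a i}) :=
        MeasureTheory.measure_mono hcover
    _ ≤ ∑ a ∈ bad, RAM.coinMeasure (Set.pi (range (m * d) : Finset ℕ) fun i => {ext a i}) :=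
        MeasureTheory.measure_biUnion_finset_le _ _
    _ = bad.card * (2⁻¹ : ℝ≥0∞) ^ (m * d) := by
        rw [sum_congr rfl fun a _ => coinMeasure_pi_singleton _ _, sum_const, nsmul_eq_mul]
    _ ≤ p.totalDegree * (2⁻¹ : ℝ≥0∞) ^ d := by
        rw [← ENNReal.inv_pow, ← ENNReal.inv_pow, ← div_eq_mul_inv, ← div_eq_mul_inv]
        rw [ENNReal.div_le_iff (by positivity) (by finiteness), mul_comm, ← mul_div_assoc,
          ENNReal.le_div_iff_mul_le (Or.inl (by positivity)) (Or.inl (by finiteness)),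
          mul_comm ((2 : ℝ≥0∞) ^ (m * d)), mul_comm m d, pow_mul]
        exact_mod_cast hbad

theorem hafnianSum_congr {R : Type*} [CommSemiring R] {H : SimpleGraph ℕ} {S : Finset ℕ} {N : ℕ}
    {x w x' w' : ℕ → ℕ → R} (hx : ∀ i < N, ∀ j < N, x i j = x' i j)
    (hw : ∀ i < N, ∀ v ∈ S, w i v = w' i v) :
    hafnianSum H S N x w = hafnianSum H S N x' w' := by
  classical
  refine sum_congr rfl fun X hX => sum_congr rfl fun σ _ => prod_congr rfl fun i _ => ?_
  have hm : min (i : ℕ) (σ i : ℕ) < N := (min_le_left _ _).trans_lt i.2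
  simp only [slotMatrix]
  split_ifs
  · rfl
  · rfl
  · rfl
  · rw [hx _ hm _ (max_lt i.2 (σ i).2)]
    congr 1
    refine sum_congr rfl fun A hA => prod_congr rfl fun v hv => hw _ hm v ?_
    exact mem_powerset.1 hX (mem_filter.1 (mem_powerset.1 (mem_filter.1 hA).1 hv)).1

/-- A matching has at most `N` factors, each an edge variable times a product of at most `n` vertex
variables. -/
theorem totalDegree_hafnianSum_le {R τ : Type*} [CommSemiring R] {H : SimpleGraph ℕ}
    {S : Finset ℕ} {N n : ℕ} {x w : ℕ → ℕ → MvPolynomial τ R} (hS : S.card ≤ n)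
    (hx : ∀ i j, (x i j).totalDegree ≤ 1) (hw : ∀ i j, (w i j).totalDegree ≤ 1) :
    (hafnianSum H S N x w).totalDegree ≤ N * (n + 1) := by
  classical
  refine MvPolynomial.totalDegree_finsetSum_le fun X hX =>
    MvPolynomial.totalDegree_finsetSum_le fun σ _ =>
      (MvPolynomial.totalDegree_finsetProd _ _).trans ?_
  refine (sum_le_card_nsmul _ _ (n + 1) fun i _ => ?_).trans ?_
  · simp only [slotMatrix]
    split_ifs
    · simp
    · simp
    · simp
    · refine (MvPolynomial.totalDegree_mul _ _).trans ?_
      rw [add_comm n 1]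
      refine Nat.add_le_add (hx _ _) (MvPolynomial.totalDegree_finsetSum_le fun A hA =>
        (MvPolynomial.totalDegree_finsetProd _ _).trans ?_)
      refine (sum_le_card_nsmul _ _ 1 fun v _ => hw _ _).trans ?_
      rw [smul_eq_mul, mul_one]
      exact (card_le_card (mem_powerset.1 (mem_filter.1 hA).1)).trans
        ((card_filter_le _ _).trans ((card_le_card (mem_powerset.1 hX)).trans hS))
  · rw [smul_eq_mul]
    refine Nat.mul_le_mul_right _ ((card_filter_le _ _).trans ?_)
    simp

/-- If the sum of hafnians is not identically zero, it rarely vanishes at random polynomials. -/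
theorem coinMeasure_hafnianSum_eq_zero_le {H : SimpleGraph ℕ} {S : Finset ℕ} {N n d : ℕ}
    (hd : 0 < d) (hS : ∀ i ∈ S, i < n)
    (h1 : ∃ x w : ℕ → ℕ → (ZMod 2)[X], hafnianSum H S N x w = 1) :
    RAM.coinMeasure {ω | hafnianSum H S N
      (edgeVar (coinPoly ω d (X : (ZMod 2)[X])) (N + n))
      (vertexVar (coinPoly ω d (X : (ZMod 2)[X])) (N + n) N) = 0} ≤
      (N * (n + 1) : ℕ) * (2⁻¹ : ℝ≥0∞) ^ d := by
  classical
  obtain ⟨x, w, hxw⟩ := h1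
  have hidx : ∀ i < N, ∀ j < N + n, i * (N + n) + j < N * (N + n) := by
    intro i hi j hj
    calc i * (N + n) + j < i * (N + n) + (N + n) := by omega
      _ = (i + 1) * (N + n) := by ring
      _ ≤ N * (N + n) := Nat.mul_le_mul_right _ hi
  -- Edge and vertex variables share rows of length `N + n`; the default `0` beyond the last row is
  -- never read.
  let ξ : ℕ → MvPolynomial (Fin (N * (N + n))) (ZMod 2)[X] := fun t =>
    if h : t < N * (N + n) then MvPolynomial.X ⟨t, h⟩ else 0
  let p := hafnianSum H S N (edgeVar ξ (N + n)) (vertexVar ξ (N + n) N)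
  have heval : ∀ η : ℕ → (ZMod 2)[X], MvPolynomial.eval (fun t : Fin (N * (N + n)) => η t) p =
      hafnianSum H S N (edgeVar η (N + n)) (vertexVar η (N + n) N) := by
    intro η
    rw [← hafnianSum_map]
    refine hafnianSum_congr (fun i hi j hj => ?_) (fun i hi v hv => ?_)
    · simp only [edgeVar, ξ, dif_pos (hidx i hi j (by omega)), MvPolynomial.eval_X]
    · simp only [vertexVar, ξ, dif_pos (hidx i hi (N + v) (by have := hS v hv; omega)),
        MvPolynomial.eval_X]
  have hp : p ≠ 0 := by
    intro h0
    let η : ℕ → (ZMod 2)[X] := fun t =>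
      if t % (N + n) < N then x (t / (N + n)) (t % (N + n))
      else w (t / (N + n)) (t % (N + n) - N)
    have h2 := heval η
    rw [h0, map_zero, hafnianSum_congr (x' := x) (w' := w), hxw] at h2
    · exact zero_ne_one h2
    · intro i hi j hj
      have e1 : (i * (N + n) + j) % (N + n) = j := by
        rw [mul_comm, Nat.mul_add_mod, Nat.mod_eq_of_lt (by omega)]
      have e2 : (i * (N + n) + j) / (N + n) = i := by
        rw [mul_comm, Nat.mul_add_div (by omega), Nat.div_eq_of_lt (by omega), add_zero]
      simp only [edgeVar, η, e1, e2, if_pos hj]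
    · intro i hi v hv
      have := hS v hv
      have e1 : (i * (N + n) + (N + v)) % (N + n) = N + v := by
        rw [mul_comm, Nat.mul_add_mod, Nat.mod_eq_of_lt (by omega)]
      have e2 : (i * (N + n) + (N + v)) / (N + n) = i := by
        rw [mul_comm, Nat.mul_add_div (by omega), Nat.div_eq_of_lt (by omega), add_zero]
      simp only [vertexVar, η, e1, e2, if_neg (show ¬ N + v < N by omega), Nat.add_sub_cancel_left]
  have hdeg : ∀ t, (ξ t).totalDegree ≤ 1 := by
    intro t
    simp only [ξ]
    split_ifs
    · rw [MvPolynomial.totalDegree_X]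
    · simp
  have hcard : S.card ≤ n := by
    have := card_le_card (fun i hi => mem_range.2 (hS i hi) : S ⊆ range n)
    simpa using this
  have hmain := coinMeasure_eval_eq_zero_le hd hp
  have hset : {ω : ℕ → Bool | MvPolynomial.eval (fun t : Fin (N * (N + n)) =>
      coinPoly ω d (X : (ZMod 2)[X]) t) p = 0} = {ω | hafnianSum H S N
      (edgeVar (coinPoly ω d (X : (ZMod 2)[X])) (N + n))
      (vertexVar (coinPoly ω d (X : (ZMod 2)[X])) (N + n) N) = 0} := by
    ext ω
    rw [Set.mem_ofPred_eq, Set.mem_ofPred_eq, heval (coinPoly ω d (X : (ZMod 2)[X]))]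
  rw [hset] at hmain
  refine hmain.trans ?_
  gcongr
  exact totalDegree_hafnianSum_le hcard (fun i j => hdeg _) (fun i j => hdeg _)

/-- Three of the `c + 3` factors `n + 2` absorb the degree `3 * n * (n + 1)`, and `2 ^ (n + 2)`
exceeds `n + 2`. -/
theorem error_bound (n c N d : ℕ) (hN : N ≤ 3 * n) (hd : d = (c + 3) * (n + 2)) :
    ((N * (n + 1) : ℕ) : ℝ≥0∞) * (2⁻¹ : ℝ≥0∞) ^ d ≤ 1 / ((n : ℝ≥0∞) + 2) ^ c := by
  have h1 : N * (n + 1) * (n + 2) ^ c ≤ 2 ^ d := by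
    calc N * (n + 1) * (n + 2) ^ c ≤ (3 * n) * (n + 1) * (n + 2) ^ c := by gcongr
      _ ≤ (n + 2) ^ 3 * (n + 2) ^ c := by gcongr; nlinarith [Nat.zero_le (n ^ 3)]
      _ = (n + 2) ^ (c + 3) := by rw [← pow_add, add_comm c 3]
      _ ≤ (2 ^ (n + 2)) ^ (c + 3) := Nat.pow_le_pow_left Nat.lt_two_pow_self.le _
      _ = 2 ^ d := by rw [← pow_mul, hd, mul_comm]
  rw [← ENNReal.inv_pow, ← div_eq_mul_inv,
    ENNReal.div_le_iff (by positivity) (by finiteness), mul_comm (1 / _), ← mul_div_assoc, mul_one,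
    ENNReal.le_div_iff_mul_le (Or.inl (by positivity)) (Or.inl (by finiteness))]
  exact_mod_cast h1

end Random

/-! ## Subsets as bit masks -/

section BitMasks

/-- The number of smaller elements of `S`. -/
def rankIn (S : Finset ℕ) (v : ℕ) : ℕ := (S.filter fun u => u < v).card

/-- The bit mask of a subset of `S`. -/
def encode (S Y : Finset ℕ) : ℕ := ∑ v ∈ Y, 2 ^ rankIn S v

/-- The subset of `S` with the given bit mask. -/
def decode (S : Finset ℕ) (a : ℕ) : Finset ℕ := S.filter fun v => a / 2 ^ rankIn S v % 2 = 1

variable {S : Finset ℕ}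

theorem decode_subset (S : Finset ℕ) (a : ℕ) : decode S a ⊆ S := filter_subset _ _

theorem rankIn_lt {u v : ℕ} (hu : u ∈ S) (h : u < v) : rankIn S u < rankIn S v := by
  refine card_lt_card ⟨fun a ha => ?_, fun hsub => ?_⟩
  · rw [mem_filter] at ha ⊢
    exact ⟨ha.1, ha.2.trans h⟩
  · have := hsub (mem_filter.2 ⟨hu, h⟩)
    exact lt_irrefl _ (mem_filter.1 this).2

theorem rankIn_injOn : Set.InjOn (rankIn S) S := by
  intro u hu v hv h
  rcases lt_trichotomy u v with h' | h' | h'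
  · exact absurd h (rankIn_lt hu h').ne
  · exact h'
  · exact absurd h (rankIn_lt hv h').ne'

theorem rankIn_lt_card {v : ℕ} (hv : v ∈ S) : rankIn S v < S.card := by
  refine card_lt_card ⟨filter_subset _ _, fun hsub => ?_⟩
  exact lt_irrefl _ (mem_filter.1 (hsub hv)).2

theorem encode_eq_sum_image {Y : Finset ℕ} (hY : Y ⊆ S) :
    encode S Y = ∑ i ∈ Y.image (rankIn S), 2 ^ i :=
  (sum_image (rankIn_injOn.mono (by exact_mod_cast hY))).symm

theorem encode_lt {Y : Finset ℕ} (hY : Y ⊆ S) : encode S Y < 2 ^ S.card := by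
  rw [encode_eq_sum_image hY]
  refine Nat.geomSum_lt le_rfl fun i hi => ?_
  obtain ⟨v, hv, rfl⟩ := mem_image.1 hi
  exact rankIn_lt_card (hY hv)

theorem decode_encode {Y : Finset ℕ} (hY : Y ⊆ S) : decode S (encode S Y) = Y := by
  have htb : ∀ i, (encode S Y).testBit i = true ↔ i ∈ Y.image (rankIn S) := by
    intro i
    rw [← Nat.mem_bitIndices, encode_eq_sum_image hY, ← List.mem_toFinset,
      toFinset_bitIndices_sum_two_pow]
  ext v
  have h := htb (rankIn S v)
  rw [Nat.testBit_eq_decide_div_mod_eq, decide_eq_true_eq] at h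
  simp only [decode, mem_filter, h, mem_image]
  constructor
  · rintro ⟨hv, u, hu, huv⟩
    exact rankIn_injOn (hY hu) hv huv ▸ hu
  · intro hv
    exact ⟨hY hv, v, hv, rfl⟩

theorem exists_encode_eq {a : ℕ} (ha : a < 2 ^ S.card) : ∃ Y ⊆ S, encode S Y = a := by
  have hinj : Set.InjOn (encode S) S.powerset := by
    intro Y hY Y' hY' h
    rw [← decode_encode (mem_powerset.1 hY), h, decode_encode (mem_powerset.1 hY')]
  have himg : S.powerset.image (encode S) = range (2 ^ S.card) := by
    refine eq_of_subset_of_card_le (fun b hb => ?_) ?_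
    · obtain ⟨Y, hY, rfl⟩ := mem_image.1 hb
      exact mem_range.2 (encode_lt (mem_powerset.1 hY))
    · rw [card_range, card_image_of_injOn hinj, card_powerset]
  have := himg ▸ mem_range.2 ha
  obtain ⟨Y, hY, h⟩ := mem_image.1 this
  exact ⟨Y, mem_powerset.1 hY, h⟩

theorem encode_decode {a : ℕ} (ha : a < 2 ^ S.card) : encode S (decode S a) = a := by
  obtain ⟨Y, hY, rfl⟩ := exists_encode_eq ha
  rw [decode_encode hY]

/-- This justifies filling tables in increasing order of bit masks: proper subsets come first. -/
theorem encode_lt_of_ssubset {a : ℕ} (ha : a < 2 ^ S.card) {Y : Finset ℕ}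
    (hY : Y ⊂ decode S a) : encode S Y < a := by
  conv_rhs => rw [← encode_decode ha]
  obtain ⟨v, hv, hvY⟩ := exists_of_ssubset hY
  exact sum_lt_sum_of_subset hY.1 hv hvY (by positivity) fun _ _ _ => Nat.zero_le _

theorem sum_decode {M : Type*} [AddCommMonoid M] (f : Finset ℕ → M) :
    ∑ a ∈ range (2 ^ S.card), f (decode S a) = ∑ Y ∈ S.powerset, f Y := by
  symm
  refine sum_bij (fun Y _ => encode S Y) (fun Y hY => ?_) (fun Y hY Y' hY' h => ?_)
    (fun a ha => ?_) (fun Y hY => ?_)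
  · exact mem_range.2 (encode_lt (mem_powerset.1 hY))
  · rw [← decode_encode (mem_powerset.1 hY), h, decode_encode (mem_powerset.1 hY')]
  · obtain ⟨Y, hY, h⟩ := exists_encode_eq (mem_range.1 ha)
    exact ⟨Y, mem_powerset.2 hY, h⟩
  · rw [decode_encode (mem_powerset.1 hY)]

-- A clique of `insert m Y` either avoids `m`, or consists of `m` and a clique in the neighbourhood
-- of `m`.
open Classical in
theorem cliqueSum_insert {R : Type*} [CommSemiring R] (H : SimpleGraph ℕ) (w : ℕ → R)
    {Y : Finset ℕ} {m : ℕ} (hm : m ∉ Y) :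
    cliqueSum H w (insert m Y) =
      cliqueSum H w Y + w m * cliqueSum H w (Y.filter fun u => H.Adj u m) := by
  simp only [cliqueSum, sum_filter]
  rw [sum_powerset_insert hm, mul_sum]
  congr 1
  rw [← sum_subset (powerset_mono.2 (filter_subset (fun u => H.Adj u m) Y))]
  · refine sum_congr rfl fun A hA => ?_
    have hAm : m ∉ A := fun h => hm (mem_filter.1 (mem_powerset.1 hA h)).1
    have hiff : H.IsClique (insert m A : Finset ℕ) ↔ H.IsClique (A : Set ℕ) := by
      rw [coe_insert, SimpleGraph.isClique_insert_of_notMem (by exact_mod_cast hAm)]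
      exact and_iff_left fun b hb => (mem_filter.1 (mem_powerset.1 hA hb)).2.symm
    rw [prod_insert hAm, mul_ite, mul_zero]
    exact if_congr hiff rfl rfl
  · intro A hA hA'
    have hAm : m ∉ A := fun h => hm (mem_powerset.1 hA h)
    refine if_neg ?_
    rw [coe_insert, SimpleGraph.isClique_insert_of_notMem (by exact_mod_cast hAm)]
    rintro ⟨_, h⟩
    refine hA' (mem_powerset.2 fun b hb => mem_filter.2 ⟨mem_powerset.1 hA hb, (h b hb).symm⟩)

open Classical in
/-- The clique sum, by the largest vertex of the clique. -/
theorem cliqueSum_eq {R : Type*} [CommSemiring R] (H : SimpleGraph ℕ) (w : ℕ → R) (Y : Finset ℕ) :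
    cliqueSum H w Y =
      1 + ∑ v ∈ Y, w v * cliqueSum H w (Y.filter fun u => u < v ∧ H.Adj u v) := by
  induction Y using Finset.induction_on_max with
  | empty => simp [cliqueSum, filter_singleton]
  | insert m Y hmax ih =>
    have hm : m ∉ Y := fun h => lt_irrefl _ (hmax m h)
    rw [cliqueSum_insert H w hm, sum_insert hm, ih, add_assoc, add_comm (w m * _)]
    congr 2
    · refine sum_congr rfl fun v hv => ?_
      congr 2
      rw [filter_insert, if_neg]
      exact fun h => (hmax v hv).not_gt h.1
    · congr 2
      rw [filter_insert, if_neg fun h => lt_irrefl _ h.1]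
      exact filter_congr fun u hu => ⟨fun h => ⟨hmax u hu, h⟩, fun h => h.2⟩

end BitMasks

/-! ## The terms of the program and their values -/

namespace RAM.Term

instance : Add Term := ⟨bin .add⟩
instance : Sub Term := ⟨bin .sub⟩
instance : Mul Term := ⟨bin .mul⟩
instance : Div Term := ⟨bin .div⟩

variable {μ ρ : ℕ → ℕ}

theorem val_lit (c : ℕ) : (lit c).val μ ρ = c := rfl
theorem val_var (r : ℕ) : (var r).val μ ρ = ρ r := rfl
theorem val_mem (a : Term) : (mem a).val μ ρ = μ (a.val μ ρ) := rfl
theorem val_add (a b : Term) : (a + b).val μ ρ = a.val μ ρ + b.val μ ρ := rfl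
theorem val_sub (a b : Term) : (a - b).val μ ρ = a.val μ ρ - b.val μ ρ := rfl
theorem val_mul (a b : Term) : (a * b).val μ ρ = a.val μ ρ * b.val μ ρ := rfl
theorem val_div (a b : Term) : (a / b).val μ ρ = a.val μ ρ / b.val μ ρ := rfl
theorem val_ite (c a b : Term) :
    (ite c a b).val μ ρ = if c.val μ ρ = 0 then b.val μ ρ else a.val μ ρ := rfl
theorem val_letIn (r : ℕ) (e b : Term) :
    (letIn r e b).val μ ρ = b.val μ (Function.update ρ r (e.val μ ρ)) := rfl

/-- The sum of `b`, with register `r` running up to the value of register `c`. -/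
def sumTo (r c : ℕ) (b : Term) : Term := agg .add 0 r c b

/-- The product of `b`, with register `r` running up to the value of register `c`. -/
def prodTo (r c : ℕ) (b : Term) : Term := agg .mul 1 r c b

theorem val_sumTo (r c : ℕ) (b : Term) : (sumTo r c b).val μ ρ =
    ∑ j ∈ range (ρ c), b.val μ (Function.update ρ r j) := by
  simp only [sumTo, val]
  induction ρ c with
  | zero => rfl
  | succ m ih => rw [sum_range_succ, ← ih]; rfl

theorem val_prodTo (r c : ℕ) (b : Term) : (prodTo r c b).val μ ρ =
    ∏ j ∈ range (ρ c), b.val μ (Function.update ρ r j) := by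
  simp only [prodTo, val]
  induction ρ c with
  | zero => rfl
  | succ m ih => rw [prod_range_succ, ← ih]; rfl

end RAM.Term

namespace RAM

open Term

/-- The contents of the parameter registers. -/
structure Regs (ρ : ℕ → ℕ) (n k N d J L Q cb fb wb ab : ℕ) : Prop where
  r0 : ρ 0 = n
  r1 : ρ 1 = k
  r2 : ρ 2 = N
  r3 : ρ 3 = d
  r4 : ρ 4 = N + 1
  r5 : ρ 5 = J
  r6 : ρ 6 = L
  r7 : ρ 7 = Q
  r8 : ρ 8 = 2 ^ L
  r9 : ρ 9 = (2 ^ L) ^ J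
  r10 : ρ 10 = N + n
  r11 : ρ 11 = cb
  r12 : ρ 12 = N * (N + n) * d
  r13 : ρ 13 = fb
  r14 : ρ 14 = Q * N
  r15 : ρ 15 = wb
  r16 : ρ 16 = Q * N * (N + 1) * N
  r17 : ρ 17 = ab
  r18 : ρ 18 = ab + 1

theorem Regs.update {ρ : ℕ → ℕ} {n k N d J L Q cb fb wb ab r x : ℕ}
    (h : Regs ρ n k N d J L Q cb fb wb ab) (hr : 19 ≤ r) :
    Regs (Function.update ρ r x) n k N d J L Q cb fb wb ab := by
  have key : ∀ i < 19, Function.update ρ r x i = ρ i := fun i hi =>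
    Function.update_of_ne (by omega) _ _
  constructor <;> rw [key _ (by norm_num)]
  exacts [h.r0, h.r1, h.r2, h.r3, h.r4, h.r5, h.r6, h.r7, h.r8, h.r9, h.r10, h.r11, h.r12, h.r13,
    h.r14, h.r15, h.r16, h.r17, h.r18]

open Classical in
/-- The memory represents, below address `n + n * n`, the set `S` and the graph `H` on the first
`n` slots (by its complement if `co` is true). -/
structure GraphMem (co : Bool) (H : SimpleGraph ℕ) (S : Finset ℕ) (n : ℕ) (μ : ℕ → ℕ) : Prop where
  lt : ∀ v ∈ S, v < n
  set : ∀ v < n, μ v = if v ∈ S then 1 else 0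
  adj : ∀ u < n, ∀ v < n, u ≠ v →
    (bif co then 1 - μ (n + u * n + v) else μ (n + u * n + v)) = if H.Adj u v then 1 else 0
  dummy : ∀ i j, i ≠ j → n ≤ i ∨ n ≤ j → H.Adj i j

section Terms

/-- The weight in a bit mask of the vertex in register `v`. -/
def maskBit (v : ℕ) : Term :=
  prodTo 26 0 (ite (var v - var 26) (lit 1 + mem (var 26)) (lit 1))

/-- Whether the vertex in register `u` belongs to the set with the bit mask in register `X`. -/
def isMember (X u : ℕ) : Term :=
  mem (var u) * (var X / maskBit u - lit 2 * (var X / maskBit u / lit 2))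

/-- Whether the vertices in registers `u` and `v` are adjacent. -/
def isAdj (co : Bool) (u v : ℕ) : Term :=
  bif co then lit 1 - mem (var 0 + var u * var 0 + var v) else mem (var 0 + var u * var 0 + var v)

/-- Whether the slots in registers `u` and `v` are adjacent. -/
def isSlotAdj (co : Bool) (u v : ℕ) : Term :=
  ite (var 0 - var u) (ite (var 0 - var v) (isAdj co u v) (lit 1)) (lit 1)

/-- The bit mask of those elements (in register `25`) of the set with bit mask in register `X`
which satisfy a condition. -/
def subMask (X : ℕ) (c : Term) : Term := sumTo 25 0 (isMember X 25 * (c * maskBit 25))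

/-- The value of the random polynomial in row `i` and column `j`. -/
def coinTerm (i j : Term) : Term :=
  sumTo 27 3 (mem (var 11 + ((i * var 10 + j) * var 3 + var 27)) *
    prodTo 28 3 (ite (var 27 - var 28) (var 8) (lit 1)))

/-- The entry number `t` (in register `19`) of the table of clique sums. -/
def cliqueTerm (co : Bool) : Term :=
  letIn 20 (var 19 / var 2) (letIn 23 (var 19 - var 20 * var 2)
    (lit 1 + sumTo 29 0 (isMember 20 29 * (coinTerm (var 23) (var 2 + var 29) *
      mem (var 13 + (subMask 20 (ite (var 29 - var 25) (isAdj co 25 29) (lit 0)) * var 2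
        + var 23))))))

/-- The weight of the edge between the slots in registers `a` and `b`. -/
def edgeTerm (co : Bool) (a b : ℕ) : Term :=
  coinTerm (var a) (var b) *
    mem (var 13 + (subMask 20 (isSlotAdj co 25 23 * isSlotAdj co 25 24) * var 2 + var a))

/-- Whether the slot in register `r` lies outside of `S`. -/
def isFree (r : ℕ) : Term := ite (var 0 - var r) (lit 1 - mem (var r)) (lit 1)

/-- The entry in row `23` and column `24` of the slot matrix of the set in register `20`. -/
def matrixTerm (co : Bool) : Term :=
  ite ((var 23 - var 24) + (var 24 - var 23))
    (isFree 23 * (isFree 24 * (isSlotAdj co 23 24 *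
      ite (var 24 - var 23) (edgeTerm co 23 24) (edgeTerm co 24 23))))
    (ite (var 0 - var 23) (mem (var 23)) (lit 0))

/-- The entry number `t` (in register `19`) of the table of walks. -/
def walkTerm (co : Bool) : Term :=
  letIn 31 (var 19 / var 2) (letIn 23 (var 19 - var 31 * var 2)
  (letIn 32 (var 31 / var 4) (letIn 22 (var 31 - var 32 * var 4)
  (letIn 20 (var 32 / var 2) (letIn 21 (var 32 - var 20 * var 2)
    (ite (var 22)
      (sumTo 24 2 (ite (var 24 - var 21) (lit 0)
        (matrixTerm co * mem (var 15 + ((var 31 - lit 1) * var 2 + var 24)))))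
      (ite ((var 23 - var 21) + (var 21 - var 23)) (lit 0) (lit 1))))))))

/-- The walk series of the set in register `19`. -/
def seriesTerm : Term :=
  prodTo 21 2 (sumTo 22 4 (prodTo 34 2 (ite (var 22 - var 34) (var 9) (lit 1)) *
    mem (var 15 + (((var 19 * var 2 + var 21) * var 4 + var 22) * var 2 + var 21))))

/-- The entry number `t + 1` (with `t` in register `19`) of the table of accumulated determinant
series. -/
def sumTerm : Term :=
  mem (var 17 + var 19) +
    sumTo 30 4 (prodTo 33 2 (ite (var 30 - var 33) (lit 1 + seriesTerm) (lit 1)))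

/-- The final answer. -/
def answerTerm : Term :=
  letIn 20 (mem (var 17 + var 7) / prodTo 33 2 (var 9))
  (letIn 21 (var 20 - (var 20 / var 9) * var 9)
    (ite ((var 0 - sumTo 33 0 (mem (var 33))) - lit 2 * var 1) (lit 0)
      (lit 1 - (lit 1 - sumTo 22 5
        (letIn 24 (var 21 / prodTo 33 5 (ite (var 22 - var 33) (var 8) (lit 1)))
          (var 24 - lit 2 * (var 24 / lit 2)))))))

end Terms

/-! ### The terms evaluate to the intended quantities. -/

section Values

variable {ρ μ : ℕ → ℕ} {n k N d J L Q cb fb wb ab : ℕ} {co : Bool} {H : SimpleGraph ℕ}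
  {S : Finset ℕ} {ω : ℕ → Bool}

theorem sub_two_mul_div (a : ℕ) : a - 2 * (a / 2) = a % 2 := by omega

/-- Aggregations can run only up to a parameter register. A variable exponent `e` is therefore
realised by a product of fixed length `m` with trivial factors from position `e` on. -/
theorem prod_range_ite_lt (b : ℕ) {m e : ℕ} (h : e ≤ m) :
    ∏ j ∈ range m, (if e - j = 0 then 1 else b) = b ^ e := by
  rw [← prod_subset (range_subset_range.2 h)]
  · rw [prod_congr rfl (g := fun _ => b), prod_const, card_range]
    intro j hj
    rw [if_neg]
    have := mem_range.1 hj
    omega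
  · intro j _ hj
    rw [if_pos]
    rw [mem_range] at hj
    omega

theorem val_maskBit (hg : GraphMem co H S n μ) (h0 : ρ 0 = n) {v : ℕ} (hv : v ≠ 26) :
    (maskBit v).val μ ρ = 2 ^ rankIn S (ρ v) := by
  simp only [maskBit, val_prodTo, val_ite, val_sub, val_var, val_add, val_lit, val_mem, h0,
    Function.update_self, Function.update_of_ne hv]
  have hsub : range n ∩ S = S := inter_eq_right.2 fun u hu => mem_range.2 (hg.lt u hu)
  rw [rankIn, ← prod_const, prod_filter, ← hsub, ← prod_ite_mem]
  refine prod_congr rfl fun j hj => ?_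
  rw [hg.set j (mem_range.1 hj)]
  split_ifs <;> first | rfl | omega

theorem val_isMember (hg : GraphMem co H S n μ) (h0 : ρ 0 = n) {X u : ℕ} (hu : u ≠ 26)
    (hun : ρ u < n) :
    (isMember X u).val μ ρ = if ρ u ∈ decode S (ρ X) then 1 else 0 := by
  simp only [isMember, val_mul, val_mem, val_var, val_sub, val_div, val_lit,
    val_maskBit hg h0 hu, sub_two_mul_div, hg.set _ hun, decode, mem_filter]
  have := Nat.mod_two_eq_zero_or_one (ρ X / 2 ^ rankIn S (ρ u))
  by_cases h : ρ u ∈ S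
  · rcases this with h' | h' <;> simp [h, h']
  · simp [h]

open Classical in
theorem val_isAdj (hg : GraphMem co H S n μ) (h0 : ρ 0 = n) {u v : ℕ} (hu : ρ u < n)
    (hv : ρ v < n) (huv : ρ u ≠ ρ v) :
    (isAdj co u v).val μ ρ = if H.Adj (ρ u) (ρ v) then 1 else 0 := by
  rw [← hg.adj _ hu _ hv huv]
  cases co <;> simp [isAdj, val_mem, val_sub, val_add, val_mul, val_var, val_lit, h0]

open Classical in
theorem val_isSlotAdj (hg : GraphMem co H S n μ) (h0 : ρ 0 = n) {u v : ℕ} (huv : ρ u ≠ ρ v) :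
    (isSlotAdj co u v).val μ ρ = if H.Adj (ρ u) (ρ v) then 1 else 0 := by
  simp only [isSlotAdj, val_ite, val_sub, val_var, val_lit, h0]
  split_ifs with h1 h2 h3 h4 h5 <;> try rfl
  · exact absurd (hg.dummy _ _ huv (Or.inl (by omega))) h2
  · exact absurd (hg.dummy _ _ huv (Or.inr (by omega))) h4
  · rw [val_isAdj hg h0 (by omega) (by omega) huv, if_pos h5]
  · rw [val_isAdj hg h0 (by omega) (by omega) huv, if_neg h5]

/-- The factor `isMember` annihilates everything else, so the condition needs to be evaluated
correctly only at members of the set. -/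
theorem val_subMask (hg : GraphMem co H S n μ) (h0 : ρ 0 = n) {X : ℕ} {c : Term} {P : ℕ → Prop}
    [DecidablePred P] (hX : X ≠ 25)
    (hc : ∀ u ∈ decode S (ρ X), c.val μ (Function.update ρ 25 u) = if P u then 1 else 0) :
    (subMask X c).val μ ρ = encode S ((decode S (ρ X)).filter P) := by
  have hsub : range n ∩ decode S (ρ X) = decode S (ρ X) :=
    inter_eq_right.2 fun u hu => mem_range.2 (hg.lt u (decode_subset _ _ hu))
  rw [subMask, val_sumTo, h0, encode, sum_filter, ← hsub, ← sum_ite_mem]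
  refine sum_congr rfl fun u hu => ?_
  have h0' : Function.update ρ 25 u 0 = n := by rw [Function.update_of_ne (by norm_num), h0]
  rw [val_mul, val_mul, val_isMember hg h0' (by norm_num) (by simpa using hu),
    val_maskBit hg h0' (by norm_num), Function.update_self, Function.update_of_ne hX]
  split_ifs with h1 h2
  · rw [hc u h1, if_pos h2]; simp
  · rw [hc u h1, if_neg h2]; simp
  · simp

/-- The memory holds the coins. -/
def CoinMem (ω : ℕ → Bool) (V cb : ℕ) (μ : ℕ → ℕ) : Prop := ∀ t < V, μ (cb + t) = (ω t).toNat

theorem val_coinTerm (hr : Regs ρ n k N d J L Q cb fb wb ab)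
    (hc : CoinMem ω (N * (N + n) * d) cb μ) {i j : Term} {i₀ j₀ : ℕ}
    (hi : ∀ e, i.val μ (Function.update ρ 27 e) = i₀)
    (hj : ∀ e, j.val μ (Function.update ρ 27 e) = j₀) (hi₀ : i₀ < N) (hj₀ : j₀ < N + n) :
    (coinTerm i j).val μ ρ = coinPoly ω d (2 ^ L) (i₀ * (N + n) + j₀) := by
  simp only [coinTerm, val_sumTo, hr.r3, coinPoly]
  refine sum_congr rfl fun e he => ?_
  have hr' := hr.update (r := 27) (x := e) (by norm_num)
  simp only [val_mul, val_mem, val_add, val_var, val_prodTo, val_ite, val_sub, val_lit, hi, hj,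
    hr'.r11, hr'.r10, hr'.r3, Function.update_self]
  have he' := mem_range.1 he
  have h27 : ∀ x, Function.update (Function.update ρ 27 e) 28 x 27 = e := fun x => by
    rw [Function.update_of_ne (by norm_num), Function.update_self]
  have h8 : ∀ x, Function.update (Function.update ρ 27 e) 28 x 8 = 2 ^ L := fun x =>
    (hr'.update (by norm_num)).r8
  simp only [h27, h8, prod_range_ite_lt _ he'.le]
  rw [hc]
  · simp
  · have h1 : i₀ * (N + n) + j₀ + 1 ≤ N * (N + n) := by
      calc i₀ * (N + n) + j₀ + 1 ≤ i₀ * (N + n) + (N + n) := by omega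
        _ = (i₀ + 1) * (N + n) := by ring
        _ ≤ N * (N + n) := Nat.mul_le_mul_right _ hi₀
    calc (i₀ * (N + n) + j₀) * d + e < (i₀ * (N + n) + j₀) * d + d := by omega
      _ = (i₀ * (N + n) + j₀ + 1) * d := by ring
      _ ≤ N * (N + n) * d := Nat.mul_le_mul_right _ h1

/-- The table of clique sums. -/
noncomputable def cliqueTable (H : SimpleGraph ℕ) (S : Finset ℕ) (n N : ℕ) (ξ : ℕ → ℕ) (t : ℕ) :
    ℕ :=
  cliqueSum H (vertexVar ξ (N + n) N (t % N)) (decode S (t / N))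

/-- The slot matrix of the set with bit mask `a`. -/
noncomputable def maskMatrix (H : SimpleGraph ℕ) (S : Finset ℕ) (n N : ℕ) (ξ : ℕ → ℕ) (a : ℕ) :
    ℕ → ℕ → ℕ :=
  slotMatrix H S (edgeVar ξ (N + n)) (vertexVar ξ (N + n) N) (decode S a)

/-- The table of walks. -/
noncomputable def walkTable (H : SimpleGraph ℕ) (S : Finset ℕ) (n N : ℕ) (ξ : ℕ → ℕ) (t : ℕ) : ℕ :=
  walk (maskMatrix H S n N ξ (t / N / (N + 1) / N)) N
    (t / N / (N + 1) % N) (t / N % (N + 1)) (t % N)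

/-- The table of accumulated determinant series. -/
noncomputable def sumTable (H : SimpleGraph ℕ) (S : Finset ℕ) (n N : ℕ) (ξ : ℕ → ℕ) (z t : ℕ) : ℕ :=
  ∑ a ∈ range (t + 1), detSeries (maskMatrix H S n N ξ a) N z

theorem sub_div_mul (a b : ℕ) : a - a / b * b = a % b := Nat.mod_eq_sub_div_mul.symm

theorem mul_add_lt_mul {a b c e : ℕ} (h : a < b) (he : e < c) : a * c + e < b * c := by
  calc a * c + e < a * c + c := by omega
    _ = (a + 1) * c := by ring
    _ ≤ b * c := Nat.mul_le_mul_right _ h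

theorem mul_add_div_of_lt {a b c : ℕ} (h : c < b) : (a * b + c) / b = a := by
  rw [mul_comm, Nat.mul_add_div (by omega), Nat.div_eq_of_lt h, add_zero]

theorem mul_add_mod_of_lt {a b c : ℕ} (h : c < b) : (a * b + c) % b = c := by
  rw [mul_comm, Nat.mul_add_mod, Nat.mod_eq_of_lt h]

theorem val_cliqueTerm (hr : Regs ρ n k N d J L (2 ^ S.card) cb fb wb ab)
    (hg : GraphMem co H S n μ) (hc : CoinMem ω (N * (N + n) * d) cb μ)
    {t : ℕ} (ht : ρ 19 = t) (htQ : t < 2 ^ S.card * N)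
    (hf : ∀ i < t, μ (fb + i) = cliqueTable H S n N (coinPoly ω d (2 ^ L)) i) :
    (cliqueTerm co).val μ ρ = cliqueTable H S n N (coinPoly ω d (2 ^ L)) t := by
  classical
  have hN : 0 < N := Nat.pos_of_ne_zero fun h => by simp [h] at htQ
  have hiN := Nat.mod_lt t hN
  have hX : t / N < 2 ^ S.card := (Nat.div_lt_iff_lt_mul hN).2 htQ
  rw [cliqueTable, cliqueSum_eq, cliqueTerm]
  simp only [val_letIn, val_div, val_sub, val_mul, val_var, ht, hr.r2, Function.update_self,
    Function.update_apply]
  norm_num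
  simp only [sub_div_mul]
  set ρ' := Function.update (Function.update ρ 20 (t / N)) 23 (t % N) with hρ'
  have hr' : Regs ρ' n k N d J L (2 ^ S.card) cb fb wb ab :=
    (hr.update (by norm_num)).update (by norm_num)
  have h20 : ρ' 20 = t / N := by simp [hρ']
  have h23 : ρ' 23 = t % N := by simp [hρ']
  rw [val_add, val_lit, val_sumTo, hr'.r0]
  congr 1
  have hsub : range n ∩ decode S (t / N) = decode S (t / N) :=
    inter_eq_right.2 fun u hu => mem_range.2 (hg.lt u (decode_subset _ _ hu))
  conv_rhs => rw [← hsub, ← sum_ite_mem, hsub]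
  refine sum_congr rfl fun v hv => ?_
  have hv' := mem_range.1 hv
  have hr2 := hr'.update (r := 29) (x := v) (by norm_num)
  have h29 : Function.update ρ' 29 v 29 = v := Function.update_self ..
  have g20 : Function.update ρ' 29 v 20 = t / N := by
    rw [Function.update_of_ne (by norm_num), h20]
  have g23 : Function.update ρ' 29 v 23 = t % N := by
    rw [Function.update_of_ne (by norm_num), h23]
  set ρ₂ := Function.update ρ' 29 v with hρ₂
  rw [val_mul, val_isMember hg hr2.r0 (by norm_num) (by rw [h29]; exact hv'), h29, g20]
  by_cases hmem : v ∈ decode S (t / N)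
  · rw [if_pos hmem, if_pos hmem, one_mul, val_mul]
    rw [val_coinTerm hr2 hc (i₀ := t % N) (j₀ := N + v) (fun e => ?_) (fun e => ?_) hiN (by omega)]
    · congr 1
      rw [val_mem, val_add, val_add, val_mul, val_var, val_var, val_var, hr2.r13, hr2.r2, g23,
        val_subMask hg hr2.r0 (P := fun u => u < v ∧ H.Adj u v) (by norm_num), g20]
      · set m := encode S ((decode S (t / N)).filter fun u => u < v ∧ H.Adj u v) with hm
        -- The vertex `v` itself is removed, so the subset is proper and its entry in the same
        -- column of the table is already present.
        have hmlt : m < t / N := by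
          refine encode_lt_of_ssubset hX ⟨filter_subset _ _, fun hs => ?_⟩
          exact lt_irrefl _ (mem_filter.1 (hs hmem)).2.1
        rw [hf, cliqueTable, mul_add_mod_of_lt hiN, mul_add_div_of_lt hiN, hm, decode_encode]
        · exact (filter_subset _ _).trans (decode_subset _ _)
        · calc m * N + t % N < t / N * N + t % N := by
                have := Nat.mul_lt_mul_of_pos_right hmlt hN; omega
            _ = t := Nat.div_add_mod' t N
      · intro u hu
        rw [g20] at hu
        have hun := hg.lt u (decode_subset _ _ hu)
        have e29 : Function.update ρ₂ 25 u 29 = v := by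
          rw [Function.update_of_ne (by norm_num), h29]
        have e25 : Function.update ρ₂ 25 u 25 = u := Function.update_self ..
        rw [val_ite, val_sub, val_var, val_var, e29, e25]
        by_cases huv : u < v
        · rw [if_neg (by omega), val_isAdj hg ((hr2.update (by norm_num)).r0)
            (by rw [e25]; exact hun) (by rw [e29]; exact hv') (by rw [e25, e29]; exact huv.ne),
            e25, e29]
          simp [huv]
        · rw [if_pos (by omega), val_lit, if_neg (fun h => huv h.1)]
    · rw [val_var, Function.update_of_ne (by norm_num), g23]
    · rw [val_add, val_var, val_var, (hr2.update (by norm_num)).r2,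
        Function.update_of_ne (by norm_num), h29]
  · rw [if_neg hmem, if_neg hmem, zero_mul]

theorem val_isFree (hg : GraphMem co H S n μ) (h0 : ρ 0 = n) (r : ℕ) :
    (isFree r).val μ ρ = if ρ r ∈ S then 0 else 1 := by
  simp only [isFree, val_ite, val_sub, val_var, val_lit, val_mem, h0]
  by_cases h : ρ r < n
  · rw [if_neg (by omega), hg.set _ h]
    split_ifs <;> rfl
  · rw [if_pos (by omega), if_neg fun hs => h (hg.lt _ hs)]

-- Clique vertices lie in `S` and the two slots do not, so every adjacency that is tested concerns
-- distinct slots.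
open Classical in
theorem val_edgeTerm (hr : Regs ρ n k N d J L (2 ^ S.card) cb fb wb ab)
    (hg : GraphMem co H S n μ) (hc : CoinMem ω (N * (N + n) * d) cb μ) {a b : ℕ}
    (ha : a ≠ 27) (hb : b ≠ 27) (haN : ρ a < N) (hbN : ρ b < N)
    (h23 : ρ 23 ∉ S) (h24 : ρ 24 ∉ S)
    (hf : ∀ i < 2 ^ S.card * N, μ (fb + i) = cliqueTable H S n N (coinPoly ω d (2 ^ L)) i) :
    (edgeTerm co a b).val μ ρ =
      edgeVar (coinPoly ω d (2 ^ L)) (N + n) (ρ a) (ρ b) *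
        cliqueSum H (vertexVar (coinPoly ω d (2 ^ L)) (N + n) N (ρ a))
          ((decode S (ρ 20)).filter fun v => H.Adj v (ρ 23) ∧ H.Adj v (ρ 24)) := by
  rw [edgeTerm, val_mul, val_coinTerm hr hc (i₀ := ρ a) (j₀ := ρ b)
    (fun e => by rw [val_var, Function.update_of_ne ha])
    (fun e => by rw [val_var, Function.update_of_ne hb]) haN (by omega)]
  congr 1
  rw [val_mem, val_add, val_add, val_mul, val_var, val_var, val_var, hr.r13, hr.r2,
    val_subMask hg hr.r0 (P := fun v => H.Adj v (ρ 23) ∧ H.Adj v (ρ 24)) (by norm_num)]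
  · have hsub : (decode S (ρ 20)).filter (fun v => H.Adj v (ρ 23) ∧ H.Adj v (ρ 24)) ⊆ S :=
      (filter_subset _ _).trans (decode_subset _ _)
    rw [hf _ (mul_add_lt_mul (encode_lt hsub) haN), cliqueTable, mul_add_mod_of_lt haN,
      mul_add_div_of_lt haN, decode_encode hsub]
  · intro u hu
    have huS := decode_subset _ _ hu
    have h0' := (hr.update (r := 25) (x := u) (by norm_num)).r0
    have e25 : Function.update ρ 25 u 25 = u := Function.update_self ..
    have e23 : Function.update ρ 25 u 23 = ρ 23 := Function.update_of_ne (by norm_num) _ _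
    have e24 : Function.update ρ 25 u 24 = ρ 24 := Function.update_of_ne (by norm_num) _ _
    rw [val_mul, val_isSlotAdj hg h0', val_isSlotAdj hg h0', e25, e23, e24]
    · split_ifs <;> first | rfl | tauto
    · rw [e25, e24]; exact fun h => h24 (h ▸ huS)
    · rw [e25, e23]; exact fun h => h23 (h ▸ huS)

theorem val_matrixTerm (hr : Regs ρ n k N d J L (2 ^ S.card) cb fb wb ab)
    (hg : GraphMem co H S n μ) (hc : CoinMem ω (N * (N + n) * d) cb μ)
    (h23 : ρ 23 < N) (h24 : ρ 24 < N)
    (hf : ∀ i < 2 ^ S.card * N, μ (fb + i) = cliqueTable H S n N (coinPoly ω d (2 ^ L)) i) :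
    (matrixTerm co).val μ ρ =
      maskMatrix H S n N (coinPoly ω d (2 ^ L)) (ρ 20) (ρ 23) (ρ 24) := by
  classical
  rw [matrixTerm, val_ite, maskMatrix]
  by_cases heq : ρ 23 = ρ 24
  · rw [if_pos (by simp only [val_add, val_sub, val_var]; omega), ← heq, slotMatrix_self]
    simp only [val_ite, val_sub, val_var, val_mem, val_lit, hr.r0]
    by_cases h : ρ 23 < n
    · rw [if_neg (by omega), hg.set _ h]
    · rw [if_pos (by omega), if_neg fun hs => h (hg.lt _ hs)]
  · rw [if_neg (by simp only [val_add, val_sub, val_var]; omega), val_mul, val_mul, val_mul,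
      val_isFree hg hr.r0, val_isFree hg hr.r0, val_isSlotAdj hg hr.r0 heq]
    by_cases hfree : ρ 23 ∉ S ∧ ρ 24 ∉ S ∧ H.Adj (ρ 23) (ρ 24)
    · obtain ⟨h1, h2, h3⟩ := hfree
      rw [if_neg h1, if_neg h2, if_pos h3, one_mul, one_mul, one_mul, val_ite]
      by_cases hlt : ρ 23 < ρ 24
      · rw [if_neg (by rw [val_sub, val_var, val_var]; omega),
          slotMatrix_of_lt H S _ _ _ hlt h1 h2 h3,
          val_edgeTerm hr hg hc (by norm_num) (by norm_num) h23 h24 h1 h2 hf]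
      · have hlt' : ρ 24 < ρ 23 := by omega
        rw [if_pos (by rw [val_sub, val_var, val_var]; omega),
          slotMatrix_comm, slotMatrix_of_lt H S _ _ _ hlt' h2 h1 h3.symm,
          val_edgeTerm hr hg hc (by norm_num) (by norm_num) h24 h23 h1 h2 hf]
        simp only [and_comm]
    · rw [slotMatrix_eq_zero H S _ _ _ heq hfree]
      by_cases h1 : ρ 23 ∈ S
      · rw [if_pos h1, zero_mul]
      · by_cases h2 : ρ 24 ∈ S
        · rw [if_pos h2, zero_mul, mul_zero]
        · rw [if_neg (show ¬ H.Adj (ρ 23) (ρ 24) from fun h3 => hfree ⟨h1, h2, h3⟩), zero_mul,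
            mul_zero, mul_zero]

theorem val_walkTerm (hr : Regs ρ n k N d J L (2 ^ S.card) cb fb wb ab)
    (hg : GraphMem co H S n μ) (hc : CoinMem ω (N * (N + n) * d) cb μ)
    (hf : ∀ i < 2 ^ S.card * N, μ (fb + i) = cliqueTable H S n N (coinPoly ω d (2 ^ L)) i)
    {t : ℕ} (ht : ρ 19 = t) (htQ : t < 2 ^ S.card * N * (N + 1) * N)
    (hw : ∀ i < t, μ (wb + i) = walkTable H S n N (coinPoly ω d (2 ^ L)) i) :
    (walkTerm co).val μ ρ = walkTable H S n N (coinPoly ω d (2 ^ L)) t := by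
  classical
  have hN : 0 < N := Nat.pos_of_ne_zero fun h => by simp [h] at htQ
  have ht1 : t / N < 2 ^ S.card * N * (N + 1) := (Nat.div_lt_iff_lt_mul hN).2 htQ
  have ht2 : t / N / (N + 1) < 2 ^ S.card * N := (Nat.div_lt_iff_lt_mul (by omega)).2 ht1
  have ht3 : t / N / (N + 1) / N < 2 ^ S.card := (Nat.div_lt_iff_lt_mul hN).2 ht2
  set X := t / N / (N + 1) / N with hXdef
  set r := t / N / (N + 1) % N with hrdef
  set κ := t / N % (N + 1) with hκ
  set i := t % N with hi
  have hrN : r < N := Nat.mod_lt _ hN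
  have hiN : i < N := Nat.mod_lt _ hN
  set ρ' := Function.update (Function.update (Function.update (Function.update (Function.update
    (Function.update ρ 31 (t / N)) 23 i) 32 (t / N / (N + 1))) 22 κ) 20 X) 21 r with hρ'
  have hr' : Regs ρ' n k N d J L (2 ^ S.card) cb fb wb ab :=
    (((((hr.update (by norm_num)).update (by norm_num)).update (by norm_num)).update
      (by norm_num)).update (by norm_num)).update (by norm_num)
  have hval : (walkTerm co).val μ ρ = (ite (var 22)
      (sumTo 24 2 (ite (var 24 - var 21) (lit 0)
        (matrixTerm co * mem (var 15 + ((var 31 - lit 1) * var 2 + var 24)))))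
      (ite ((var 23 - var 21) + (var 21 - var 23)) (lit 0) (lit 1))).val μ ρ' := by
    rw [walkTerm]
    simp only [val_letIn, val_div, val_sub, val_mul, val_var]
    rw [hρ']
    simp [ht, hr.r2, hr.r4, sub_div_mul, hi, hκ, hrdef, hXdef]
  have h20 : ρ' 20 = X := by simp [hρ']
  have h21 : ρ' 21 = r := by simp [hρ']
  have h22 : ρ' 22 = κ := by simp [hρ']
  have h23 : ρ' 23 = i := by simp [hρ']
  have h31 : ρ' 31 = t / N := by simp [hρ']
  rw [hval, walkTable, ← hXdef, ← hrdef, ← hκ, ← hi, val_ite, val_var, h22]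
  rcases Nat.eq_zero_or_pos κ with hκ0 | hκ0
  · rw [if_pos hκ0, hκ0, walk]
    simp only [val_ite, val_add, val_sub, val_var, val_lit, h21, h23]
    split_ifs <;> first | rfl | omega
  · obtain ⟨κ', hκ'⟩ := Nat.exists_eq_succ_of_ne_zero hκ0.ne'
    rw [if_neg hκ0.ne', hκ', Nat.succ_eq_add_one, walk, val_sumTo, hr'.r2]
    refine sum_congr rfl fun j hj => ?_
    have hjN := mem_range.1 hj
    have hr2 := hr'.update (r := 24) (x := j) (by norm_num)
    have e24 : Function.update ρ' 24 j 24 = j := Function.update_self ..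
    have e21 : Function.update ρ' 24 j 21 = r := by
      rw [Function.update_of_ne (by norm_num), h21]
    have e20 : Function.update ρ' 24 j 20 = X := by
      rw [Function.update_of_ne (by norm_num), h20]
    have e23 : Function.update ρ' 24 j 23 = i := by
      rw [Function.update_of_ne (by norm_num), h23]
    have e31 : Function.update ρ' 24 j 31 = t / N := by
      rw [Function.update_of_ne (by norm_num), h31]
    rw [val_ite, val_sub, val_var, val_var, e24, e21]
    by_cases hrj : r < j
    · rw [if_neg (by omega), if_pos hrj, val_lit]
    · rw [if_pos (by omega), if_neg hrj, val_mul,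
        val_matrixTerm hr2 hg hc (by rw [e23]; exact hiN) (by rw [e24]; exact hjN)
          hf, e20, e23, e24]
      congr 1
      rw [val_mem, val_add, val_add, val_mul, val_sub, val_var, val_var, val_var, val_var, val_lit,
        e24, e31, hr2.r15, hr2.r2]
      have hκN : κ < N + 1 := Nat.mod_lt _ (by omega)
      -- The walk length is the lowest mixed-radix digit of `t / N`. It is positive here, so
      -- subtracting `1` shortens the walk and keeps set and end point.
      have hdecomp : t / N - 1 = t / N / (N + 1) * (N + 1) + κ' := by
        have := Nat.div_add_mod' (t / N) (N + 1)
        omega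
      have hlt : (t / N - 1) * N + j < t := by
        have h1 := Nat.div_add_mod' t N
        have h2 : (t / N - 1) * N + N = t / N * N := by
          have : t / N - 1 + 1 = t / N := by
            have := Nat.mod_le (t / N) (N + 1); omega
          rw [← Nat.succ_mul, Nat.succ_eq_add_one, this]
        omega
      rw [hw _ hlt, walkTable, mul_add_mod_of_lt hjN, mul_add_div_of_lt hjN, hdecomp,
        mul_add_mod_of_lt (by omega), mul_add_div_of_lt (by omega)]

theorem val_seriesTerm (hr : Regs ρ n k N d J L (2 ^ S.card) cb fb wb ab) {t : ℕ}
    (ht : ρ 19 = t) (htQ : t < 2 ^ S.card)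
    (hw : ∀ i < 2 ^ S.card * N * (N + 1) * N,
      μ (wb + i) = walkTable H S n N (coinPoly ω d (2 ^ L)) i) :
    seriesTerm.val μ ρ =
      walkSeries (maskMatrix H S n N (coinPoly ω d (2 ^ L)) t) N ((2 ^ L) ^ J) := by
  rw [seriesTerm, val_prodTo, hr.r2, walkSeries]
  refine prod_congr rfl fun r hrr => ?_
  have hrN := mem_range.1 hrr
  rw [val_sumTo, (hr.update (by norm_num)).r4]
  refine sum_congr rfl fun κ hκ => ?_
  have hκN := mem_range.1 hκ
  set ρ' := Function.update (Function.update ρ 21 r) 22 κ with hρ'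
  have hr' : Regs ρ' n k N d J L (2 ^ S.card) cb fb wb ab :=
    (hr.update (by norm_num)).update (by norm_num)
  have h19 : ρ' 19 = t := by simp [hρ', ht]
  have h21 : ρ' 21 = r := by simp [hρ']
  have h22 : ρ' 22 = κ := by simp [hρ']
  have h22' : ∀ x, Function.update ρ' 34 x 22 = κ := fun x => by
    rw [Function.update_of_ne (by norm_num), h22]
  have h9 : ∀ x, Function.update ρ' 34 x 9 = (2 ^ L) ^ J := fun x =>
    (hr'.update (by norm_num)).r9
  simp only [val_mul, val_prodTo, hr'.r2, val_ite, val_sub, val_var, val_lit, h22', h9,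
    Function.update_self, prod_range_ite_lt _ (Nat.lt_succ_iff.1 hκN), val_mem, val_add, hr'.r15,
    hr'.r4, h19, h21, h22]
  rw [hw, walkTable, mul_add_mod_of_lt hrN, mul_add_div_of_lt hrN, mul_add_mod_of_lt hκN,
    mul_add_div_of_lt hκN, mul_add_mod_of_lt hrN, mul_add_div_of_lt hrN]
  exact mul_add_lt_mul (mul_add_lt_mul (mul_add_lt_mul htQ hrN) hκN) hrN

/-- The zero cell just before the table plays the role of the empty partial sum, so entry `0` needs
no special case. -/
theorem val_sumTerm (hr : Regs ρ n k N d J L (2 ^ S.card) cb fb wb ab) {t : ℕ}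
    (ht : ρ 19 = t) (htQ : t < 2 ^ S.card)
    (hw : ∀ i < 2 ^ S.card * N * (N + 1) * N,
      μ (wb + i) = walkTable H S n N (coinPoly ω d (2 ^ L)) i)
    (h0 : μ ab = 0)
    (hs : ∀ i < t, μ (ab + 1 + i) = sumTable H S n N (coinPoly ω d (2 ^ L)) ((2 ^ L) ^ J) i) :
    sumTerm.val μ ρ = sumTable H S n N (coinPoly ω d (2 ^ L)) ((2 ^ L) ^ J) t := by
  rw [sumTerm, val_add, sumTable, sum_range_succ]
  congr 1
  · rw [val_mem, val_add, val_var, val_var, hr.r17, ht]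
    cases t with
    | zero => simp [h0]
    | succ t =>
      rw [show ab + (t + 1) = ab + 1 + t by ring, hs t (by omega), sumTable]
  · rw [val_sumTo, hr.r4, detSeries]
    refine sum_congr rfl fun j hj => ?_
    have hjN := mem_range.1 hj
    have hval : ∀ x, (lit 1 + seriesTerm).val μ (Function.update (Function.update ρ 30 j) 33 x) =
        1 + walkSeries (maskMatrix H S n N (coinPoly ω d (2 ^ L)) t) N ((2 ^ L) ^ J) := by
      intro x
      rw [val_add, val_lit, val_seriesTerm ((hr.update (by norm_num)).update (by norm_num)) _ htQ hw]
      rw [Function.update_of_ne (by norm_num), Function.update_of_ne (by norm_num), ht]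
    have h30 : ∀ x, Function.update (Function.update ρ 30 j) 33 x 30 = j := fun x => by
      rw [Function.update_of_ne (by norm_num), Function.update_self]
    rw [val_prodTo, (hr.update (by norm_num)).r2]
    simp only [val_ite, val_sub, val_var, hval, h30, Function.update_self, val_lit]
    exact prod_range_ite_lt _ (Nat.lt_succ_iff.1 hjN)

-- Truncated subtraction `1 - (1 - x)` turns the number `x` of odd digits into a truth value. The
-- other test answers no if `n - S.card` exceeds `2 * k`, in which case the padding is meaningless.
open Classical in
theorem val_answerTerm (hr : Regs ρ n k N d J L Q cb fb wb ab) (hg : GraphMem co H S n μ) {s : ℕ}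
    (hs : μ (ab + Q) = s) :
    answerTerm.val μ ρ =
      if n - S.card ≤ 2 * k ∧
        ∃ j < J, (s / ((2 ^ L) ^ J) ^ N % (2 ^ L) ^ J) / (2 ^ L) ^ j % 2 ≠ 0 then 1 else 0 := by
  have hcard : ∀ ρ₁ : ℕ → ℕ, ρ₁ 0 = n → (sumTo 33 0 (mem (var 33))).val μ ρ₁ = S.card := by
    intro ρ₁ h0
    have hsub : range n ∩ S = S := inter_eq_right.2 fun u hu => mem_range.2 (hg.lt u hu)
    rw [val_sumTo, h0, card_eq_sum_ones, ← hsub, ← sum_ite_mem]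
    refine sum_congr rfl fun v hv => ?_
    rw [val_mem, val_var, Function.update_self, hg.set v (mem_range.1 hv)]
  rw [answerTerm]
  simp only [val_letIn]
  have e1 : (mem (var 17 + var 7) / prodTo 33 2 (var 9)).val μ ρ = s / ((2 ^ L) ^ J) ^ N := by
    rw [val_div, val_mem, val_add, val_var, val_var, hr.r17, hr.r7, hs, val_prodTo, hr.r2]
    simp only [val_var, (hr.update (r := 33) (by norm_num)).r9, prod_const, card_range]
  rw [e1]
  have e2 : (var 20 - var 20 / var 9 * var 9).val μ
      (Function.update ρ 20 (s / ((2 ^ L) ^ J) ^ N)) = s / ((2 ^ L) ^ J) ^ N % (2 ^ L) ^ J := by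
    simp only [val_sub, val_mul, val_div, val_var, Function.update_self,
      (hr.update (r := 20) (by norm_num)).r9, sub_div_mul]
  rw [e2]
  set c := s / ((2 ^ L) ^ J) ^ N % (2 ^ L) ^ J with hc
  set ρ' := Function.update (Function.update ρ 20 (s / ((2 ^ L) ^ J) ^ N)) 21 c with hρ'
  have hr' : Regs ρ' n k N d J L Q cb fb wb ab :=
    (hr.update (by norm_num)).update (by norm_num)
  have h21 : ρ' 21 = c := by simp [hρ']
  rw [val_ite, val_sub, val_sub, val_mul, val_var, val_var, val_lit, val_lit, hcard _ hr'.r0, hr'.r0,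
    hr'.r1]
  have hsum : (sumTo 22 5 (letIn 24 (var 21 / prodTo 33 5 (ite (var 22 - var 33) (var 8) (lit 1)))
          (var 24 - lit 2 * (var 24 / lit 2)))).val μ ρ' = ∑ j ∈ range J, c / (2 ^ L) ^ j % 2 := by
    rw [val_sumTo, hr'.r5]
    refine sum_congr rfl fun j hj => ?_
    have hjJ := mem_range.1 hj
    have hr2 := hr'.update (r := 22) (x := j) (by norm_num)
    have h8 : ∀ x, Function.update (Function.update ρ' 22 j) 33 x 8 = 2 ^ L := fun x =>
      (hr2.update (by norm_num)).r8
    have h22 : ∀ x, Function.update (Function.update ρ' 22 j) 33 x 22 = j := fun x => by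
      rw [Function.update_of_ne (by norm_num), Function.update_self]
    have h21' : Function.update ρ' 22 j 21 = c := by
      rw [Function.update_of_ne (by norm_num), h21]
    simp only [val_letIn, val_sub, val_mul, val_div, val_var, val_lit, Function.update_self,
      sub_two_mul_div, h21', val_prodTo, hr2.r5, val_ite, h8, h22, prod_range_ite_lt _ hjJ.le]
  rw [val_sub, val_sub, val_lit, hsum]
  by_cases hk : n - S.card ≤ 2 * k
  · rw [if_pos (by omega)]
    by_cases hex : ∃ j < J, c / (2 ^ L) ^ j % 2 ≠ 0
    · rw [if_pos ⟨hk, hex⟩]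
      obtain ⟨j, hj, hne⟩ := hex
      have := single_le_sum (f := fun j => c / (2 ^ L) ^ j % 2) (fun _ _ => Nat.zero_le _)
        (mem_range.2 hj)
      omega
    · rw [if_neg fun h => hex h.2]
      push Not at hex
      rw [sum_eq_zero fun j hj => hex j (mem_range.1 hj)]
      rfl
  · rw [if_neg (by omega), if_neg fun h => hk h.1]

end Values
end RAM

/-! ## The program -/

namespace RAM

open Term

section Parameters

/-- The number of slots. -/
def slotCount (n k p : ℕ) : ℕ := n + (2 * k - (n - p))

/-- The number of coefficients of the random polynomials. -/
def coeffCount (c n : ℕ) : ℕ := (c + 3) * (n + 2)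

/-- The number of bits reserved for a coefficient. -/
def digitBits (c n : ℕ) : ℕ := coverSumBits n (3 * n) (coeffCount c n) 0 + 1

/-- The number of digits reserved for a polynomial. -/
def digitCount (c n : ℕ) : ℕ := coverSumBits n (3 * n) (digitBits c n * coeffCount c n) 0 + 1

/-- The number of coins. -/
def coinCount (c n k p : ℕ) : ℕ := slotCount n k p * (slotCount n k p + n) * coeffCount c n

/-- The address of the table of clique sums. -/
def cliqueBase (c n k p : ℕ) : ℕ := n + n * n + coinCount c n k p

/-- The address of the table of walks. -/
def walkBase (c n k p : ℕ) : ℕ := cliqueBase c n k p + 2 ^ p * slotCount n k p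

/-- The address of the table of accumulated determinant series. -/
def sumBase (c n k p : ℕ) : ℕ :=
  walkBase c n k p + 2 ^ p * slotCount n k p * (slotCount n k p + 1) * slotCount n k p

/-- The intended contents of the parameter registers. -/
def params (c n k p r : ℕ) : ℕ :=
  [n, k, slotCount n k p, coeffCount c n, slotCount n k p + 1, digitCount c n, digitBits c n, 2 ^ p,
    2 ^ digitBits c n, (2 ^ digitBits c n) ^ digitCount c n, slotCount n k p + n, n + n * n,
    coinCount c n k p, cliqueBase c n k p, 2 ^ p * slotCount n k p, walkBase c n k p,
    2 ^ p * slotCount n k p * (slotCount n k p + 1) * slotCount n k p, sumBase c n k p,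
    sumBase c n k p + 1].getD r 0

theorem regs_params (c n k p : ℕ) : Regs (params c n k p) n k (slotCount n k p) (coeffCount c n)
    (digitCount c n) (digitBits c n) (2 ^ p) (n + n * n) (cliqueBase c n k p) (walkBase c n k p)
    (sumBase c n k p) := by
  constructor <;> rfl

/-- The term for `coverSumBits`. -/
def bitsTerm (N δ : Term) : Term :=
  var 0 + (N + (lit 1 + N * (N + (lit 0 + (N + δ * (var 0 + lit 1))) * N)) * N)

theorem val_bitsTerm {μ ρ : ℕ → ℕ} (N δ : Term) : (bitsTerm N δ).val μ ρ =
    coverSumBits (ρ 0) (N.val μ ρ) (δ.val μ ρ) 0 := rfl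

/-- The terms for the parameter registers from number `2` on. -/
def paramTerms (c : ℕ) : List Term :=
  [var 0 + (lit 2 * var 1 - (var 0 - sumTo 33 0 (mem (var 33)))),
    lit (c + 3) * (var 0 + lit 2),
    var 2 + lit 1,
    bitsTerm (lit 3 * var 0) ((bitsTerm (lit 3 * var 0) (var 3) + lit 1) * var 3) + lit 1,
    bitsTerm (lit 3 * var 0) (var 3) + lit 1,
    prodTo 26 0 (lit 1 + mem (var 26)),
    prodTo 26 6 (lit 2),
    prodTo 26 5 (var 8),
    var 2 + var 0,
    var 0 + var 0 * var 0,
    var 2 * var 10 * var 3,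
    var 11 + var 12,
    var 7 * var 2,
    var 13 + var 14,
    var 14 * var 4 * var 2,
    var 15 + var 16,
    var 17 + lit 1]

theorem wf_paramTerms (c : ℕ) : ∀ e ∈ paramTerms c, e.WF = true := by
  simp only [paramTerms, List.forall_mem_cons]
  refine ⟨rfl, rfl, rfl, rfl, rfl, rfl, rfl, rfl, rfl, rfl, rfl, rfl, rfl, rfl, rfl, rfl, rfl, ?_⟩
  simp

variable {n k p c : ℕ} {co : Bool} {H : SimpleGraph ℕ} {S : Finset ℕ} {μ : ℕ → ℕ}

theorem GraphMem.sum_eq_card (hg : GraphMem co H S n μ) : ∑ v ∈ range n, μ v = S.card := by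
  have hsub : range n ∩ S = S := inter_eq_right.2 fun u hu => mem_range.2 (hg.lt u hu)
  rw [card_eq_sum_ones, ← hsub, ← sum_ite_mem]
  exact sum_congr rfl fun v hv => hg.set v (mem_range.1 hv)

theorem GraphMem.prod_eq_two_pow (hg : GraphMem co H S n μ) :
    ∏ v ∈ range n, (1 + μ v) = 2 ^ S.card := by
  have hsub : range n ∩ S = S := inter_eq_right.2 fun u hu => mem_range.2 (hg.lt u hu)
  rw [← prod_const, ← hsub, ← prod_ite_mem]
  refine prod_congr rfl fun v hv => ?_
  rw [hg.set v (mem_range.1 hv)]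
  split_ifs <;> rfl

/-- The number `p` is not given: it is the sum of the indicator vector, and `2 ^ p` is the product
of the numbers `1 + μ v`. Register `5` precedes register `6`, so the term for the digit count
recomputes the digit length. -/
theorem val_paramTerms (hg : GraphMem co H S n μ) (hp : S.card = p) :
    ∀ (j : ℕ) (hj : j < (paramTerms c).length), ((paramTerms c)[j]).val μ
      (fun i => if i < 2 + j then params c n k p i else 0) = params c n k p (2 + j) := by
  intro j hj
  have hj' : j < 17 := hj
  have hs := hg.sum_eq_card
  have hq := hg.prod_eq_two_pow
  rw [hp] at hs hq
  have hR := regs_params c n k p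
  have hlt : ∀ i < 2 + j, (fun i => if i < 2 + j then params c n k p i else 0) i =
      params c n k p i := fun i hi => if_pos hi
  generalize (fun i => if i < 2 + j then params c n k p i else 0) = ρ at hlt
  have h0 : ρ 0 = n := (hlt 0 (by omega)).trans hR.r0
  have h1 : ρ 1 = k := (hlt 1 (by omega)).trans hR.r1
  interval_cases j
  · rw [hR.r2]
    simp only [paramTerms, List.getElem_cons_zero, val_add, val_sub, val_mul, val_var, val_lit,
      val_sumTo, val_mem, h0, h1, Function.update_self, hs, slotCount]
  · rw [hR.r3]
    simp only [paramTerms, List.getElem_cons_succ, List.getElem_cons_zero, val_add, val_mul,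
      val_var, val_lit, h0, coeffCount]
  · rw [hR.r4, ← hR.r2, ← hlt 2 (by norm_num)]; rfl
  · have h3 : ρ 3 = coeffCount c n := (hlt 3 (by norm_num)).trans hR.r3
    rw [hR.r5]
    simp only [paramTerms, List.getElem_cons_succ, List.getElem_cons_zero, val_add, val_mul,
      val_var, val_lit, h0, h3, val_bitsTerm, digitCount, digitBits]
  · have h3 : ρ 3 = coeffCount c n := (hlt 3 (by norm_num)).trans hR.r3
    rw [hR.r6]
    simp only [paramTerms, List.getElem_cons_succ, List.getElem_cons_zero, val_add, val_mul,
      val_var, val_lit, h0, h3, val_bitsTerm, digitBits]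
  · rw [hR.r7]
    simp only [paramTerms, List.getElem_cons_succ, List.getElem_cons_zero, val_add, val_mem,
      val_var, val_lit, h0, val_prodTo, Function.update_self, hq]
  · have h6 : ρ 6 = digitBits c n := (hlt 6 (by norm_num)).trans hR.r6
    rw [hR.r8]
    simp only [paramTerms, List.getElem_cons_succ, List.getElem_cons_zero, val_lit, h6, val_prodTo,
      prod_const, card_range]
  · have h5 : ρ 5 = digitCount c n := (hlt 5 (by norm_num)).trans hR.r5
    have h8 : ρ 8 = 2 ^ digitBits c n := (hlt 8 (by norm_num)).trans hR.r8
    rw [hR.r9]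
    simp only [paramTerms, List.getElem_cons_succ, List.getElem_cons_zero, val_var, h5, val_prodTo,
      Function.update_of_ne (show 8 ≠ 26 by norm_num), h8, prod_const, card_range]
  · rw [hR.r10, ← hR.r2, ← hlt 2 (by norm_num)]
    simp only [paramTerms, List.getElem_cons_succ, List.getElem_cons_zero, val_add, val_var, h0]
  · rw [hR.r11]
    simp only [paramTerms, List.getElem_cons_succ, List.getElem_cons_zero, val_add, val_mul,
      val_var, h0]
  · rw [hR.r12, ← hR.r10, ← hR.r3, ← hR.r2, ← hlt 2 (by norm_num), ← hlt 10 (by norm_num),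
      ← hlt 3 (by norm_num)]
    rfl
  · rw [hR.r13, cliqueBase, coinCount, ← hR.r11, ← hR.r12, ← hlt 11 (by norm_num),
      ← hlt 12 (by norm_num)]
    rfl
  · rw [hR.r14, ← hR.r7, ← hR.r2, ← hlt 7 (by norm_num), ← hlt 2 (by norm_num)]
    rfl
  · rw [hR.r15, walkBase, ← hR.r13, ← hR.r14, ← hlt 13 (by norm_num), ← hlt 14 (by norm_num)]
    rfl
  · rw [hR.r16, ← hR.r14, ← hR.r4, ← hR.r2, ← hlt 14 (by norm_num), ← hlt 4 (by norm_num),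
      ← hlt 2 (by norm_num)]
    rfl
  · rw [hR.r17, sumBase, ← hR.r15, ← hR.r16, ← hlt 15 (by norm_num), ← hlt 16 (by norm_num)]
    rfl
  · rw [hR.r18, ← hR.r17, ← hlt 17 (by norm_num)]
    rfl

end Parameters
end RAM

/-! ### Polynomial bounds for addresses and bit lengths. -/

namespace RAM

open Term

section Bounds

variable {n k p c : ℕ} {co : Bool} {H : SimpleGraph ℕ} {S : Finset ℕ} {μ : ℕ → ℕ}

/-- All addresses are at most `2 ^ p` times this number. -/
def addressBound (c n : ℕ) : ℕ :=
  n + n * n + 3 * n * (3 * n + n) * coeffCount c n + 3 * n + 3 * n * (3 * n + 1) * (3 * n) + 1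

/-- A bound for the bit lengths of the contents of all registers and memory cells. -/
def sizeBound (c n : ℕ) : ℕ :=
  n + addressBound c n + coeffCount c n + digitCount c n + digitBits c n +
    digitBits c n * digitCount c n +
    (3 * n + digitBits c n * coeffCount c n * (n + 1)) * (3 * n) +
    coverSumBits n (3 * n) (digitBits c n * coeffCount c n) (digitBits c n * digitCount c n) + 1

theorem PolyBdd.addressBound (c : ℕ) : PolyBdd (addressBound c) := by
  have C := PolyBdd.const
  have I := PolyBdd.id
  have hd : PolyBdd (coeffCount c) := (C _).mul (I.add (C _))
  have h3 : PolyBdd fun n => 3 * n := (C _).mul I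
  exact ((((I.add (I.mul I)).add ((h3.mul (h3.add I)).mul hd)).add h3).add
    ((h3.mul (h3.add (C _))).mul h3)).add (C _)

theorem PolyBdd.coverSumBits {N δ ζ : ℕ → ℕ} (hN : PolyBdd N) (hδ : PolyBdd δ) (hζ : PolyBdd ζ) :
    PolyBdd fun n => coverSumBits n (N n) (δ n) (ζ n) := by
  have C := PolyBdd.const
  have I := PolyBdd.id
  exact I.add (hN.add (((C 1).add (hN.mul (hN.add ((hζ.add (hN.add (hδ.mul (I.add (C 1))))).mul
    hN)))).mul hN))

theorem PolyBdd.sizeBound (c : ℕ) : PolyBdd (sizeBound c) := by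
  have C := PolyBdd.const
  have I := PolyBdd.id
  have hd : PolyBdd (coeffCount c) := (C _).mul (I.add (C _))
  have h3 : PolyBdd fun n => 3 * n := (C _).mul I
  have hL : PolyBdd (digitBits c) := (PolyBdd.coverSumBits h3 hd (C 0)).add (C 1)
  have hJ : PolyBdd (digitCount c) := (PolyBdd.coverSumBits h3 (hL.mul hd) (C 0)).add (C 1)
  exact (((((((I.add (PolyBdd.addressBound c)).add hd).add hJ).add hL).add (hL.mul hJ)).add
    ((h3.add ((hL.mul hd).mul (I.add (C 1)))).mul h3)).add
    (PolyBdd.coverSumBits h3 (hL.mul hd) (hL.mul hJ))).add (C 1)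

/-- Here it matters that the main program runs only for `k < n`; otherwise the padding would not be
polynomial in `n`. -/
theorem slotCount_le (hk : k < n) : slotCount n k p ≤ 3 * n := by
  simp only [slotCount]; omega

theorem size_le_of_le_two_pow {x b : ℕ} (h : x ≤ 2 ^ b) : x.size ≤ b + 1 := by
  rw [Nat.size_le, pow_succ]
  have : 0 < 2 ^ b := by positivity
  omega

theorem size_le_of_le_mul {x n p e : ℕ} (hp : p ≤ n) (h : x ≤ 2 ^ p * e) : x.size ≤ n + e + 1 := by
  refine size_le_of_le_two_pow (h.trans ?_)
  rw [pow_add]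
  exact Nat.mul_le_mul (Nat.pow_le_pow_right (by norm_num) hp) Nat.lt_two_pow_self.le

theorem walk_length_le (hk : k < n) : 2 ^ p * slotCount n k p * (slotCount n k p + 1) *
    slotCount n k p ≤ 2 ^ p * (3 * n * (3 * n + 1) * (3 * n)) := by
  have := slotCount_le (p := p) hk
  rw [mul_assoc, mul_assoc, ← mul_assoc (slotCount n k p)]
  gcongr

theorem coinCount_le (hk : k < n) :
    coinCount c n k p ≤ 3 * n * (3 * n + n) * coeffCount c n := by
  have := slotCount_le (p := p) hk
  simp only [coinCount]
  gcongr

theorem le_two_pow_mul (p a : ℕ) : a ≤ 2 ^ p * a := Nat.le_mul_of_pos_left a (by positivity)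

theorem sumBase_lt (hk : k < n) : sumBase c n k p + 1 ≤ 2 ^ p * addressBound c n := by
  have h1 := walk_length_le (p := p) hk
  have h2 := coinCount_le (c := c) (p := p) hk
  have h3 : 2 ^ p * slotCount n k p ≤ 2 ^ p * (3 * n) :=
    Nat.mul_le_mul_left _ (slotCount_le hk)
  have h4 := le_two_pow_mul p (n + n * n + 3 * n * (3 * n + n) * coeffCount c n)
  have h5 : 1 ≤ 2 ^ p := Nat.one_le_two_pow
  simp only [sumBase, walkBase, cliqueBase, addressBound, mul_add _ (_ + _), mul_one] at *
  omega

theorem bounded_params (hk : k < n) (hp : p ≤ n) (hμ : ∀ a, (μ a).size ≤ sizeBound c n) :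
    Bounded (params c n k p) μ (sizeBound c n) := by
  have hR := regs_params c n k p
  have hN := slotCount_le (p := p) hk
  have hE : 3 * n + 1 ≤ addressBound c n := by simp only [addressBound]; omega
  have hadd : ∀ x, x ≤ sumBase c n k p + 1 → x.size ≤ sizeBound c n := by
    intro x hx
    have := size_le_of_le_mul hp (hx.trans (sumBase_lt hk))
    simp only [sizeBound]
    omega
  have hcount : ∀ r < 7, params c n k p r ≤ sizeBound c n := by
    intro r hr
    interval_cases r
    · rw [hR.r0]; simp only [sizeBound]; omega
    · rw [hR.r1]; simp only [sizeBound]; omega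
    · rw [hR.r2]; simp only [sizeBound]; omega
    · rw [hR.r3]; simp only [sizeBound]; omega
    · rw [hR.r4]; simp only [sizeBound]; omega
    · rw [hR.r5]; simp only [sizeBound]; omega
    · rw [hR.r6]; simp only [sizeBound]; omega
  refine ⟨hcount, fun r hr => ?_, hμ⟩
  rcases lt_or_ge r 7 with h7 | h7
  · exact (size_le_self _).trans (hcount r h7)
  rcases lt_or_ge 18 r with h18 | h18
  · rw [show params c n k p r = 0 from List.getD_eq_default _ _ h18]
    simp
  interval_cases r
  · rw [hR.r7]
    refine (size_le_of_le_two_pow le_rfl).trans ?_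
    simp only [sizeBound]; omega
  · rw [hR.r8]
    refine (size_le_of_le_two_pow le_rfl).trans ?_
    simp only [sizeBound]; omega
  · rw [hR.r9, ← pow_mul]
    refine (size_le_of_le_two_pow le_rfl).trans ?_
    simp only [sizeBound]; omega
  · rw [hR.r10]
    refine (size_le_self _).trans ?_
    simp only [sizeBound]; omega
  · refine hadd _ ?_
    rw [hR.r11]; simp only [sumBase, walkBase, cliqueBase]; omega
  · refine hadd _ ?_
    rw [hR.r12]; simp only [sumBase, walkBase, cliqueBase, coinCount]; omega
  · refine hadd _ ?_
    rw [hR.r13]; simp only [sumBase, walkBase]; omega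
  · refine hadd _ ?_
    rw [hR.r14]; simp only [sumBase, walkBase]; omega
  · refine hadd _ ?_
    rw [hR.r15]; simp only [sumBase]; omega
  · refine hadd _ ?_
    rw [hR.r16]; simp only [sumBase]; omega
  · refine hadd _ ?_
    rw [hR.r17]; omega
  · exact hadd _ hR.r18.le

variable {ω : ℕ → Bool}

theorem card_le_of_lt (hS : ∀ v ∈ S, v < n) : S.card ≤ n := by
  simpa using card_le_card (show S ⊆ range n from fun v hv => mem_range.2 (hS v hv))

/-- The value at `2 ^ digitBits c n` of the random polynomial number `t`. -/
def coinNumber (ω : ℕ → Bool) (c n t : ℕ) : ℕ := coinPoly ω (coeffCount c n) (2 ^ digitBits c n) t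

theorem coinNumber_add_one_le (ω : ℕ → Bool) (c n t : ℕ) :
    coinNumber ω c n t + 1 ≤ 2 ^ (digitBits c n * coeffCount c n) :=
  coinPoly_lt ω (Nat.succ_pos _) _ _

theorem size_cliqueTable_le (hS : S.card ≤ n) (N t : ℕ) :
    (cliqueTable H S n N (coinNumber ω c n) t).size ≤ sizeBound c n := by
  have h1 := cliqueSum_le (H := H) (n := n) (δ := digitBits c n * coeffCount c n)
    (w := vertexVar (coinNumber ω c n) (N + n) N (t % N))
    (fun v => coinNumber_add_one_le ω c n _)
    ((card_le_card (decode_subset S (t / N))).trans hS)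
  refine (size_le_of_le_two_pow h1).trans ?_
  have h2 : digitBits c n * coeffCount c n * n ≤
      (3 * n + digitBits c n * coeffCount c n * (n + 1)) * (3 * n) := by
    rcases Nat.eq_zero_or_pos n with rfl | hn
    · simp
    · refine le_trans ?_ (Nat.le_mul_of_pos_right _ (by omega))
      exact le_add_left (Nat.mul_le_mul_left _ (Nat.le_succ n))
  simp only [sizeBound]
  omega

theorem maskMatrix_le (hS : S.card ≤ n) (N a i j : ℕ) :
    maskMatrix H S n N (coinNumber ω c n) a i j ≤
      2 ^ (digitBits c n * coeffCount c n * (n + 1)) :=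
  slotMatrix_le (fun _ _ => coinNumber_add_one_le ω c n _)
    (fun _ _ => coinNumber_add_one_le ω c n _) ((card_le_card (decode_subset S a)).trans hS) i j

theorem size_walkTable_le (hS : S.card ≤ n) {N : ℕ} (hN : N ≤ 3 * n) (t : ℕ) :
    (walkTable H S n N (coinNumber ω c n) t).size ≤ sizeBound c n := by
  have h1 := walk_le (N := N) (maskMatrix_le (H := H) (ω := ω) (c := c) hS N (t / N / (N + 1) / N))
    (t / N / (N + 1) % N) (t / N % (N + 1)) (t % N)
  refine (size_le_of_le_two_pow h1).trans ?_
  have h2 : t / N % (N + 1) ≤ 3 * n := by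
    have := Nat.mod_lt (t / N) (show 0 < N + 1 by omega)
    omega
  have h3 : (N + digitBits c n * coeffCount c n * (n + 1)) * (t / N % (N + 1)) ≤
      (3 * n + digitBits c n * coeffCount c n * (n + 1)) * (3 * n) := by gcongr
  simp only [sizeBound]
  omega

/-- Every subset of `S` has exactly one mask below `2 ^ S.card`, so the last partial sum is the sum
over all subsets. -/
theorem sumTable_last (N : ℕ) (ξ : ℕ → ℕ) (z : ℕ) :
    sumTable H S n N ξ z (2 ^ S.card - 1) = coverValue H S N (N + n) ξ z := by
  rw [sumTable, Nat.sub_add_cancel Nat.one_le_two_pow, coverValue, coverSum]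
  exact sum_decode (S := S) fun X => detSeries (slotMatrix H S (edgeVar ξ (N + n))
    (vertexVar ξ (N + n) N) X) N z

theorem size_sumTable_le (hS : S.card ≤ n) {N : ℕ} (hN : N ≤ 3 * n) {t : ℕ}
    (ht : t < 2 ^ S.card) :
    (sumTable H S n N (coinNumber ω c n) ((2 ^ digitBits c n) ^ digitCount c n) t).size ≤
      sizeBound c n := by
  have h1 : sumTable H S n N (coinNumber ω c n) ((2 ^ digitBits c n) ^ digitCount c n) t ≤
      sumTable H S n N (coinNumber ω c n) ((2 ^ digitBits c n) ^ digitCount c n)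
        (2 ^ S.card - 1) :=
    sum_le_sum_of_subset (range_subset_range.2 (by omega))
  rw [sumTable_last] at h1
  have h2 := coverSum_le (H := H) (S := S) (N := N) (n := n)
    (x := edgeVar (coinNumber ω c n) (N + n)) (w := vertexVar (coinNumber ω c n) (N + n) N)
    (δ := digitBits c n * coeffCount c n) (ζ := digitBits c n * digitCount c n)
    (z := (2 ^ digitBits c n) ^ digitCount c n)
    (fun _ _ => coinNumber_add_one_le ω c n _) (fun _ _ => coinNumber_add_one_le ω c n _)
    (by rw [← pow_mul]) hS
  refine (size_le_of_le_two_pow (h1.trans h2)).trans ?_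
  have h3 := coverSumBits_mono (n := n) (δ := digitBits c n * coeffCount c n)
    (ζ := digitBits c n * digitCount c n) hN
  simp only [sizeBound]
  omega

/-- Reading off the answer from the last entry of the table of accumulated determinant series. -/
theorem exists_odd_digit_iff_hafnianSum (hS : S.card ≤ n) {N : ℕ} (hN : N ≤ 3 * n) :
    (∃ j < digitCount c n, (sumTable H S n N (coinNumber ω c n)
      ((2 ^ digitBits c n) ^ digitCount c n) (2 ^ S.card - 1) /
        ((2 ^ digitBits c n) ^ digitCount c n) ^ N %
      (2 ^ digitBits c n) ^ digitCount c n) / (2 ^ digitBits c n) ^ j % 2 ≠ 0) ↔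
    hafnianSum H S N (edgeVar (coinPoly ω (coeffCount c n) (.X : Polynomial (ZMod 2))) (N + n))
      (vertexVar (coinPoly ω (coeffCount c n) (.X : Polynomial (ZMod 2))) (N + n) N) ≠ 0 := by
  rw [sumTable_last]
  refine exists_odd_digit_iff ω (N + n) (coeffCount c n) _ _ (Nat.succ_pos _) ?_ ?_
  · refine lt_of_le_of_lt (coverSum_le (n := n) (δ := coeffCount c n) (ζ := 0)
      (fun _ _ => coinPoly_one_lt ω _ _) (fun _ _ => coinPoly_one_lt ω _ _) (by simp) hS) ?_
    exact Nat.pow_lt_pow_right (by norm_num) (Nat.lt_succ_of_le (coverSumBits_mono hN))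
  · refine lt_of_le_of_lt (coverSum_le (n := n) (δ := digitBits c n * coeffCount c n) (ζ := 0)
      (fun _ _ => coinNumber_add_one_le ω c n _) (fun _ _ => coinNumber_add_one_le ω c n _)
      (by simp) hS) ?_
    rw [← pow_mul]
    refine Nat.pow_lt_pow_right (by norm_num) ?_
    refine lt_of_lt_of_le (Nat.lt_succ_of_le (coverSumBits_mono hN)) ?_
    exact Nat.le_mul_of_pos_left _ (Nat.succ_pos _)

end Bounds
end RAM

/-! ### The program and its running time. -/

namespace RAM

open Term

section Program

/-- The program for the case of fewer colors than vertices. -/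
def mainProg (co : Bool) (c : ℕ) : Prog :=
  .seq (setTerms 2 (paramTerms c)) (.seq (fillCoins 11 12) (.seq (fillTable 13 14 (cliqueTerm co))
    (.seq (fillTable 15 16 (walkTerm co)) (.seq (fillTable 18 7 sumTerm) (setTerm 0 answerTerm)))))

/-- The whole program. -/
def coverProg (co : Bool) (c : ℕ) : Prog :=
  .cond (.bin .sub (.reg 0) (.reg 1)) (mainProg co c) (.assign 0 (.lit 1))

/-- The time bound for filling a table with `C` entries, with time bound `t` for each of them. -/
def tableTime (M t C : ℕ) : ℕ :=
  2 + (((C + 1) * (1 + (3 + 4 * M)) + C * (t + ((6 + 8 * M) + (6 + 3 * M)))) + 2)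

/-- The time bound for flipping `C` coins. -/
def coinsTime (M C : ℕ) : ℕ :=
  2 + (((C + 1) * (1 + (3 + 4 * M)) + C * (1 + ((9 + 6 * M) + (6 + 3 * M)))) + (2 + 2))

/-- Loop times are affine in the table length, so `2 ^ p` can be pulled out once. -/
theorem affine_le_two_pow_mul {C p E : ℕ} (A B u v : ℕ) (h : C ≤ 2 ^ p * E) :
    u + (((C + 1) * A + C * B) + v) ≤ 2 ^ p * (u + (((E + 1) * A + E * B) + v)) := by
  have h1 : 1 ≤ 2 ^ p := Nat.one_le_two_pow
  calc u + (((C + 1) * A + C * B) + v)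
      ≤ 2 ^ p * u + (((2 ^ p * E + 2 ^ p * 1) * A + 2 ^ p * E * B) + 2 ^ p * v) := by
        gcongr
        · exact le_two_pow_mul p u
        · omega
        · exact le_two_pow_mul p v
    _ = _ := by ring

theorem tableTime_le {M t C p E : ℕ} (h : C ≤ 2 ^ p * E) :
    tableTime M t C ≤ 2 ^ p * tableTime M t E :=
  affine_le_two_pow_mul _ _ _ _ h

theorem coinsTime_le {M C p E : ℕ} (h : C ≤ 2 ^ p * E) :
    coinsTime M C ≤ 2 ^ p * coinsTime M E :=
  affine_le_two_pow_mul _ _ _ _ h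

/-- The polynomial factor of the running time of the main program. -/
def mainTime (co : Bool) (c n : ℕ) : ℕ :=
  setTermsTime (sizeBound c n) (paramTerms c) +
    (coinsTime (sizeBound c n) (addressBound c n) +
    (tableTime (sizeBound c n) ((cliqueTerm co).ct (sizeBound c n)) (addressBound c n) +
    (tableTime (sizeBound c n) ((walkTerm co).ct (sizeBound c n)) (addressBound c n) +
    (tableTime (sizeBound c n) (sumTerm.ct (sizeBound c n)) (addressBound c n) +
    (answerTerm.ct (sizeBound c n) + (2 + 2 * answerTerm.sz (sizeBound c n)))))))

theorem PolyBdd.tableTime {M t C : ℕ → ℕ} (hM : PolyBdd M) (ht : PolyBdd t) (hC : PolyBdd C) :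
    PolyBdd fun n => tableTime (M n) (t n) (C n) := by
  have K := PolyBdd.const
  exact (K 2).add ((((hC.add (K 1)).mul ((K 1).add ((K 3).add ((K 4).mul hM)))).add
    (hC.mul (ht.add (((K 6).add ((K 8).mul hM)).add ((K 6).add ((K 3).mul hM)))))).add (K 2))

theorem PolyBdd.coinsTime {M C : ℕ → ℕ} (hM : PolyBdd M) (hC : PolyBdd C) :
    PolyBdd fun n => coinsTime (M n) (C n) := by
  have K := PolyBdd.const
  exact (K 2).add ((((hC.add (K 1)).mul ((K 1).add ((K 3).add ((K 4).mul hM)))).add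
    (hC.mul ((K 1).add (((K 9).add ((K 6).mul hM)).add ((K 6).add ((K 3).mul hM)))))).add
    ((K 2).add (K 2)))

theorem PolyBdd.mainTime (co : Bool) (c : ℕ) : PolyBdd (mainTime co c) := by
  have K := PolyBdd.const
  have hM := PolyBdd.sizeBound c
  have hE := PolyBdd.addressBound c
  exact (PolyBdd.setTermsTime _ hM).add ((PolyBdd.coinsTime hM hE).add
    ((PolyBdd.tableTime hM (PolyBdd.ct _ hM) hE).add
    ((PolyBdd.tableTime hM (PolyBdd.ct _ hM) hE).add
    ((PolyBdd.tableTime hM (PolyBdd.ct _ hM) hE).add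
    ((PolyBdd.ct _ hM).add ((K 2).add ((K 2).mul (PolyBdd.sz _ hM))))))))

variable {n k p c : ℕ} {co : Bool} {H : SimpleGraph ℕ} {S : Finset ℕ} {μ μ' : ℕ → ℕ} {ω : ℕ → Bool}

theorem GraphMem.congr (h : GraphMem co H S n μ) (hμ : ∀ a < n + n * n, μ' a = μ a) :
    GraphMem co H S n μ' where
  lt := h.lt
  set v hv := (hμ v (by omega)).trans (h.set v hv)
  adj u hu v hv huv := by
    have : u * n + v < n * n := mul_add_lt_mul hu hv
    rw [hμ _ (by omega)]
    exact h.adj u hu v hv huv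
  dummy := h.dummy

open Classical in
theorem runs_mainProg (hg : GraphMem co H S n μ) (hz : ∀ a, n + n * n ≤ a → μ a = 0)
    (h1 : ∀ a, μ a ≤ 1) (hp : S.card = p) (hk : k < n) {s : State}
    (hs : At (fun i => if i < 2 then params c n k p i else 0) μ 0 s) :
    Runs ω (mainProg co c) s (2 ^ p * mainTime co c n) fun s' => s'.reg 0 =
      if n - p ≤ 2 * k ∧ hafnianSum H S (slotCount n k p)
        (edgeVar (coinPoly ω (coeffCount c n) (.X : Polynomial (ZMod 2))) (slotCount n k p + n))
        (vertexVar (coinPoly ω (coeffCount c n) (.X : Polynomial (ZMod 2))) (slotCount n k p + n)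
          (slotCount n k p)) ≠ 0 then 1 else 0 := by
  subst hp
  set p := S.card with hpdef
  set M := sizeBound c n with hM
  set E := addressBound c n with hE
  set ρ := params c n k p with hρ
  set N := slotCount n k p with hNdef
  have hpn : p ≤ n := card_le_of_lt hg.lt
  have hN : N ≤ 3 * n := slotCount_le hk
  have hR : Regs ρ n k N (coeffCount c n) (digitCount c n) (digitBits c n) (2 ^ p) (n + n * n)
    (cliqueBase c n k p) (walkBase c n k p) (sumBase c n k p) := regs_params c n k p
  have hM1 : 1 ≤ M := by rw [hM, sizeBound]; omega
  have hμ : ∀ a, (μ a).size ≤ M := fun a => (size_le_self _).trans ((h1 a).trans hM1)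
  have h0 : ∀ r, 18 < r → ρ r = 0 := fun r hr => List.getD_eq_default _ _ hr
  have hρ19 : (fun i => if i < 2 + (paramTerms c).length then ρ i else 0) = ρ := by
    funext i
    have : (paramTerms c).length = 17 := rfl
    rw [this]
    split
    · rfl
    · exact (h0 i (by omega)).symm
  have hW := walk_length_le (p := p) hk
  have hV := coinCount_le (c := c) (p := p) hk
  have hE1 : 1 ≤ E := by rw [hE, addressBound]; omega
  set ξ := coinNumber ω c n with hξ
  set μ₁ := filled μ (n + n * n) (fun j => (ω j).toNat) (coinCount c n k p) with hμ₁
  set μ₂ := filled μ₁ (cliqueBase c n k p) (cliqueTable H S n N ξ) (2 ^ p * N) with hμ₂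
  set μ₃ := filled μ₂ (walkBase c n k p) (walkTable H S n N ξ) (2 ^ p * N * (N + 1) * N) with hμ₃
  set Z := (2 ^ digitBits c n) ^ digitCount c n with hZ
  set μ₄ := filled μ₃ (sumBase c n k p + 1) (sumTable H S n N ξ Z) (2 ^ p) with hμ₄
  have hcb : n + n * n + coinCount c n k p = cliqueBase c n k p := rfl
  have hfb : cliqueBase c n k p + 2 ^ p * N = walkBase c n k p := rfl
  have hwb : walkBase c n k p + 2 ^ p * N * (N + 1) * N = sumBase c n k p := rfl
  have hsz₁ : ∀ a, (μ₁ a).size ≤ M := size_filled_le hμ fun j _ =>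
    (size_le_self _).trans ((Bool.toNat_le _).trans hM1)
  have hf : ∀ t, (cliqueTable H S n N ξ t).size ≤ M := size_cliqueTable_le hpn N
  have hsz₂ : ∀ a, (μ₂ a).size ≤ M := size_filled_le hsz₁ fun j _ => hf j
  have hw : ∀ t, (walkTable H S n N ξ t).size ≤ M := size_walkTable_le hpn hN
  have hsz₃ : ∀ a, (μ₃ a).size ≤ M := size_filled_le hsz₂ fun j _ => hw j
  have hsum : ∀ t < 2 ^ p, (sumTable H S n N ξ Z t).size ≤ M := fun t ht =>
    size_sumTable_le hpn hN ht
  have hsz₄ : ∀ a, (μ₄ a).size ≤ M := size_filled_le hsz₃ hsum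
  -- Arbitrary `g` and `C` are allowed because the graph is also read while the table is only partly
  -- filled.
  have hg₁ : ∀ g C, GraphMem co H S n (filled μ₁ (cliqueBase c n k p) g C) := fun g C =>
    hg.congr fun a ha => by
      rw [filled_of_lt (by omega), hμ₁, filled_of_lt (by omega)]
  have hg₂ : ∀ g C, GraphMem co H S n (filled μ₂ (walkBase c n k p) g C) := fun g C =>
    (hg₁ (cliqueTable H S n N ξ) (2 ^ p * N)).congr fun a ha => filled_of_lt (by omega)
  have hc₁ : ∀ g C, CoinMem ω (N * (N + n) * coeffCount c n) (n + n * n)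
      (filled μ₁ (cliqueBase c n k p) g C) := by
    intro g C t ht
    have ht' : t < coinCount c n k p := ht
    rw [filled_of_lt (by omega), hμ₁, filled_add ht']
  have hc₂ : ∀ g C, CoinMem ω (N * (N + n) * coeffCount c n) (n + n * n)
      (filled μ₂ (walkBase c n k p) g C) := by
    intro g C t ht
    have ht' : t < coinCount c n k p := ht
    rw [filled_of_lt (by omega)]
    exact hc₁ _ _ t ht
  have hf₂ : ∀ g C, ∀ i < 2 ^ p * N, filled μ₂ (walkBase c n k p) g C (cliqueBase c n k p + i) =
      cliqueTable H S n N ξ i := by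
    intro g C i hi
    rw [filled_of_lt (by omega), hμ₂, filled_add hi]
  have hw₃ : ∀ g C, ∀ i < 2 ^ p * N * (N + 1) * N,
      filled μ₃ (sumBase c n k p + 1) g C (walkBase c n k p + i) = walkTable H S n N ξ i := by
    intro g C i hi
    rw [filled_of_lt (by omega), hμ₃, filled_add hi]
  -- The walk table ends just before this cell and the last table starts just after it, so it keeps
  -- its initial value.
  have hμ₃0 : μ₃ (sumBase c n k p) = 0 := by
    rw [hμ₃, filled_of_ge (by omega), hμ₂, filled_of_ge (by omega), hμ₁, filled_of_ge (by omega),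
      hz _ (by omega)]
  refine Runs.mono (T := setTermsTime M (paramTerms c) +
    (coinsTime M (coinCount c n k p) +
    (tableTime M ((cliqueTerm co).ct M) (2 ^ p * N) +
    (tableTime M ((walkTerm co).ct M) (2 ^ p * N * (N + 1) * N) +
    (tableTime M (sumTerm.ct M) (2 ^ p) +
    (answerTerm.ct M + (2 + 2 * answerTerm.sz M))))))) ?_ ?_ (fun _ h => h)
  · refine (runs_setTerms (bounded_params hk hpn hμ) _ 2 s (wf_paramTerms c) hs
      (val_paramTerms hg rfl)).seq fun s₁ hs₁ => ?_
    rw [hρ19] at hs₁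
    have t1 := runs_fillCoins (ω := ω) (b := 11) (c := 12) hs₁ (bounded_params hk hpn hμ)
      (h0 19 (by norm_num)) (h0 20 (by norm_num)) (by norm_num) (by norm_num)
    rw [hR.r11, hR.r12] at t1
    refine t1.seq fun s₂ hs₂ => ?_
    have t2 := runs_fillTable (ω := ω) (b := 13) (c := 14) (e := cliqueTerm co)
      (g := cliqueTable H S n N ξ) hs₂ (bounded_params hk hpn hsz₁) (by cases co <;> rfl)
      (h0 19 (by norm_num)) (by norm_num) (by norm_num) (fun j _ => hf j) (by
        intro j hj
        rw [hR.r14] at hj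
        rw [hR.r13]
        exact val_cliqueTerm (hR.update (by norm_num)) (hg₁ _ _) (hc₁ _ _)
          (Function.update_self ..) hj fun i hi => filled_add hi)
    rw [hR.r13, hR.r14] at t2
    refine t2.seq fun s₃ hs₃ => ?_
    have t3 := runs_fillTable (ω := ω) (b := 15) (c := 16) (e := walkTerm co)
      (g := walkTable H S n N ξ) hs₃ (bounded_params hk hpn hsz₂) (by cases co <;> rfl)
      (h0 19 (by norm_num)) (by norm_num) (by norm_num) (fun j _ => hw j) (by
        intro j hj
        rw [hR.r16] at hj
        rw [hR.r15]
        exact val_walkTerm (hR.update (by norm_num)) (hg₂ _ _) (hc₂ _ _) (hf₂ _ _)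
          (Function.update_self ..) hj fun i hi => filled_add hi)
    rw [hR.r15, hR.r16] at t3
    refine t3.seq fun s₄ hs₄ => ?_
    have t4 := runs_fillTable (ω := ω) (b := 18) (c := 7) (e := sumTerm)
      (g := sumTable H S n N ξ Z) hs₄ (bounded_params hk hpn hsz₃) rfl
      (h0 19 (by norm_num)) (by norm_num) (by norm_num)
      (fun j hj => hsum j (by rwa [hR.r7] at hj)) (by
        intro j hj
        rw [hR.r7] at hj
        rw [hR.r18]
        refine val_sumTerm (hR.update (by norm_num)) (Function.update_self ..) hj (hw₃ _ _) ?_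
          fun i hi => filled_add hi
        exact (filled_of_lt (by omega)).trans hμ₃0)
    rw [hR.r18, hR.r7] at t4
    refine t4.seq fun s₅ hs₅ => ?_
    refine (runs_setTerm (r := 0) hs₅ (bounded_params hk hpn hsz₄) rfl).mono le_rfl fun s₆ hs₆ => ?_
    have hg₄ : GraphMem co H S n μ₄ :=
      (hg₂ (walkTable H S n N ξ) (2 ^ p * N * (N + 1) * N)).congr fun a ha =>
        filled_of_lt (by omega)
    have hlast : μ₄ (sumBase c n k p + 2 ^ p) = sumTable H S n N ξ Z (2 ^ p - 1) := by
      have : 1 ≤ 2 ^ p := Nat.one_le_two_pow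
      rw [show sumBase c n k p + 2 ^ p = sumBase c n k p + 1 + (2 ^ p - 1) by omega, hμ₄,
        filled_add (by omega)]
    rw [hs₆.reg 0 (by norm_num), Function.update_self]
    exact (val_answerTerm hR hg₄ hlast).trans
      (if_congr (and_congr_right fun _ => exists_odd_digit_iff_hafnianSum hpn hN) rfl rfl)
  · have e1 := le_two_pow_mul p (setTermsTime M (paramTerms c))
    have e2 := coinsTime_le (M := M) (C := coinCount c n k p) (p := p) (E := E)
      ((le_two_pow_mul p _).trans (Nat.mul_le_mul_left _ (by
        rw [hE, addressBound]; omega)))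
    have e3 := tableTime_le (M := M) (t := (cliqueTerm co).ct M) (C := 2 ^ p * N) (p := p) (E := E)
      (Nat.mul_le_mul_left _ (by rw [hE, addressBound]; omega))
    have e4 := tableTime_le (M := M) (t := (walkTerm co).ct M) (C := 2 ^ p * N * (N + 1) * N) (p := p)
      (E := E) (hW.trans (Nat.mul_le_mul_left _ (by rw [hE, addressBound]; omega)))
    have e5 := tableTime_le (M := M) (t := sumTerm.ct M) (C := 2 ^ p) (p := p) (E := E)
      (Nat.le_mul_of_pos_right _ hE1)
    have e6 := le_two_pow_mul p (answerTerm.ct M + (2 + 2 * answerTerm.sz M))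
    refine (add_le_add e1 (add_le_add e2 (add_le_add e3 (add_le_add e4
      (add_le_add e5 e6))))).trans (le_of_eq ?_)
    rw [← mul_add, ← mul_add, ← mul_add, ← mul_add, ← mul_add, mainTime]

end Program
end RAM

/-! ### Correctness on the input state. -/

namespace RAM

section Correctness

variable {n k p c : ℕ} {co : Bool} {S : Finset (Fin n)}

theorem graphMem_input (co : Bool) (G : SimpleGraph (Fin n)) (S : Finset (Fin n)) (k : ℕ) :
    GraphMem co (slotGraph (bif co then Gᶜ else G)) (slotSet S) n (input G S k).mem := by
  classical
  have hadj : ∀ u (hu : u < n), ∀ v (hv : v < n), (input G S k).mem (n + u * n + v) =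
      if G.Adj ⟨u, hu⟩ ⟨v, hv⟩ then 1 else 0 := by
    intro u hu v hv
    refine if_congr ⟨?_, fun h => Or.inr ⟨⟨u, hu⟩, ⟨v, hv⟩, rfl, h⟩⟩ rfl rfl
    rintro (⟨w, hw, _⟩ | ⟨u', v', hw, h⟩)
    · have := w.2
      omega
    · have h1 : u * n + v = u' * n + v' := by omega
      have h2 : u = u' := by
        rw [← mul_add_div_of_lt (a := u) hv, h1, mul_add_div_of_lt v'.2]
      have h3 : v = v' := by
        rw [← mul_add_mod_of_lt (a := u) hv, h1, mul_add_mod_of_lt v'.2]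
      subst h2 h3
      exact h
  refine ⟨fun v hv => (mem_slotSet.1 hv).1, fun v hv => ?_, fun u hu v hv huv => ?_,
    fun i j hij h => ⟨hij, fun hi hj => ?_⟩⟩
  · refine if_congr ⟨?_, fun h => ?_⟩ rfl rfl
    · rintro (⟨w, rfl, hw⟩ | ⟨u', v', hw, _⟩)
      · exact mem_slotSet.2 ⟨w.2, hw⟩
      · omega
    · obtain ⟨h1, h2⟩ := mem_slotSet.1 h
      exact Or.inl ⟨⟨v, h1⟩, rfl, h2⟩
  · have hne : (⟨u, hu⟩ : Fin n) ≠ ⟨v, hv⟩ := fun h => huv (congrArg Fin.val h)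
    cases co with
    | false =>
      simp only [cond_false, hadj u hu v hv]
      exact if_congr ⟨fun h => ⟨huv, fun _ _ => h⟩, fun h => h.2 hu hv⟩ rfl rfl
    | true =>
      simp only [cond_true, hadj u hu v hv]
      by_cases h : G.Adj ⟨u, hu⟩ ⟨v, hv⟩
      · rw [if_pos h, if_neg fun h' => ((SimpleGraph.compl_adj _ _ _).1 (h'.2 hu hv)).2 h]
      · rw [if_neg h, if_pos ⟨huv, fun _ _ => (SimpleGraph.compl_adj _ _ _).2 ⟨hne, h⟩⟩]
  · omega

theorem input_mem_of_le (G : SimpleGraph (Fin n)) (S : Finset (Fin n)) (k : ℕ) {a : ℕ}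
    (ha : n + n * n ≤ a) : (input G S k).mem a = 0 := by
  refine if_neg ?_
  rintro (⟨w, rfl, _⟩ | ⟨u, v, rfl, _⟩)
  · have := w.2
    omega
  · have := mul_add_lt_mul u.2 v.2
    omega

theorem input_mem_le_one (G : SimpleGraph (Fin n)) (S : Finset (Fin n)) (k a : ℕ) :
    (input G S k).mem a ≤ 1 := by
  simp only [input]
  split_ifs <;> simp

theorem at_input (c : ℕ) (G : SimpleGraph (Fin n)) (S : Finset (Fin n)) (k p : ℕ) :
    At (fun i => if i < 2 then params c n k p i else 0) (input G S k).mem 0 (input G S k) := by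
  refine ⟨fun r _ => ?_, rfl, rfl⟩
  rcases r with _ | _ | r
  · rfl
  · rfl
  · simp [input]

/-- This comparison is the only step charged for a possibly huge `k`; afterwards either `k < n`, or
`k` is not touched again. -/
theorem cost_test_input (G : SimpleGraph (Fin n)) (S : Finset (Fin n)) (k : ℕ) :
    1 + (Exp.bin .sub (.reg 0) (.reg 1)).cost (input G S k) ≤ 4 + 2 * n + 2 * k.size := by
  have := size_le_self n
  simp only [Exp.cost, Exp.val, input, if_true, one_ne_zero, if_false]
  omega

theorem decides_of_runs {P : Prog} {s : State} {A : Prop} {T : ℕ} {ε : ℝ≥0∞}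
    {B : (ℕ → Bool) → Prop}
    (h : ∀ ω, Runs ω P s T fun s' => (B ω → s'.reg 0 = 1) ∧ (¬ B ω → s'.reg 0 = 0))
    (hε : coinMeasure {ω | ¬ (A ↔ B ω)} ≤ ε) : Decides P s A T ε := by
  refine ⟨fun ω => ?_, (MeasureTheory.measure_mono ?_).trans hε⟩
  · obtain ⟨s', t, he, ht, _⟩ := h ω
    exact ⟨s', t, he, ht⟩
  · intro ω hω hAB
    refine hω ?_
    obtain ⟨s', t, he, _, h1, h0⟩ := h ω
    refine ⟨s', t, he, ?_⟩
    by_cases hA : A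
    · exact Or.inl ⟨hA, h1 (hAB.1 hA)⟩
    · exact Or.inr ⟨hA, h0 fun hB => hA (hAB.2 hB)⟩

/-- A positive answer always comes with a colouring, so errors occur only on colourable instances,
when the random weights annihilate the sum of hafnians. For `k ≥ n` every vertex can have its own
colour. -/
theorem decides_coverProg (co : Bool) (c : ℕ) (G : SimpleGraph (Fin n)) (hk : 0 < k)
    (hp : S.card = p) (hS : TriangleFreeOff (bif co then Gᶜ else G) S) :
    Decides (coverProg co c) (input G S k) ((bif co then Gᶜ else G)ᶜ.Colorable k)
      (2 ^ p * (4 + 2 * n + (mainTime co c n + 4)) + 2 * k.size) (1 / ((n : ℝ≥0∞) + 2) ^ c) := by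
  classical
  set K := bif co then Gᶜ else G with hK
  have hcost := cost_test_input G S k
  have h2p := le_two_pow_mul p (4 + 2 * n)
  have h2p' := le_two_pow_mul p 4
  rcases lt_or_ge k n with hkn | hkn
  · set N := slotCount n k p with hN
    let F : (ℕ → Bool) → Prop := fun ω => hafnianSum (slotGraph K) (slotSet S) N
      (edgeVar (coinPoly ω (coeffCount c n) (.X : Polynomial (ZMod 2))) (N + n))
      (vertexVar (coinPoly ω (coeffCount c n) (.X : Polynomial (ZMod 2))) (N + n) N) ≠ 0
    refine decides_of_runs (B := fun ω => n - p ≤ 2 * k ∧ F ω) (fun ω => ?_) ?_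
    · refine (Runs.cond_true (T := 2 ^ p * mainTime co c n) ?_
        (runs_mainProg (ω := ω) (graphMem_input co G S k) (fun a => input_mem_of_le G S k)
          (input_mem_le_one G S k) ((card_slotSet S).trans hp) hkn
          (at_input c G S k p))).mono ?_ fun s' hs' => ?_
      · change n - k ≠ 0
        omega
      · rw [mul_add, mul_add _ (mainTime co c n)]
        omega
      · exact ⟨fun h => hs'.trans (if_pos h), fun h => hs'.trans (if_neg h)⟩
    · have hsound : ∀ ω, n - p ≤ 2 * k ∧ F ω → Kᶜ.Colorable k := by
        rintro ω ⟨h1, h2⟩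
        subst hp
        exact colorable_of_hafnianSum_ne_zero h1 h2
      by_cases hcol : Kᶜ.Colorable k
      · have hle : n - p ≤ 2 * k := hp ▸ card_compl_le_of_colorable hS hcol
        have hsub : {ω | ¬ (Kᶜ.Colorable k ↔ n - p ≤ 2 * k ∧ F ω)} ⊆ {ω | ¬ F ω} :=
          fun ω hω hF => hω ⟨fun _ => ⟨hle, hF⟩, fun _ => hcol⟩
        refine (MeasureTheory.measure_mono hsub).trans ?_
        have hd : 0 < coeffCount c n := Nat.mul_pos (by omega) (by omega)
        have h1 := exists_hafnianSum_eq_one (R := Polynomial (ZMod 2)) hk hS hcol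
        rw [hp] at h1
        have h3 := coinMeasure_hafnianSum_eq_zero_le (n := n) hd
          (fun i hi => (mem_slotSet.1 hi).1) h1
        refine (le_of_eq ?_).trans (h3.trans (error_bound n c N _ (slotCount_le hkn) rfl))
        congr 1
        ext ω
        exact not_not
      · have : {ω | ¬ (Kᶜ.Colorable k ↔ n - p ≤ 2 * k ∧ F ω)} = ∅ := by
          refine Set.eq_empty_of_forall_notMem fun ω hω => hω ?_
          exact ⟨fun h => absurd h hcol, fun h => absurd (hsound ω h) hcol⟩
        rw [this]
        simp
  · refine decides_of_runs (B := fun _ => True) (fun ω => ?_) ?_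
    · refine (Runs.cond_false (T := 4) ?_ (Runs.assign (T := 4)
        (Q := fun s' => s'.reg 0 = 1) ?_ ?_)).mono ?_ fun s' hs' => ⟨fun _ => hs', fun h => ?_⟩
      · change n - k = 0
        omega
      · simp [Exp.cost, Exp.val]
      · simp [Exp.val]
      · rw [mul_add, mul_add _ (mainTime co c n)]
        omega
      · exact absurd trivial h
    · have hcol : Kᶜ.Colorable k :=
        (SimpleGraph.colorable_of_fintype Kᶜ).mono (by simpa using hkn)
      have : {ω : ℕ → Bool | ¬ (Kᶜ.Colorable k ↔ True)} = ∅ := by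
        refine Set.eq_empty_of_forall_notMem fun ω hω => hω ?_
        exact ⟨fun _ => trivial, fun _ => hcol⟩
      rw [this]
      simp

theorem exists_program (co : Bool) (c : ℕ) : ∃ (P : Prog) (q : Polynomial ℕ) (C : ℕ),
    ∀ (n p k : ℕ) (G : SimpleGraph (Fin n)) (S : Finset (Fin n)), 0 < k → S.card = p →
      TriangleFreeOff (bif co then Gᶜ else G) S →
        Decides P (input G S k) ((bif co then Gᶜ else G)ᶜ.Colorable k)
          (2 ^ p * q.eval n + C * k.size) (1 / ((n : ℝ≥0∞) + 2) ^ c) := by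
  obtain ⟨q, hq⟩ := ((PolyBdd.const 4).add ((PolyBdd.const 2).mul PolyBdd.id)).add
    ((PolyBdd.mainTime co c).add (PolyBdd.const 4))
  refine ⟨coverProg co c, q, 2, fun n p k G S hk hp hS => ?_⟩
  obtain ⟨h1, h2⟩ := decides_coverProg co c G hk hp hS
  refine ⟨fun ω => ?_, h2⟩
  obtain ⟨s', t, he, ht⟩ := h1 ω
  refine ⟨s', t, he, ht.trans ?_⟩
  have := hq n
  gcongr

end Correctness

end RAM

theorem lemma3 :
    RAM.SolvableInRandomizedTwoPow
      (fun {n : ℕ} (G : SimpleGraph (Fin n)) (S : Finset (Fin n)) =>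
        IsFreeModulator ((⊤ : SimpleGraph (Fin 3))ᶜ) G S)
      (fun {n : ℕ} (G : SimpleGraph (Fin n)) (k : ℕ) => G.Colorable k) ∧
    RAM.SolvableInRandomizedTwoPow
      (fun {n : ℕ} (G : SimpleGraph (Fin n)) (S : Finset (Fin n)) =>
        IsFreeModulator (⊤ : SimpleGraph (Fin 3)) G S)
      (fun {n : ℕ} (G : SimpleGraph (Fin n)) (k : ℕ) => HasCliqueCover G k) := by
  -- One construction serves both problems: with the flag `true` the adjacency matrix is read
  -- complemented, and colouring `G` is covering `Gᶜ` by cliques.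
  refine ⟨fun c => ?_, fun c => ?_⟩
  · obtain ⟨P, q, C, h⟩ := RAM.exists_program true c
    refine ⟨P, q, C, fun n p k G S hk hp hS => ?_⟩
    have := h n p k G S hk hp hS.triangleFreeOff_compl
    rwa [cond_true, compl_compl] at this
  · obtain ⟨P, q, C, h⟩ := RAM.exists_program false c
    refine ⟨P, q, C, fun n p k G S hk hp hS => ?_⟩
    have := h n p k G S hk hp hS.triangleFreeOff
    rwa [cond_false, ← hasCliqueCover_iff_colorable_compl] at this
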